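/- Let $(W,\lambda)$ be a $2n$-dimensional Liouville domain: a compact connected manifold with boundary, with a one-form $\lambda$ such that $\omega=d\lambda$ is symplectic and the vector field $Y$ given by $\iota_Y\omega=\lambda$ is transverse to $\partial W$ and points outwards. Let $\alpha=\lambda|_{\partial W}$ and let $\hat W=W\cup_{\partial W}(\partial W\times[1,\infty))$ be its completion. The flow of $Y$ identifies an open subset of $\hat W$ with $\partial W\times(0,\infty)$, on which $\rho$ denotes the second coordinate, $\lambda=\rho\alpha$ and $Y=\rho\,\partial/\partial\rho$; there $\alpha$ also denotes its own pull-back by the projection to $\partial W$. Let $X_H$ be the vector field given by $\iota_{X_H}\omega=-dH$. Let $\mathbb T=\mathbb R/\mathbb Z$ and let $J_t$, $t\in\mathbb T$, be a smooth loop of almost complex structures on $\hat W$ such that $\langle\cdot,\cdot\rangle_t=\omega(J_t\cdot,\cdot)$ is a Riemannian metric for every $t$, and which is of contact type on $\partial W\times[\rho_0,\infty)$ for some $\rho_0>0$, that is, $d\rho\circ J_t=\lambda$ there. Let $S=[0,\infty)$ or $S=(-\infty,0]$, and let $\{H_s\}_{s\in S}$ be a smooth family of functions on $\hat W$ such that $H_s$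 does not depend on $s$ for $s\in S$ with $|s|\ge 1$; for some $\theta>0$, $$\lambda(X_{H_s}(w))-H_s(w)\ge\theta\qquad\text{for all } s\in S \text{ and } w\in\hat W \text{ with } H_s(w)=0;$$ and $H_s(x,\rho)=h(s,\rho)$ on $\partial W\times[\rho_0,\infty)$ for all $s\in S$, where $h:S\times[\rho_0,\infty)\to\mathbb R$ is smooth and satisfies at least one of the following two sets of conditions for all $(s,\rho)\in S\times[\rho_0,\infty)$: (i) for some constants $\kappa>0$, $\gamma>0$: $\partial_\rho h\ge 0$, $\;h\ge\rho/\kappa$, $\;|\partial_\rho^2h|\le\kappa\rho^\gamma$, $\;|\partial_s\partial_\rho h|\le\kappa\rho^\gamma$; (ii) $\inf h>0$ and, for some constant $\kappa>0$: $\partial_\rho h\ge 0$, $\;|\partial_\rho h|^2\le\kappa(h+1)$, $\;\rho^2|\partial_\rho^2h|^2\le\kappa(h+1)$, $\;|\partial_s\partial_\rho h|^2\le\kappa(h+1)$. For a smooth loop $x:\mathbb T\to\hat W$ and $\eta\in\mathbb R$ let $\mathbb A_H(x,\eta)=\int_{\mathbb T}x^*\lambda-\eta\int_{\mathbb T}H(x(t))\,dt$;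 its gradient is $\nabla\mathbb A_H(x,\eta)=\bigl(J_t(x)(x'-\eta X_H(x)),\,-\int_{\mathbb T}H(x)\,dt\bigr)$, with norm given by $\|(\xi,\tau)\|^2=\int_{\mathbb T}\langle\xi(t),\xi(t)\rangle_t\,dt+\tau^2$. Consider smooth solutions $v=(u,\eta)$, $u:S\times\mathbb T\to\hat W$, $\eta:S\to\mathbb R$, of $$\partial_su+J_t(u)\bigl(\partial_tu-\eta X_{H_s}(u)\bigr)=0,\qquad \eta'(s)=\int_{\mathbb T}H_s(u(s,t))\,dt .\qquad(*)$$ 1. If $S=[0,\infty)$, then for all positive numbers $A,E,\nu$ there is a compact set $K\subset\hat W$ such that every smooth solution $v=(u,\eta)$ of $(*)$ on $S\times\mathbb T$ with $$\sup_{s\in S}|\mathbb A_{H_s}(v(s))|\le A,\qquad \int_S\|\nabla\mathbb A_{H_s}(v(s))\|^2\,ds\le E,$$ $$\alpha\bigl(\partial_tu(0,t)-\eta(0)X_{H_0}(u(0,t))\bigr)\le\nu\quad\text{for all }t\in\mathbb T\text{ with }u(0,t)\in\partial W\times[\rho_0,\infty),\qquad \eta(0)\ge-\nu,$$ satisfies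 $u(s,t)\in K$ for all $(s,t)\in S\times\mathbb T$. 2. If $S=(-\infty,0]$, the same holds with the last two conditions replaced by $$\alpha\bigl(\partial_tu(0,t)-\eta(0)X_{H_0}(u(0,t))\bigr)\ge-\nu\quad\text{for all }t\in\mathbb T\text{ with }u(0,t)\in\partial W\times[\rho_0,\infty),\qquad \eta(0)\le\nu.$$ -/

import Mathlib

open Set Filter Topology Manifold ContDiff MeasureTheory Bundle

noncomputable section

namespace RabinowitzFloer

section Forms

variable {d : ℕ} {M : Type*} [TopologicalSpace M] [ChartedSpace (EuclideanSpace ℝ (Fin d)) M]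

/-- A (not necessarily smooth) one-form on the `d`-dimensional manifold `M`. -/
abbrev OneForm (d : ℕ) (M : Type*) [TopologicalSpace M]
    [ChartedSpace (EuclideanSpace ℝ (Fin d)) M] : Type _ :=
  ∀ p : M, TangentSpace (𝓡 d) p →L[ℝ] ℝ

/-- Smoothness of a one-form, as a section of the cotangent bundle. -/
def OneForm.Smooth [IsManifold (𝓡 d) ∞ M] (lam : OneForm d M) : Prop :=
  ContMDiff (𝓡 d) ((𝓡 d).prod 𝓘(ℝ, EuclideanSpace ℝ (Fin d) →L[ℝ] ℝ)) ∞
    (fun p : M => TotalSpace.mk' (EuclideanSpace ℝ (Fin d) →L[ℝ] ℝ)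
      (E := fun q : M => TangentSpace (𝓡 d) q →L[ℝ] ℝ) p (lam p))

/-- The expression of the one-form `lam` in the preferred chart at `p`: the pull-back of `lam` by
the inverse of that chart. -/
def OneForm.chartRep (lam : OneForm d M) (p : M) (y : EuclideanSpace ℝ (Fin d)) :
    EuclideanSpace ℝ (Fin d) →L[ℝ] ℝ :=
  (lam ((extChartAt (𝓡 d) p).symm y)).comp
    (mfderiv 𝓘(ℝ, EuclideanSpace ℝ (Fin d)) (𝓡 d) (extChartAt (𝓡 d) p).symm y)

/-- The exterior derivative of a one-form at `p`, computed in the preferred chart at `p` (through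
which Mathlib identifies `TangentSpace (𝓡 d) p` with the model space):
`dλ(v, w) = (D_v λ)(w) - (D_w λ)(v)`. -/
def OneForm.extDer (lam : OneForm d M) (p : M) :
    TangentSpace (𝓡 d) p →L[ℝ] TangentSpace (𝓡 d) p →L[ℝ] ℝ :=
  let D : EuclideanSpace ℝ (Fin d) →L[ℝ] EuclideanSpace ℝ (Fin d) →L[ℝ] ℝ :=
    fderiv ℝ (lam.chartRep p) (extChartAt (𝓡 d) p p)
  D - D.flip

/-- The velocity of a curve in `M`. -/
def velocity (d : ℕ) {M : Type*} [TopologicalSpace M] [ChartedSpace (EuclideanSpace ℝ (Fin d)) M]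
    (x : ℝ → M) (t : ℝ) : TangentSpace (𝓡 d) (x t) :=
  mfderiv 𝓘(ℝ, ℝ) (𝓡 d) x t (1 : ℝ)

/-- The velocity of a curve in `M` defined on `S ⊆ ℝ` (one-sided at an end point of `S`). -/
def velocityWithin (d : ℕ) {M : Type*} [TopologicalSpace M]
    [ChartedSpace (EuclideanSpace ℝ (Fin d)) M] (x : ℝ → M) (S : Set ℝ) (s : ℝ) :
    TangentSpace (𝓡 d) (x s) :=
  mfderivWithin 𝓘(ℝ, ℝ) (𝓡 d) x S s (1 : ℝ)

end Forms

/-- The completion `M = W ∪ (∂W × [1, ∞))` of a `2n`-dimensional Liouville domain `W`, where the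
closed manifold `N` is the boundary `∂W`.

* `lam` is the Liouville form, whose exterior derivative is non-degenerate;
* `core` is the Liouville domain `W`, compact and connected;
* `alpha` is the contact form on `N = ∂W`;
* `cyl` is the symplectization `N × (0, ∞) → M`, `(x, ρ) ↦ φ_{log ρ}(x)` (`φ` being the flow of
  the Liouville vector field), a diffeomorphism onto an open subset of `M` which pulls `lam` back
  to `ρ α`; it maps `N × {1}` onto the boundary of `W`, `N × (0, 1]` onto a collar of it in `W`,
  and `N × (1, ∞)` onto the complement of `W`.

It follows that the Liouville vector field is `ρ ∂/∂ρ` on `N × (0, ∞)`: it is transverse to the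
boundary `N × {1}` of `W` and points outwards. -/
structure LiouvilleCompletion (n : ℕ)
    (M : Type*) [TopologicalSpace M] [ChartedSpace (EuclideanSpace ℝ (Fin (2 * n))) M]
    [IsManifold (𝓡 (2 * n)) ∞ M]
    (N : Type*) [TopologicalSpace N] [ChartedSpace (EuclideanSpace ℝ (Fin (2 * n - 1))) N]
    [IsManifold (𝓡 (2 * n - 1)) ∞ N] where
  lam : OneForm (2 * n) M
  lam_smooth : lam.Smooth
  nondegenerate : ∀ (p : M) (v : TangentSpace (𝓡 (2 * n)) p),
    (∀ w : TangentSpace (𝓡 (2 * n)) p, lam.extDer p v w = 0) → v = 0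
  core : Set M
  core_compact : IsCompact core
  core_connected : IsConnected core
  alpha : OneForm (2 * n - 1) N
  alpha_smooth : alpha.Smooth
  cyl : OpenPartialHomeomorph (N × ℝ) M
  cyl_source : cyl.source = univ ×ˢ Ioi 0
  cyl_smooth : ContMDiffOn ((𝓡 (2 * n - 1)).prod 𝓘(ℝ, ℝ)) (𝓡 (2 * n)) ∞ cyl cyl.source
  cyl_symm_smooth :
    ContMDiffOn (𝓡 (2 * n)) ((𝓡 (2 * n - 1)).prod 𝓘(ℝ, ℝ)) ∞ cyl.symm cyl.target
  cyl_lam : ∀ (x : N) (r : ℝ), 0 < r →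
    ∀ (v : TangentSpace (𝓡 (2 * n - 1)) x) (a : ℝ),
      lam (cyl (x, r))
        (mfderiv ((𝓡 (2 * n - 1)).prod 𝓘(ℝ, ℝ)) (𝓡 (2 * n)) cyl (x, r) (v, a)) = r * alpha x v
  core_compl : coreᶜ = cyl '' (univ ×ˢ Ioi 1)
  core_frontier : frontier core = cyl '' (univ ×ˢ {1})

section Liouville

variable {n : ℕ}
  {M : Type*} [TopologicalSpace M] [ChartedSpace (EuclideanSpace ℝ (Fin (2 * n))) M]
  [IsManifold (𝓡 (2 * n)) ∞ M]
  {N : Type*} [TopologicalSpace N] [ChartedSpace (EuclideanSpace ℝ (Fin (2 * n - 1))) N]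
  [IsManifold (𝓡 (2 * n - 1)) ∞ N]

namespace LiouvilleCompletion

variable (D : LiouvilleCompletion n M N)

/-- The symplectic form `ω = dλ`. -/
def omega (p : M) :
    TangentSpace (𝓡 (2 * n)) p →L[ℝ] TangentSpace (𝓡 (2 * n)) p →L[ℝ] ℝ :=
  D.lam.extDer p

/-- The coordinate `ρ` on `∂W × (0, ∞) ⊆ M` (only meaningful there). -/
def radius (w : M) : ℝ := (D.cyl.symm w).2

/-- The subset `∂W × [r₀, ∞)` of `M`, for `r₀ > 0`. -/
def cylEnd (r₀ : ℝ) : Set M := D.cyl '' (univ ×ˢ Ici r₀)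

/-- The form `α` on `∂W × (0, ∞) ⊆ M`: the pull-back of the contact form of `∂W` by the projection
`(x, ρ) ↦ x` (only meaningful on `∂W × (0, ∞)`). -/
def alphaCyl (w : M) (ζ : TangentSpace (𝓡 (2 * n)) w) : ℝ :=
  D.alpha (D.cyl.symm w).1
    (mfderiv (𝓡 (2 * n)) (𝓡 (2 * n - 1)) (fun q : M => (D.cyl.symm q).1) w ζ)

/-- The Hamiltonian vector field `X_H`, defined by `ω(X_H, ·) = -dH`: the inverse of the
isomorphism `v ↦ ω(v, ·)` applied to `-dH`. -/
def hamVF (H : M → ℝ) (p : M) : TangentSpace (𝓡 (2 * n)) p :=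
  let dH : TangentSpace (𝓡 (2 * n)) p →L[ℝ] ℝ := mfderiv (𝓡 (2 * n)) 𝓘(ℝ, ℝ) H p
  (D.omega p).inverse (-dH)

/-- `J` is a smooth loop (that is, `1`-periodic in `t ∈ ℝ`) of `ω`-compatible almost complex
structures: `⟨v, w⟩_t = ω(J_t v, w)` is a loop of Riemannian metrics. -/
structure IsCompatibleLoop
    (J : ℝ → ∀ p : M, TangentSpace (𝓡 (2 * n)) p →L[ℝ] TangentSpace (𝓡 (2 * n)) p) : Prop where
  smooth : ContMDiff (𝓘(ℝ, ℝ).prod (𝓡 (2 * n)))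
    ((𝓡 (2 * n)).prod
      𝓘(ℝ, EuclideanSpace ℝ (Fin (2 * n)) →L[ℝ] EuclideanSpace ℝ (Fin (2 * n)))) ∞
    (fun q : ℝ × M =>
      TotalSpace.mk' (EuclideanSpace ℝ (Fin (2 * n)) →L[ℝ] EuclideanSpace ℝ (Fin (2 * n)))
        (E := fun p : M => TangentSpace (𝓡 (2 * n)) p →L[ℝ] TangentSpace (𝓡 (2 * n)) p)
        q.2 (J q.1 q.2))
  periodic : ∀ t, J (t + 1) = J t
  sq_eq_neg : ∀ t p v, J t p (J t p v) = -v
  symm : ∀ t p v w, D.omega p (J t p v) w = D.omega p (J t p w) v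
  pos : ∀ t p v, v ≠ 0 → 0 < D.omega p (J t p v) v

/-- `J` is of contact type on `∂W × [r₀, ∞)`: `dρ ∘ J_t = λ` there. -/
def IsContactType
    (J : ℝ → ∀ p : M, TangentSpace (𝓡 (2 * n)) p →L[ℝ] TangentSpace (𝓡 (2 * n)) p)
    (r₀ : ℝ) : Prop :=
  ∀ t, ∀ w ∈ D.cylEnd r₀, ∀ ζ : TangentSpace (𝓡 (2 * n)) w,
    mfderiv (𝓡 (2 * n)) 𝓘(ℝ, ℝ) D.radius w (J t w ζ) = D.lam w ζ

/-- The standing assumptions on a smooth family of Hamiltonians `{H_s}`, `s ∈ S`, with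
`S = [0, ∞)` or `S = (-∞, 0]`: it does not depend on `s` for `|s| ≥ 1`, the Liouville
vector field is transverse to the zero level sets, uniformly in `s`, and `H_s(x, ρ) = h(s, ρ)` on
`∂W × [r₀, ∞)` with `h` smooth on `S × [r₀, ∞)`. -/
structure IsHamiltonianFamily (S : Set ℝ) (H : ℝ → M → ℝ) (r₀ : ℝ) (h : ℝ → ℝ → ℝ) : Prop where
  smooth : ContMDiffOn (𝓘(ℝ, ℝ).prod (𝓡 (2 * n))) 𝓘(ℝ, ℝ) ∞
    (fun q : ℝ × M => H q.1 q.2) (S ×ˢ univ)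
  const_pos : ∀ s ∈ S, 1 ≤ s → H s = H 1
  const_neg : ∀ s ∈ S, s ≤ -1 → H s = H (-1)
  transverse : ∃ θ : ℝ, 0 < θ ∧ ∀ s ∈ S, ∀ w : M, H s w = 0 →
    θ ≤ D.lam w (D.hamVF (H s) w) - H s w
  profile_smooth : ContDiffOn ℝ ∞ (fun q : ℝ × ℝ => h q.1 q.2) (S ×ˢ Ici r₀)
  radial : ∀ s ∈ S, ∀ (x : N) (r : ℝ), r₀ ≤ r → H s (D.cyl (x, r)) = h s r

/-- The Rabinowitz action functional `𝔸_H(x, η) = ∫ x^*λ - η ∫ H(x(t)) dt`. -/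
def action (H : M → ℝ) (x : ℝ → M) (η : ℝ) : ℝ :=
  (∫ t in (0 : ℝ)..1, D.lam (x t) (velocity (2 * n) x t)) - η * ∫ t in (0 : ℝ)..1, H (x t)

/-- The loop component `J_t(x)(x' - η X_H(x))` of the gradient of `𝔸_H` at `(x, η)`. -/
def gradLoop (J : ℝ → ∀ p : M, TangentSpace (𝓡 (2 * n)) p →L[ℝ] TangentSpace (𝓡 (2 * n)) p)
    (H : M → ℝ) (x : ℝ → M) (η : ℝ) (t : ℝ) : TangentSpace (𝓡 (2 * n)) (x t) :=
  J t (x t) (velocity (2 * n) x t - η • D.hamVF H (x t))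

/-- The real component `-∫ H(x(t)) dt` of the gradient of `𝔸_H` at `(x, η)`. -/
def gradReal (H : M → ℝ) (x : ℝ → M) : ℝ := -∫ t in (0 : ℝ)..1, H (x t)

/-- `‖∇𝔸_H(x, η)‖²`, for the product of the `L²` metric `∫ ω(J_t ·, ·) dt` and the standard metric
of `ℝ`. -/
def gradNormSq (J : ℝ → ∀ p : M, TangentSpace (𝓡 (2 * n)) p →L[ℝ] TangentSpace (𝓡 (2 * n)) p)
    (H : M → ℝ) (x : ℝ → M) (η : ℝ) : ℝ :=
  (∫ t in (0 : ℝ)..1,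
      D.omega (x t) (J t (x t) (D.gradLoop J H x η t)) (D.gradLoop J H x η t)) +
    gradReal H x ^ 2

/-- `v = (u, η)` is a smooth solution of the Rabinowitz-Floer equation on `S × 𝕋`,
`∂_s u + J_t(u) (∂_t u - η X_{H_s}(u)) = 0`, `η'(s) = ∫ H_s(u(s, t)) dt`. -/
structure IsSolution
    (J : ℝ → ∀ p : M, TangentSpace (𝓡 (2 * n)) p →L[ℝ] TangentSpace (𝓡 (2 * n)) p)
    (S : Set ℝ) (H : ℝ → M → ℝ) (u : ℝ → ℝ → M) (η : ℝ → ℝ) : Prop where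
  u_smooth : ContMDiffOn 𝓘(ℝ, ℝ × ℝ) (𝓡 (2 * n)) ∞ (fun q : ℝ × ℝ => u q.1 q.2) (S ×ˢ univ)
  u_periodic : ∀ s ∈ S, ∀ t, u s (t + 1) = u s t
  η_smooth : ContDiffOn ℝ ∞ η S
  u_eq : ∀ s ∈ S, ∀ t,
    velocityWithin (2 * n) (fun σ => u σ t) S s +
      J t (u s t) (velocity (2 * n) (u s) t - η s • D.hamVF (H s) (u s t)) = 0
  η_eq : ∀ s ∈ S, HasDerivWithinAt η (∫ t in (0 : ℝ)..1, H s (u s t)) S s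

/-- `|𝔸_{H_s}(v(s))| ≤ A` for every `s ∈ S`. -/
def ActionBound (S : Set ℝ) (H : ℝ → M → ℝ) (u : ℝ → ℝ → M) (η : ℝ → ℝ) (A : ℝ) : Prop :=
  ∀ s ∈ S, |D.action (H s) (u s) (η s)| ≤ A

/-- `∫_S ‖∇𝔸_{H_s}(v(s))‖² ds ≤ E`. -/
def EnergyBound
    (J : ℝ → ∀ p : M, TangentSpace (𝓡 (2 * n)) p →L[ℝ] TangentSpace (𝓡 (2 * n)) p)
    (S : Set ℝ) (H : ℝ → M → ℝ) (u : ℝ → ℝ → M) (η : ℝ → ℝ) (E : ℝ) : Prop :=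
  ∫⁻ s in S, ENNReal.ofReal (D.gradNormSq J (H s) (u s) (η s)) ≤ ENNReal.ofReal E

end LiouvilleCompletion

end Liouville

/-- `∂h/∂ρ`, for `h` defined on `S × [r₀, ∞)`. -/
def dRho (r₀ : ℝ) (h : ℝ → ℝ → ℝ) (s r : ℝ) : ℝ := derivWithin (h s) (Ici r₀) r

/-- `∂²h/∂ρ²`, for `h` defined on `S × [r₀, ∞)`. -/
def dRhoRho (r₀ : ℝ) (h : ℝ → ℝ → ℝ) (s r : ℝ) : ℝ := derivWithin (dRho r₀ h s) (Ici r₀) r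

/-- `∂²h/∂s∂ρ`, for `h` defined on `S × [r₀, ∞)`. -/
def dSRho (S : Set ℝ) (r₀ : ℝ) (h : ℝ → ℝ → ℝ) (s r : ℝ) : ℝ :=
  derivWithin (fun σ => dRho r₀ h σ r) S s

/-- The profile `h` is non-decreasing in `ρ`, grows at least linearly, and its derivatives
`∂²h/∂ρ²` and `∂²h/∂s∂ρ` grow at most polynomially. -/
def PolynomialGrowth (S : Set ℝ) (r₀ : ℝ) (h : ℝ → ℝ → ℝ) : Prop :=
  ∃ κ γ : ℝ, 0 < κ ∧ 0 < γ ∧ ∀ s ∈ S, ∀ r, r₀ ≤ r →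
    0 ≤ dRho r₀ h s r ∧ r / κ ≤ h s r ∧
    |dRhoRho r₀ h s r| ≤ κ * r ^ γ ∧ |dSRho S r₀ h s r| ≤ κ * r ^ γ

/-- The profile `h` is non-decreasing in `ρ`, has a positive infimum, and its derivatives are
controlled by `h`. -/
def QuadraticGrowth (S : Set ℝ) (r₀ : ℝ) (h : ℝ → ℝ → ℝ) : Prop :=
  (∃ m : ℝ, 0 < m ∧ ∀ s ∈ S, ∀ r, r₀ ≤ r → m ≤ h s r) ∧
  ∃ κ : ℝ, 0 < κ ∧ ∀ s ∈ S, ∀ r, r₀ ≤ r →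
    0 ≤ dRho r₀ h s r ∧
    |dRho r₀ h s r| ^ 2 ≤ κ * (h s r + 1) ∧
    r ^ 2 * |dRhoRho r₀ h s r| ^ 2 ≤ κ * (h s r + 1) ∧
    |dSRho S r₀ h s r| ^ 2 ≤ κ * (h s r + 1)

end RabinowitzFloer

end

/-! ### Real-variable estimates: confinement of a function with small energy -/

namespace RabinowitzFloer

/-! The bound on `u` is an a priori estimate for the function `F` = `height`, a smooth cutoff of
`log ρ(u) - a` extended by zero to the whole completion. It has three ingredients.

Slices where `F` vanishes. If the gradient of the action is small at `(x, η)`, then `H ∘ x` has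
small mean and small oscillation, so the loop stays where `|H|` is small. In particular it avoids
the end, on which `h` has a positive lower bound. There `λ(X_H) - H ≥ θ`, and the identity `𝔸 = ∫
λ(x' - ηX_H) + η ∫ (λ(X_H) - H)` bounds `η` by the action (`exists_gradient_gap`). By the energy
bound every window of some fixed length `L` contains such a slice, and since `η'` is square
integrable the multiplier is bounded everywhere (`exists_good`).

Differential inequalities for `F`. Contact type gives `|∇ρ(u)|² ≤ ρ |∂_s u|²`, hence `e^F |∇F|² ≤
|∂_s u|²`, which is integrable (`exp_height_mul_le`). Differentiating the equation once more gives
`ΔF ≥ -P (1 + |∂_s F|)`, where `P` dominates the relevant derivatives of `h`; this uses `|η| ≤ C`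
and `η' = ∫ H ≥ -m` (`laplacian_height`). The growth conditions serve to bound `∫ (∫ P² dt)² ds` on
windows of bounded length (`exists_weight`). In case (i) `P` is `c e^{kF}`, and the weighted energy
improves itself to bounds on all exponential integrals by iterating the embedding of `W^{1,1}` into
`L²` (`integral_exp_succ_le`). In case (ii) `P²` is affine in `H`, so `∫ P² dt` is affine in `η'`,
which is in `L²`.

A mean value inequality. Green's identity is applied on `[a, b] × 𝕋` to `F` and to a regularization
of the Green kernel `log(cosh 2πs - cos 2πt)`, reflected so as to satisfy a Neumann condition at `s
= a` (`exists_neumann_kernel`, `exists_pole_bound`). The supremum in `t` of the kernel is in `L⁴` of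
`s`, while `P` is in `L⁴` in `s` and `L²` in `t` and `∂_s F` is in `L²`; the exponents are exactly
those of Hölder's inequality. At slices where `F` vanishes both `F` and `∂_s F` are zero, as `F ≥
0`. At `s = 0` the assumption on `α` is what bounds `∂_s F` from below, because `∂_s log ρ(u) =
-α(∂_t u - ηX_H)` on the end. The left half-line is reduced to the right one by `s ↦ -s`, recorded
by a sign `σ`. -/

theorem abs_sub_le_integral {g g' B : ℝ → ℝ} {a b : ℝ}
    (hg : ∀ x ∈ Icc a b, HasDerivAt g (g' x) x) (hg' : ContinuousOn g' (Icc a b))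
    (hB : ∀ x ∈ Icc a b, |g' x| ≤ B x) (hBi : IntervalIntegrable B volume a b)
    {x y : ℝ} (hx : x ∈ Icc a b) (hy : y ∈ Icc a b) : |g x - g y| ≤ ∫ t in a..b, B t := by
  wlog hxy : y ≤ x generalizing x y
  · rw [abs_sub_comm]
    exact this hy hx (le_of_not_ge hxy)
  have hsub : Icc y x ⊆ Icc a b := Icc_subset_Icc hy.1 hx.2
  have h1 : ∫ t in y..x, g' t = g x - g y := by
    refine intervalIntegral.integral_eq_sub_of_hasDerivAt (fun t ht => hg t (hsub ?_)) ?_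
    · rwa [uIcc_of_le hxy] at ht
    · exact (hg'.mono (by rw [uIcc_of_le hxy]; exact hsub)).intervalIntegrable
  rw [← h1]
  have hab : a ≤ b := hx.1.trans hx.2
  have hBi' : IntervalIntegrable B volume y x := hBi.mono_set (by
    rw [uIcc_of_le hxy, uIcc_of_le hab]; exact hsub)
  refine (intervalIntegral.norm_integral_le_of_norm_le (f := g') hxy
    (ae_of_all _ fun t ht => hB t (hsub (Ioc_subset_Icc_self ht))) hBi').trans ?_
  refine intervalIntegral.integral_mono_interval hy.1 hxy hx.2 ?_ hBi
  rw [EventuallyLE, ae_restrict_iff' measurableSet_Ioc]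
  exact ae_of_all _ fun t ht => (abs_nonneg _).trans (hB t (Ioc_subset_Icc_self ht))

/-- Squaring removes the corner of the positive part: the square is quadratically small at the
origin. -/
theorem hasDerivAt_max_zero_sq (y : ℝ) :
    HasDerivAt (fun y : ℝ => (max y 0) ^ 2) (2 * max y 0) y := by
  rcases lt_trichotomy y 0 with h | h | h
  · rw [max_eq_right h.le, mul_zero]
    refine (hasDerivAt_const y (0 : ℝ)).congr_of_eventuallyEq ?_
    filter_upwards [isOpen_Iio.mem_nhds h] with z hz
    rw [max_eq_right (le_of_lt hz)]
    simp
  · subst h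
    simp only [max_self, mul_zero]
    rw [hasDerivAt_iff_isLittleO]
    simp only [max_self, sub_zero, smul_zero, ne_eq, OfNat.ofNat_ne_zero, not_false_eq_true, zero_pow]
    refine Asymptotics.IsBigO.trans_isLittleO (g := fun y : ℝ => y ^ 2) ?_ ?_
    · refine Asymptotics.IsBigO.of_bound 1 (Eventually.of_forall fun z => ?_)
      rw [one_mul, Real.norm_eq_abs, Real.norm_eq_abs, abs_of_nonneg (sq_nonneg _),
        abs_of_nonneg (sq_nonneg _)]
      rcases le_total z 0 with h | h
      · rw [max_eq_right h]; simpa using sq_nonneg z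
      · rw [max_eq_left h]
    · exact Asymptotics.isLittleO_pow_id (by norm_num)
  · rw [max_eq_left h.le]
    have h1 : HasDerivAt (fun y : ℝ => y ^ 2) (2 * y) y := by simpa using hasDerivAt_pow 2 y
    refine h1.congr_of_eventuallyEq ?_
    filter_upwards [isOpen_Ioi.mem_nhds h] with z hz
    rw [max_eq_left (le_of_lt hz)]

/-- A loop of values with small mean and small energy below the level `μ` stays close to zero. -/
theorem exists_confinement {c μ m δ : ℝ} (hc : 0 < c) (hμ : 0 < μ) (hm : 0 ≤ m) (hδ : 0 < δ)
    (hδμ : δ ≤ μ) :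
    ∃ ε : ℝ, 0 < ε ∧ ε ≤ 1 ∧ ∀ y y' Nf : ℝ → ℝ, (∀ t, HasDerivAt y (y' t) t) → Continuous y' →
      (∀ t, 0 ≤ Nf t) → IntervalIntegrable Nf volume 0 1 →
      (∀ t, y t < μ → y' t ^ 2 ≤ c * Nf t) → (∀ t, -m ≤ y t) →
      ∫ t in (0 : ℝ)..1, Nf t < ε ^ 2 → |∫ t in (0 : ℝ)..1, y t| < ε →
      ∀ t ∈ Icc (0 : ℝ) 1, |y t| ≤ δ := by
  set K := (μ + m) * (c + 1) with hK
  have hK0 : 0 < K := by positivity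
  -- The bound `δ / 2` puts one value of `y` well inside `[-δ, δ]`. The bound `δμ / (4K)` keeps the
  -- oscillation of `max (μ - y) 0 ^ 2` below `δμ / 4`, less than what a value outside `[-δ, δ]`
  -- would require.
  refine ⟨min 1 (min (δ / 2) (δ * μ / (4 * K))), by positivity, min_le_left _ _, ?_⟩
  set ε := min 1 (min (δ / 2) (δ * μ / (4 * K))) with hε
  have hε0 : 0 < ε := by positivity
  have hε1 : ε ≤ δ / 2 := (min_le_right _ _).trans (min_le_left _ _)
  have hε2 : K * ε ≤ δ * μ / 4 := by
    have : ε ≤ δ * μ / (4 * K) := (min_le_right _ _).trans (min_le_right _ _)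
    rw [le_div_iff₀ (by positivity)] at this
    linarith
  intro y y' Nf hy hy' hN0 hNi hyN hym hNε hyε t ht
  have hyc : Continuous y := continuous_iff_continuousAt.2 fun t => (hy t).continuousAt
  obtain ⟨t₀, ht₀, hyt₀⟩ : ∃ t₀ ∈ Icc (0 : ℝ) 1, |y t₀| < ε := by
    obtain ⟨t₀, ht₀, h⟩ := exists_eq_interval_average (f := y) (a := 0) (b := 1) (by norm_num)
      hyc.continuousOn
    refine ⟨t₀, ?_, ?_⟩
    · rw [uIoo_of_le (by norm_num)] at ht₀
      exact ⟨ht₀.1.le, ht₀.2.le⟩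
    · rw [interval_average_eq] at h
      rw [h]
      simpa using hyε
  -- Nothing is known about `y'` where `y ≥ μ`, so the oscillation is measured after a truncation
  -- that is constant there.
  have hg : ∀ x, HasDerivAt (fun x => (max (μ - y x) 0) ^ 2) (2 * max (μ - y x) 0 * (- y' x)) x := by
    intro x
    exact (hasDerivAt_max_zero_sq (μ - y x)).comp x ((hy x).const_sub μ)
  have hB : ∀ x, |2 * max (μ - y x) 0 * (- y' x)| ≤ (μ + m) * (c * Nf x / ε + ε) := by
    intro x
    have hp : 0 ≤ c * Nf x / ε + ε := by
      have := hN0 x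
      positivity
    rcases lt_or_ge (y x) μ with h | h
    · rw [max_eq_left (by linarith), abs_mul, abs_mul, abs_neg, abs_of_nonneg (by linarith : 0 ≤ μ - y x)]
      have h1 : 2 * |y' x| ≤ c * Nf x / ε + ε := by
        have h2 := hyN x h
        have h3 : 2 * |y' x| * ε ≤ c * Nf x + ε ^ 2 := by
          nlinarith [sq_nonneg (|y' x| - ε), sq_abs (y' x)]
        rw [← mul_le_mul_iff_left₀ hε0, add_mul, div_mul_cancel₀ _ hε0.ne']
        nlinarith
      have h4 : μ - y x ≤ μ + m := by linarith [hym x]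
      calc |2| * (μ - y x) * |y' x| = (μ - y x) * (2 * |y' x|) := by rw [abs_two]; ring
        _ ≤ (μ + m) * (c * Nf x / ε + ε) := by gcongr
    · rw [max_eq_right (by linarith)]
      simp only [mul_zero, zero_mul, abs_zero]
      positivity
  have hmain := abs_sub_le_integral (a := 0) (b := 1) (fun x _ => hg x)
    (by fun_prop) (fun x _ => hB x) (((hNi.const_mul c).div_const ε |>.add
      intervalIntegrable_const).const_mul (μ + m)) ht ht₀
  have hint : ∫ x in (0 : ℝ)..1, (μ + m) * (c * Nf x / ε + ε) ≤ K * ε := by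
    rw [intervalIntegral.integral_const_mul, intervalIntegral.integral_add
      ((hNi.const_mul c).div_const ε) intervalIntegrable_const, intervalIntegral.integral_div,
      intervalIntegral.integral_const_mul, intervalIntegral.integral_const]
    have h1 : c * (∫ t in (0 : ℝ)..1, Nf t) / ε ≤ c * ε := by
      rw [div_le_iff₀ hε0]
      nlinarith
    have : (μ + m) * (c * (∫ t in (0 : ℝ)..1, Nf t) / ε + ((1 : ℝ) - 0) • ε) ≤ (μ + m) * (c * ε + ε) := by
      simp only [sub_zero, one_smul]
      gcongr
    calc _ ≤ _ := this
      _ = K * ε := by rw [hK]; ring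
  have h5 := abs_le.1 (hmain.trans (hint.trans hε2))
  have h6 := abs_lt.1 hyt₀
  rw [max_eq_left (by linarith : (0 : ℝ) ≤ μ - y t₀)] at h5
  rw [abs_le]
  constructor
  · by_contra! hcon
    rw [max_eq_left (by linarith : (0 : ℝ) ≤ μ - y t)] at h5
    nlinarith [h5.1, h5.2]
  · by_contra! hcon
    have h7 : (max (μ - y t) 0) ^ 2 ≤ (μ - δ) ^ 2 := by
      have : max (μ - y t) 0 ≤ μ - δ := max_le (by linarith) (by linarith)
      exact pow_le_pow_left₀ (le_max_right _ _) this 2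
    have h8 : (μ - ε) ^ 2 ≤ (μ - y t₀) ^ 2 := by
      refine pow_le_pow_left₀ (by linarith) (by linarith) 2
    nlinarith [h5.1, h5.2]

end RabinowitzFloer

/-! ### Pull-back of one-forms and naturality of the exterior derivative -/

namespace RabinowitzFloer

section PullBack

variable {d : ℕ} {M : Type*} [TopologicalSpace M] [ChartedSpace (EuclideanSpace ℝ (Fin d)) M]
  [IsManifold (𝓡 d) ∞ M] {V : Type*} [NormedAddCommGroup V] [NormedSpace ℝ V]

/-- The velocity section `z ↦ du(z) v` along a smooth map `u` is smooth. -/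
theorem contMDiffOn_mfderiv_apply {M' : Type*} {E' H' : Type*} [NormedAddCommGroup E']
    [NormedSpace ℝ E'] [TopologicalSpace H'] {I' : ModelWithCorners ℝ E' H'}
    [TopologicalSpace M'] [ChartedSpace H' M'] [IsManifold I' ∞ M']
    {u : V → M'} {Ω : Set V} (hΩ : IsOpen Ω)
    (hu : ContMDiffOn 𝓘(ℝ, V) I' ∞ u Ω) (v : V) :
    ContMDiffOn 𝓘(ℝ, V) I'.tangent ∞
      (fun z => (TotalSpace.mk' E' (E := fun q : M' => TangentSpace I' q) (u z)
        (mfderiv 𝓘(ℝ, V) I' u z v))) Ω := by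
  have h := hu.contMDiffOn_tangentMapWithin (m := ∞) (by simp) hΩ.uniqueMDiffOn
  have h2 : ContMDiff 𝓘(ℝ, V) 𝓘(ℝ, V).tangent ∞
      (fun z : V => (TotalSpace.mk' V (E := fun q : V => TangentSpace 𝓘(ℝ, V) q) z v)) := by
    intro z
    rw [contMDiffAt_totalSpace]
    refine ⟨contMDiffAt_id, ?_⟩
    simp
    exact contMDiffAt_const
  have h3 := h.comp (h2.contMDiffOn (s := Ω)) (fun z hz => by simpa using hz)
  refine h3.congr fun z hz => ?_
  simp [tangentMapWithin, mfderivWithin_of_isOpen hΩ hz]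

/-- The pull-back `u^* λ`. -/
noncomputable def OneForm.pull (lam : OneForm d M) (u : V → M) (z : V) : V →L[ℝ] ℝ :=
  (lam (u z)).comp (mfderiv 𝓘(ℝ, V) (𝓡 d) u z)

theorem OneForm.Smooth.pull_contDiffOn {lam : OneForm d M} (hl : lam.Smooth)
    {u : V → M} {Ω : Set V} (hΩ : IsOpen Ω)
    (hu : ContMDiffOn 𝓘(ℝ, V) (𝓡 d) ∞ u Ω) (v : V) :
    ContDiffOn ℝ ∞ (fun z => OneForm.pull lam u z v) Ω := by
  have h1 := contMDiffOn_mfderiv_apply hΩ hu v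
  have h2 := hl.comp_contMDiffOn hu
  rw [← contMDiffOn_iff_contDiffOn]
  have h3 := ContMDiffOn.clm_bundle_apply (E₁ := fun q : M => TangentSpace (𝓡 d) q) (E₂ := Bundle.Trivial M ℝ) (F₂ := ℝ) (F₁ := EuclideanSpace ℝ (Fin d)) (b := u) (ϕ := fun z => lam (u z)) (v := fun z => mfderiv 𝓘(ℝ, V) (𝓡 d) u z v) h2 h1
  intro z hz
  have h4 := (contMDiffWithinAt_totalSpace.1 (h3 z hz)).2
  simp only [Trivial.fiberBundle_trivializationAt', Trivial.trivialization_apply] at h4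
  exact h4

omit [IsManifold (𝓡 d) ∞ M] in
theorem OneForm.pull_congr (lam : OneForm d M) {u u' : V → M} {z : V} (h : u =ᶠ[𝓝 z] u') :
    OneForm.pull lam u z = OneForm.pull lam u' z := by
  let Λ : M → (EuclideanSpace ℝ (Fin d) →L[ℝ] ℝ) := lam
  let A : V →L[ℝ] EuclideanSpace ℝ (Fin d) := mfderiv 𝓘(ℝ, V) (𝓡 d) u z
  let A' : V →L[ℝ] EuclideanSpace ℝ (Fin d) := mfderiv 𝓘(ℝ, V) (𝓡 d) u' z
  have hA : A = A' := h.mfderiv_eq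
  change (Λ (u z)).comp A = (Λ (u' z)).comp A'
  rw [hA, h.eq_of_nhds]

omit [IsManifold (𝓡 d) ∞ M] in
theorem OneForm.pull_comp {V' : Type*} [NormedAddCommGroup V'] [NormedSpace ℝ V']
    (lam : OneForm d M) {u : V → M} {y : V' → V} {z : V'}
    (hu : MDifferentiableAt 𝓘(ℝ, V) (𝓡 d) u (y z)) (hy : DifferentiableAt ℝ y z) :
    OneForm.pull lam (u ∘ y) z = (OneForm.pull lam u (y z)).comp (fderiv ℝ y z) := by
  ext v
  rw [OneForm.pull, mfderiv_comp z hu hy.mdifferentiableAt, mfderiv_eq_fderiv]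
  rfl

theorem OneForm.Smooth.chartRep_contDiffOn {lam : OneForm d M} (hl : lam.Smooth) (p : M) :
    ContDiffOn ℝ ∞ (lam.chartRep p) (extChartAt (𝓡 d) p).target := by
  rw [contDiffOn_clm_apply]
  exact fun v => hl.pull_contDiffOn (isOpen_extChartAt_target p) (contMDiffOn_extChartAt_symm p) v

/-- Near `z` the map `u` is the inverse chart composed with its coordinate expression, so questions
about `u^* λ` become calculus in the model space. -/
theorem OneForm.pull_eq_chartRep (lam : OneForm d M) {u : V → M} {z : V} (p : M)
    (hu : MDifferentiableAt 𝓘(ℝ, V) (𝓡 d) u z) (hz : u z ∈ (extChartAt (𝓡 d) p).source) :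
    OneForm.pull lam u z = (lam.chartRep p (extChartAt (𝓡 d) p (u z))).comp
      (fderiv ℝ (extChartAt (𝓡 d) p ∘ u) z) := by
  have h1 : MDifferentiableAt (𝓡 d) 𝓘(ℝ, EuclideanSpace ℝ (Fin d)) (extChartAt (𝓡 d) p) (u z) :=
    mdifferentiableAt_extChartAt (by simpa using hz)
  have h2 : MDifferentiableAt 𝓘(ℝ, EuclideanSpace ℝ (Fin d)) (𝓡 d) (extChartAt (𝓡 d) p).symm
      (extChartAt (𝓡 d) p (u z)) :=
    ((contMDiffOn_extChartAt_symm (n := ∞) p).contMDiffAt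
      ((isOpen_extChartAt_target p).mem_nhds ((extChartAt (𝓡 d) p).map_source hz))).mdifferentiableAt
      (by simp)
  have h3 := OneForm.pull_comp lam (y := extChartAt (𝓡 d) p ∘ u) (z := z) h2
    (h1.comp z hu).differentiableAt
  have h4 : OneForm.pull lam ((extChartAt (𝓡 d) p).symm ∘ (extChartAt (𝓡 d) p ∘ u)) z
      = OneForm.pull lam u z := by
    have h5 : (extChartAt (𝓡 d) p).symm ∘ (extChartAt (𝓡 d) p ∘ u) =ᶠ[𝓝 z] u := by
      filter_upwards [hu.continuousAt.preimage_mem_nhds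
        ((isOpen_extChartAt_source p).mem_nhds hz)] with x hx
      exact (extChartAt (𝓡 d) p).left_inv hx
    exact OneForm.pull_congr lam h5
  rw [← h4, h3]
  rfl

/-- `d(u^* λ) = u^* dλ`. -/
theorem OneForm.Smooth.extDer_pull {lam : OneForm d M} (hl : lam.Smooth)
    {u : V → M} {Ω : Set V} (hΩ : IsOpen Ω)
    (hu : ContMDiffOn 𝓘(ℝ, V) (𝓡 d) ∞ u Ω) {z : V} (hz : z ∈ Ω) (v w : V) :
    fderiv ℝ (fun x => OneForm.pull lam u x w) z v - fderiv ℝ (fun x => OneForm.pull lam u x v) z w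
      = lam.extDer (u z) (mfderiv 𝓘(ℝ, V) (𝓡 d) u z v) (mfderiv 𝓘(ℝ, V) (𝓡 d) u z w) := by
  have hu' : ∀ x ∈ Ω, ContMDiffAt 𝓘(ℝ, V) (𝓡 d) ∞ u x := fun x hx =>
    hu.contMDiffAt (hΩ.mem_nhds hx)
  set φ := extChartAt (𝓡 d) (u z) with hφ
  set c := lam.chartRep (u z) with hc
  have hsrc : ∀ᶠ x in 𝓝 z, u x ∈ φ.source :=
    (hu' z hz).continuousAt.preimage_mem_nhds (extChartAt_source_mem_nhds (u z))
  have hy : ContDiffAt ℝ ∞ (φ ∘ u) z := by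
    rw [← contMDiffAt_iff_contDiffAt]
    exact (contMDiffAt_extChartAt (n := ∞)).comp z (hu' z hz)
  have hcd : DifferentiableAt ℝ c (φ (u z)) :=
    ((hl.chartRep_contDiffOn (u z)).contDiffAt
      (extChartAt_target_mem_nhds (u z))).differentiableAt (by simp)
  have hev : ∀ a : V, (fun x => OneForm.pull lam u x a) =ᶠ[𝓝 z]
      fun x => c ((φ ∘ u) x) (fderiv ℝ (φ ∘ u) x a) := by
    intro a
    filter_upwards [hsrc, hΩ.mem_nhds hz] with x hx hx'
    rw [OneForm.pull_eq_chartRep lam (u z) ((hu' x hx').mdifferentiableAt (by simp)) hx]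
    rfl
  have hyd : DifferentiableAt ℝ (φ ∘ u) z := hy.differentiableAt (by simp)
  have hy2 : DifferentiableAt ℝ (fderiv ℝ (φ ∘ u)) z :=
    (hy.fderiv_right (m := 1) (by norm_cast)).differentiableAt (by simp)
  have hder : ∀ a b : V, fderiv ℝ (fun x => OneForm.pull lam u x a) z b =
      c (φ (u z)) (fderiv ℝ (fderiv ℝ (φ ∘ u)) z b a) +
      fderiv ℝ c (φ (u z)) (fderiv ℝ (φ ∘ u) z b) (fderiv ℝ (φ ∘ u) z a) := by
    intro a b
    rw [(hev a).fderiv_eq]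
    have h1 : HasFDerivAt (fun x => c ((φ ∘ u) x)) ((fderiv ℝ c (φ (u z))).comp
        (fderiv ℝ (φ ∘ u) z)) z :=
      HasFDerivAt.comp (g := c) (f := φ ∘ u) z hcd.hasFDerivAt hyd.hasFDerivAt
    have h2 : HasFDerivAt (fun x => fderiv ℝ (φ ∘ u) x a)
        ((fderiv ℝ (fderiv ℝ (φ ∘ u)) z).flip a) z := by
      simpa using hy2.hasFDerivAt.clm_apply (hasFDerivAt_const a z)
    rw [(h1.clm_apply h2).fderiv]
    rfl
  -- The terms containing second derivatives of the coordinate expression are symmetric in `v` and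
  -- `w`; they cancel in the antisymmetrization.
  have hsymm : fderiv ℝ (fderiv ℝ (φ ∘ u)) z v w = fderiv ℝ (fderiv ℝ (φ ∘ u)) z w v :=
    (hy.isSymmSndFDerivAt (by simpa using WithTop.coe_le_coe.2 (le_top : (2 : ℕ∞) ≤ ⊤))).eq v w
  -- The chart is the preferred one at `u z`, through which the tangent space there is the model
  -- space. Hence the manifold derivative at `z` is the derivative of `φ ∘ u`, and `extDer` unfolds
  -- to the same expression.
  have hmf : ∀ a, mfderiv 𝓘(ℝ, V) (𝓡 d) u z a = fderiv ℝ (φ ∘ u) z a := by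
    intro a
    rw [((hu' z hz).mdifferentiableAt (by simp)).mfderiv]
    simp [writtenInExtChartAt, hφ]
    rfl
  rw [hder, hder, hsymm]
  have h3 : lam.extDer (u z) (mfderiv 𝓘(ℝ, V) (𝓡 d) u z v) (mfderiv 𝓘(ℝ, V) (𝓡 d) u z w) =
      fderiv ℝ c (φ (u z)) (mfderiv 𝓘(ℝ, V) (𝓡 d) u z v) (mfderiv 𝓘(ℝ, V) (𝓡 d) u z w) -
      fderiv ℝ c (φ (u z)) (mfderiv 𝓘(ℝ, V) (𝓡 d) u z w) (mfderiv 𝓘(ℝ, V) (𝓡 d) u z v) := rfl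
  have h4 := hmf v
  have h5 := hmf w
  refine Eq.trans ?_ h3.symm
  erw [h4, h5]
  abel

end PullBack

end RabinowitzFloer

/-! ### The symplectization coordinates and the Liouville vector field -/

namespace RabinowitzFloer

theorem OneForm.extDer_apply_neg {d : ℕ} {M : Type*} [TopologicalSpace M]
    [ChartedSpace (EuclideanSpace ℝ (Fin d)) M] (lam : OneForm d M) (p : M)
    (v w : TangentSpace (𝓡 d) p) : lam.extDer p v w = -lam.extDer p w v := by
  let D : EuclideanSpace ℝ (Fin d) →L[ℝ] EuclideanSpace ℝ (Fin d) →L[ℝ] ℝ :=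
    fderiv ℝ (lam.chartRep p) (extChartAt (𝓡 d) p p)
  let v' : EuclideanSpace ℝ (Fin d) := v
  let w' : EuclideanSpace ℝ (Fin d) := w
  change D v' w' - D w' v' = -(D w' v' - D v' w')
  ring

namespace LiouvilleCompletion

variable {n : ℕ}
  {M : Type*} [TopologicalSpace M] [ChartedSpace (EuclideanSpace ℝ (Fin (2 * n))) M]
  [IsManifold (𝓡 (2 * n)) ∞ M]
  {N : Type*} [TopologicalSpace N] [ChartedSpace (EuclideanSpace ℝ (Fin (2 * n - 1))) N]
  [IsManifold (𝓡 (2 * n - 1)) ∞ N]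
  (D : LiouvilleCompletion n M N)

theorem mem_cyl_source {x : N} {r : ℝ} : (x, r) ∈ D.cyl.source ↔ 0 < r := by
  simp [D.cyl_source]

theorem cyl_mem_target {x : N} {r : ℝ} (hr : 0 < r) : D.cyl (x, r) ∈ D.cyl.target :=
  D.cyl.map_source (D.mem_cyl_source.2 hr)

theorem cyl_symm_cyl {x : N} {r : ℝ} (hr : 0 < r) : D.cyl.symm (D.cyl (x, r)) = (x, r) :=
  D.cyl.left_inv (D.mem_cyl_source.2 hr)

theorem radius_cyl {x : N} {r : ℝ} (hr : 0 < r) : D.radius (D.cyl (x, r)) = r := by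
  rw [radius, D.cyl_symm_cyl hr]

theorem radius_pos {w : M} (hw : w ∈ D.cyl.target) : 0 < D.radius w := by
  have h := D.cyl.map_target hw
  rw [D.cyl_source] at h
  exact h.2

theorem cyl_radius {w : M} (hw : w ∈ D.cyl.target) :
    D.cyl ((D.cyl.symm w).1, D.radius w) = w := D.cyl.right_inv hw

theorem mdifferentiableAt_cyl {z : N × ℝ} (hz : 0 < z.2) :
    MDifferentiableAt ((𝓡 (2 * n - 1)).prod 𝓘(ℝ, ℝ)) (𝓡 (2 * n)) D.cyl z :=
  (D.cyl_smooth.contMDiffAt (D.cyl.open_source.mem_nhds (by simpa [D.cyl_source] using hz))).mdifferentiableAt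
    (by simp)

theorem mdifferentiableAt_cyl_symm {w : M} (hw : w ∈ D.cyl.target) :
    MDifferentiableAt (𝓡 (2 * n)) ((𝓡 (2 * n - 1)).prod 𝓘(ℝ, ℝ)) D.cyl.symm w :=
  (D.cyl_symm_smooth.contMDiffAt (D.cyl.open_target.mem_nhds hw)).mdifferentiableAt (by simp)

theorem contMDiffOn_radius : ContMDiffOn (𝓡 (2 * n)) 𝓘(ℝ, ℝ) ∞ D.radius D.cyl.target :=
  contMDiff_snd.comp_contMDiffOn D.cyl_symm_smooth

theorem mdifferentiableAt_radius {w : M} (hw : w ∈ D.cyl.target) :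
    MDifferentiableAt (𝓡 (2 * n)) 𝓘(ℝ, ℝ) D.radius w :=
  (D.contMDiffOn_radius.contMDiffAt (D.cyl.open_target.mem_nhds hw)).mdifferentiableAt (by simp)

theorem mdifferentiableAt_base {w : M} (hw : w ∈ D.cyl.target) :
    MDifferentiableAt (𝓡 (2 * n)) (𝓡 (2 * n - 1)) (fun q => (D.cyl.symm q).1) w :=
  mdifferentiableAt_fst.comp w (D.mdifferentiableAt_cyl_symm hw)

theorem mfderiv_cyl_mfderiv_symm {w : M} (hw : w ∈ D.cyl.target) (ζ : TangentSpace (𝓡 (2 * n)) w) :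
    (mfderiv ((𝓡 (2 * n - 1)).prod 𝓘(ℝ, ℝ)) (𝓡 (2 * n)) D.cyl ((D.cyl.symm w).1, D.radius w)
      (mfderiv (𝓡 (2 * n)) (𝓡 (2 * n - 1)) (fun q => (D.cyl.symm q).1) w ζ,
        mfderiv (𝓡 (2 * n)) 𝓘(ℝ, ℝ) D.radius w ζ) : EuclideanSpace ℝ (Fin (2 * n))) = ζ := by
  have h1 := (D.mdifferentiableAt_base hw).hasMFDerivAt.prodMk
    (D.mdifferentiableAt_radius hw).hasMFDerivAt
  have h2 := (D.mdifferentiableAt_cyl (z := ((D.cyl.symm w).1, D.radius w))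
    (D.radius_pos hw)).hasMFDerivAt
  have h3 := HasMFDerivAt.comp w h2 h1
  have h4 : D.cyl ∘ (fun q => ((D.cyl.symm q).1, D.radius q)) =ᶠ[𝓝 w] id := by
    filter_upwards [D.cyl.open_target.mem_nhds hw] with q hq
    exact D.cyl_radius hq
  have h5 := h3.mfderiv
  rw [h4.mfderiv_eq, mfderiv_id] at h5
  exact (DFunLike.congr_fun h5 ζ).symm

/-- `λ = ρ α` on the cylinder. -/
theorem lam_eq_radius_mul_alphaCyl {w : M} (hw : w ∈ D.cyl.target)
    (ζ : TangentSpace (𝓡 (2 * n)) w) : D.lam w ζ = D.radius w * D.alphaCyl w ζ := by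
  have h := D.cyl_lam (D.cyl.symm w).1 (D.radius w) (D.radius_pos hw)
    (mfderiv (𝓡 (2 * n)) (𝓡 (2 * n - 1)) (fun q => (D.cyl.symm q).1) w ζ)
    (mfderiv (𝓡 (2 * n)) 𝓘(ℝ, ℝ) D.radius w ζ)
  have h1 := D.mfderiv_cyl_mfderiv_symm hw ζ
  rw [alphaCyl, ← h]
  let Λ : M → (EuclideanSpace ℝ (Fin (2 * n)) →L[ℝ] ℝ) := D.lam
  change Λ w ζ = Λ (D.cyl ((D.cyl.symm w).1, D.radius w)) _
  rw [D.cyl_radius hw]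
  congr 1
  exact h1.symm

theorem omega_neg (p : M) (v w : TangentSpace (𝓡 (2 * n)) p) :
    D.omega p v w = -D.omega p w v := OneForm.extDer_apply_neg _ _ _ _

theorem omega_self (p : M) (v : TangentSpace (𝓡 (2 * n)) p) : D.omega p v v = 0 := by
  have := D.omega_neg p v v
  linarith

/-- The parametrization `(y, s) ↦ (ψ⁻¹ y, s)` of the cylinder, `ψ` being a chart of `N` at `x`. -/
noncomputable def cylPar (x : N) (z : EuclideanSpace ℝ (Fin (2 * n - 1)) × ℝ) : M :=
  D.cyl ((extChartAt (𝓡 (2 * n - 1)) x).symm z.1, z.2)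

theorem cylPar_smooth (x : N) : ContMDiffOn 𝓘(ℝ, EuclideanSpace ℝ (Fin (2 * n - 1)) × ℝ) (𝓡 (2 * n)) ∞
    (D.cylPar x) ((extChartAt (𝓡 (2 * n - 1)) x).target ×ˢ Ioi (0 : ℝ)) := by
  refine D.cyl_smooth.comp (t := D.cyl.source) (f := fun z : EuclideanSpace ℝ (Fin (2 * n - 1)) × ℝ =>
    ((extChartAt (𝓡 (2 * n - 1)) x).symm z.1, z.2)) (ContMDiffOn.prodMk ?_ ?_) ?_
  · exact (contMDiffOn_extChartAt_symm x).comp contDiff_fst.contMDiff.contMDiffOn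
      (fun z hz => hz.1)
  · exact contDiff_snd.contMDiff.contMDiffOn
  · intro z hz
    simpa [D.cyl_source] using hz.2

/-- The coordinate form of `λ = ρ α`: there is no `ds` component, and the other coefficients depend
on `s` only through the factor `s`. -/
theorem pull_cylPar (x : N) {y : EuclideanSpace ℝ (Fin (2 * n - 1))} {s : ℝ}
    (hy : y ∈ (extChartAt (𝓡 (2 * n - 1)) x).target) (hs : 0 < s)
    (b : EuclideanSpace ℝ (Fin (2 * n - 1))) (a : ℝ) :
    OneForm.pull D.lam (D.cylPar x) (y, s) (b, a) = s * D.alpha.chartRep x y b := by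
  have h1 : HasMFDerivAt 𝓘(ℝ, EuclideanSpace ℝ (Fin (2 * n - 1)) × ℝ) 𝓘(ℝ, EuclideanSpace ℝ (Fin (2 * n - 1)))
      (Prod.fst : EuclideanSpace ℝ (Fin (2 * n - 1)) × ℝ → _) (y, s)
      (ContinuousLinearMap.fst ℝ (EuclideanSpace ℝ (Fin (2 * n - 1))) ℝ) := hasFDerivAt_fst.hasMFDerivAt
  have h2 : HasMFDerivAt 𝓘(ℝ, EuclideanSpace ℝ (Fin (2 * n - 1)) × ℝ) 𝓘(ℝ, ℝ)
      (Prod.snd : EuclideanSpace ℝ (Fin (2 * n - 1)) × ℝ → ℝ) (y, s)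
      (ContinuousLinearMap.snd ℝ (EuclideanSpace ℝ (Fin (2 * n - 1))) ℝ) := hasFDerivAt_snd.hasMFDerivAt
  have h3 : MDifferentiableAt 𝓘(ℝ, EuclideanSpace ℝ (Fin (2 * n - 1))) (𝓡 (2 * n - 1))
      (extChartAt (𝓡 (2 * n - 1)) x).symm y :=
    ((contMDiffOn_extChartAt_symm (n := ∞) x).contMDiffAt
      ((isOpen_extChartAt_target x).mem_nhds hy)).mdifferentiableAt (by simp)
  have h4 := HasMFDerivAt.comp (y, s) h3.hasMFDerivAt h1
  have h5 := HasMFDerivAt.comp (y, s) (D.mdifferentiableAt_cyl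
    (z := ((extChartAt (𝓡 (2 * n - 1)) x).symm y, s)) hs).hasMFDerivAt (h4.prodMk h2)
  have h6 := D.cyl_lam ((extChartAt (𝓡 (2 * n - 1)) x).symm y) s hs
    (mfderiv 𝓘(ℝ, EuclideanSpace ℝ (Fin (2 * n - 1))) (𝓡 (2 * n - 1))
      (extChartAt (𝓡 (2 * n - 1)) x).symm y b) a
  refine Eq.trans ?_ h6
  have h7 := h5.mfderiv
  let Λ : M → (EuclideanSpace ℝ (Fin (2 * n)) →L[ℝ] ℝ) := D.lam
  let A : EuclideanSpace ℝ (Fin (2 * n - 1)) × ℝ →L[ℝ] EuclideanSpace ℝ (Fin (2 * n)) :=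
    mfderiv 𝓘(ℝ, EuclideanSpace ℝ (Fin (2 * n - 1)) × ℝ) (𝓡 (2 * n)) (D.cylPar x) (y, s)
  change Λ (D.cylPar x (y, s)) (A (b, a)) = Λ (D.cylPar x (y, s)) _
  congr 1
  exact DFunLike.congr_fun h7 (b, a)

/-- The value at `w` of the Liouville vector field `ρ ∂/∂ρ`. -/
theorem exists_liouville {w : M} (hw : w ∈ D.cyl.target) :
    ∃ Y : TangentSpace (𝓡 (2 * n)) w, (∀ ζ : TangentSpace (𝓡 (2 * n)) w,
      D.omega w Y ζ = D.lam w ζ) ∧ mfderiv (𝓡 (2 * n)) 𝓘(ℝ, ℝ) D.radius w Y = D.radius w := by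
  set x := (D.cyl.symm w).1 with hx
  set r := D.radius w with hr
  have hr0 : 0 < r := D.radius_pos hw
  set ψ := extChartAt (𝓡 (2 * n - 1)) x with hψ
  set Ω := ψ.target ×ˢ Ioi (0 : ℝ) with hΩ
  have hΩo : IsOpen Ω := (isOpen_extChartAt_target x).prod isOpen_Ioi
  have hu := D.cylPar_smooth x
  set z : EuclideanSpace ℝ (Fin (2 * n - 1)) × ℝ := (ψ x, r) with hz
  have hzΩ : z ∈ Ω := ⟨mem_extChartAt_target x, hr0⟩
  have huz : D.cylPar x z = w := by
    simp only [cylPar, hz, hψ, extChartAt_to_inv]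
    exact D.cyl_radius hw
  -- the inverse of the parametrization
  let g : M → EuclideanSpace ℝ (Fin (2 * n - 1)) × ℝ := fun q => (ψ (D.cyl.symm q).1, D.radius q)
  have hg : MDifferentiableAt (𝓡 (2 * n)) 𝓘(ℝ, EuclideanSpace ℝ (Fin (2 * n - 1)) × ℝ) g w := by
    refine MDifferentiableAt.prodMk_space ?_ (D.mdifferentiableAt_radius hw)
    have h1 : MDifferentiableAt (𝓡 (2 * n - 1)) 𝓘(ℝ, EuclideanSpace ℝ (Fin (2 * n - 1))) ψ
        (D.cyl.symm w).1 := mdifferentiableAt_extChartAt (mem_chart_source _ _)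
    exact MDifferentiableAt.comp w h1 (D.mdifferentiableAt_base hw)
  have hgw : g w = z := rfl
  have hum : MDifferentiableAt 𝓘(ℝ, EuclideanSpace ℝ (Fin (2 * n - 1)) × ℝ) (𝓡 (2 * n))
      (D.cylPar x) z := (hu.contMDiffAt (hΩo.mem_nhds hzΩ)).mdifferentiableAt (by simp)
  let A : EuclideanSpace ℝ (Fin (2 * n - 1)) × ℝ →L[ℝ] EuclideanSpace ℝ (Fin (2 * n)) :=
    mfderiv 𝓘(ℝ, EuclideanSpace ℝ (Fin (2 * n - 1)) × ℝ) (𝓡 (2 * n)) (D.cylPar x) z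
  let B : EuclideanSpace ℝ (Fin (2 * n)) →L[ℝ] EuclideanSpace ℝ (Fin (2 * n - 1)) × ℝ :=
    mfderiv (𝓡 (2 * n)) 𝓘(ℝ, EuclideanSpace ℝ (Fin (2 * n - 1)) × ℝ) g w
  -- Every tangent vector at `w` is thus some `A (b, a)`, so identities for forms can be checked on
  -- such vectors.
  have hAB : ∀ ζ : EuclideanSpace ℝ (Fin (2 * n)), A (B ζ) = ζ := by
    intro ζ
    have h3 := HasMFDerivAt.comp w (hgw ▸ hum).hasMFDerivAt hg.hasMFDerivAt
    have h4 : D.cylPar x ∘ g =ᶠ[𝓝 w] id := by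
      have h6 : ∀ᶠ q in 𝓝 w, (D.cyl.symm q).1 ∈ ψ.source :=
        (D.mdifferentiableAt_base hw).continuousAt.preimage_mem_nhds
          (extChartAt_source_mem_nhds (I := 𝓡 (2 * n - 1)) x)
      filter_upwards [D.cyl.open_target.mem_nhds hw, h6] with q hq hq2
      simp only [cylPar, g, Function.comp_apply, ← hψ, ψ.left_inv hq2, id]
      exact D.cyl_radius hq
    have h5 := h3.mfderiv
    rw [h4.mfderiv_eq, mfderiv_id] at h5
    exact (DFunLike.congr_fun h5 ζ).symm
  let L : EuclideanSpace ℝ (Fin (2 * n)) →L[ℝ] ℝ := D.lam w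
  let W : EuclideanSpace ℝ (Fin (2 * n)) →L[ℝ] EuclideanSpace ℝ (Fin (2 * n)) →L[ℝ] ℝ := D.omega w
  have hL : ∀ b a, L (A (b, a)) = r * D.alpha.chartRep x (ψ x) b := by
    intro b a
    have h := D.pull_cylPar x (mem_extChartAt_target x) hr0 b a
    have h2 : OneForm.pull D.lam (D.cylPar x) (ψ x, r) (b, a) =
      (D.lam (D.cylPar x z) : EuclideanSpace ℝ (Fin (2 * n)) →L[ℝ] ℝ) (A (b, a)) := rfl
    rw [← h, h2, huz]
    rfl
  -- This is `d(sα)(∂_s, ·) = α`. The component of `sα` along `∂_s` is identically zero, so only the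
  -- `s`-derivative of the other coefficients contributes.
  have hW : ∀ b a, W (A (0, 1)) (A (b, a)) = D.alpha.chartRep x (ψ x) b := by
    intro b a
    have h := D.lam_smooth.extDer_pull hΩo hu hzΩ (0, 1) (b, a)
    have h1 : (D.lam.extDer (D.cylPar x z) : EuclideanSpace ℝ (Fin (2 * n)) →L[ℝ] EuclideanSpace ℝ (Fin (2 * n)) →L[ℝ] ℝ)
      (A (0, 1)) (A (b, a)) = D.alpha.chartRep x (ψ x) b := by
      refine h.symm.trans ?_
      have h2 : (fun y => OneForm.pull D.lam (D.cylPar x) y (0, 1)) =ᶠ[𝓝 z] fun _ => (0 : ℝ) := by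
        filter_upwards [hΩo.mem_nhds hzΩ] with y hy
        rw [D.pull_cylPar x hy.1 hy.2]
        simp
      rw [h2.fderiv_eq]
      have h3 : DifferentiableAt ℝ (fun y => OneForm.pull D.lam (D.cylPar x) y (b, a)) z :=
        ((D.lam_smooth.pull_contDiffOn hΩo hu (b, a)).contDiffAt
          (hΩo.mem_nhds hzΩ)).differentiableAt (by simp)
      have h4 : HasDerivAt (fun s : ℝ => ((ψ x, s) : EuclideanSpace ℝ (Fin (2 * n - 1)) × ℝ)) (0, 1) r :=
        (hasDerivAt_const r (ψ x)).prodMk (hasDerivAt_id r)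
      have h5 := HasFDerivAt.comp_hasDerivAt r h3.hasFDerivAt h4
      have h6 : (fun y => OneForm.pull D.lam (D.cylPar x) y (b, a)) ∘ (fun s : ℝ => ((ψ x, s) :
          EuclideanSpace ℝ (Fin (2 * n - 1)) × ℝ)) =ᶠ[𝓝 r] fun s => s * D.alpha.chartRep x (ψ x) b := by
        filter_upwards [isOpen_Ioi.mem_nhds hr0] with s hs
        exact D.pull_cylPar x (mem_extChartAt_target x) hs b a
      have h7 : HasDerivAt (fun s : ℝ => s * D.alpha.chartRep x (ψ x) b)
          (D.alpha.chartRep x (ψ x) b) r := by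
        simpa using (hasDerivAt_id r).mul_const (D.alpha.chartRep x (ψ x) b)
      rw [(h5.congr_of_eventuallyEq h6.symm).unique h7]
      simp
    rw [← h1, huz]
    rfl
  refine ⟨(r • A (0, 1) : EuclideanSpace ℝ (Fin (2 * n))), fun ζ => ?_, ?_⟩
  · change W (r • A (0, 1)) ζ = L ζ
    rw [← hAB ζ, map_smul, _root_.smul_apply, ← Prod.mk.eta (p := B ζ), hW, hL,
      smul_eq_mul]
  · let R : EuclideanSpace ℝ (Fin (2 * n)) →L[ℝ] ℝ := mfderiv (𝓡 (2 * n)) 𝓘(ℝ, ℝ) D.radius w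
    change R (r • A (0, 1)) = r
    have h1 : R (A (0, 1)) = 1 := by
      have h2 := HasMFDerivAt.comp z (huz ▸ D.mdifferentiableAt_radius hw).hasMFDerivAt hum.hasMFDerivAt
      have h3 : D.radius ∘ D.cylPar x =ᶠ[𝓝 z] Prod.snd := by
        filter_upwards [hΩo.mem_nhds hzΩ] with y hy
        exact D.radius_cyl hy.2
      have h4 : HasMFDerivAt 𝓘(ℝ, EuclideanSpace ℝ (Fin (2 * n - 1)) × ℝ) 𝓘(ℝ, ℝ)
        (Prod.snd : EuclideanSpace ℝ (Fin (2 * n - 1)) × ℝ → ℝ) z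
        (ContinuousLinearMap.snd ℝ (EuclideanSpace ℝ (Fin (2 * n - 1))) ℝ) :=
          hasFDerivAt_snd.hasMFDerivAt
      have h5 := h2.mfderiv
      rw [h3.mfderiv_eq, h4.mfderiv] at h5
      have h6 := DFunLike.congr_fun h5 (0, 1)
      have h7 : (1 : ℝ) = (mfderiv (𝓡 (2 * n)) 𝓘(ℝ, ℝ) D.radius (D.cylPar x z) :
        EuclideanSpace ℝ (Fin (2 * n)) →L[ℝ] ℝ) (A (0, 1)) := h6
      refine Eq.trans ?_ h7.symm
      rw [huz]
      rfl
    rw [map_smul, h1]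
    simp

end LiouvilleCompletion

end RabinowitzFloer

/-! ### Contact type metrics and Hamiltonian vector fields on the end -/

namespace RabinowitzFloer

/-- A non-degenerate bilinear form on a finite-dimensional space is an isomorphism onto the dual. -/
theorem exists_equiv_of_nondegenerate {E : Type*} [NormedAddCommGroup E] [NormedSpace ℝ E]
    [FiniteDimensional ℝ E] (W : E →L[ℝ] E →L[ℝ] ℝ) (h : ∀ v, (∀ w, W v w = 0) → v = 0) :
    ∃ e : E ≃L[ℝ] (E →L[ℝ] ℝ), (e : E →L[ℝ] E →L[ℝ] ℝ) = W := by
  have hinj : Function.Injective (W : E →ₗ[ℝ] E →L[ℝ] ℝ) := by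
    rw [injective_iff_map_eq_zero]
    intro v hv
    exact h v fun w => by
      have := DFunLike.congr_fun hv w
      simpa using this
  have hfr : Module.finrank ℝ E = Module.finrank ℝ (E →L[ℝ] ℝ) := by
    rw [← (LinearMap.toContinuousLinearMap : (E →ₗ[ℝ] ℝ) ≃ₗ[ℝ] (E →L[ℝ] ℝ)).finrank_eq]
    exact (Subspace.dual_finrank_eq (K := ℝ) (V := E)).symm
  refine ⟨(LinearEquiv.ofInjectiveOfFinrankEq _ hinj hfr).toContinuousLinearEquiv, ?_⟩
  ext v w
  rfl

/-- Comparison of the metric `ω(J·, ·)` with `dρ² + λ²` for `J` of contact type. -/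
theorem contact_inequality {E : Type*} [AddCommGroup E] [Module ℝ E]
    (W : E → E → ℝ) (hadd : ∀ u v w, W (u + v) w = W u w + W v w) (hsm : ∀ (c : ℝ) v w, W (c • v) w = c * W v w)
    (hneg : ∀ v w, W v w = -W w v) (J : E →ₗ[ℝ] E) (hJJ : ∀ v, J (J v) = -v)
    (hsymm : ∀ v w, W (J v) w = W (J w) v) (hpos : ∀ v, 0 ≤ W (J v) v)
    (l R : E → ℝ) (hRneg : ∀ v, R (-v) = - R v) (hJR : ∀ v, R (J v) = l v) (Y : E) (hY : ∀ v, W Y v = l v) {ρ : ℝ} (hρ : 0 < ρ)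
    (hRY : R Y = ρ) (v : E) : R v ^ 2 + l v ^ 2 ≤ ρ * W (J v) v := by
  have hadd' : ∀ u v w, W u (v + w) = W u v + W u w := fun u v w => by
    rw [hneg, hadd, hneg v, hneg w]; ring
  have hsm' : ∀ (c : ℝ) v w, W v (c • w) = c * W v w := fun c v w => by
    rw [hneg, hsm, hneg w]; ring
  have hlJ : ∀ v, l (J v) = -R v := fun v => by rw [← hJR, hJJ, hRneg]
  have hlY : l Y = 0 := by
    have h1 := hY Y
    have h2 := hneg Y Y
    linarith
  have h1 : W (J Y) Y = ρ := by rw [hneg, hY, hlJ, hRY]; ring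
  have h2 : W (J v) Y = R v := by rw [hneg, hY, hlJ]; ring
  have h2' : W (J Y) v = R v := by rw [hsymm, h2]
  have h3 : W (J v) (J Y) = - l v := by
    rw [hsymm, hJJ]
    have : (-Y : E) = (-1 : ℝ) • Y := by simp
    rw [this, hsm, hY]; ring
  have hneg1 : ∀ w, W (-Y) w = - l w := fun w => by
    have : (-Y : E) = (-1 : ℝ) • Y := by simp
    rw [this, hsm, hY]; ring
  have h4 : W (J (J Y)) (J Y) = ρ := by
    rw [hJJ, hneg1, hlJ, hRY]; ring
  have h5 : W (J (J Y)) Y = 0 := by rw [hJJ, hneg1, hlY]; ring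
  have h6 : W (J Y) (J Y) = 0 := by
    have := hneg (J Y) (J Y)
    linarith
  have h7 : W (J (J Y)) v = - l v := by rw [hJJ, hneg1]
  -- Bessel's inequality: for the metric `W (J ·) ·` the vectors `Y` and `J Y` are orthogonal of
  -- square norm `ρ`, and `v` pairs with them to `R v` and `-l v`. The vector used here is `v` minus
  -- its projection onto their span.
  have h := hpos (v + (-(R v) / ρ) • Y + (l v / ρ) • J Y)
  simp only [map_add, map_smul, hadd, hadd', hsm, hsm', h1, h2, h2', h3, h4, h5, h6, h7] at h
  have h8 : ρ * (W (J v) v - (R v ^ 2 + l v ^ 2) / ρ) ≥ 0 := by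
    apply mul_nonneg hρ.le
    have h9 : W (J v) v - (R v ^ 2 + l v ^ 2) / ρ = W (J v) v + -R v / ρ * R v + l v / ρ * -l v := by
      field_simp
      ring
    rw [h9]
    refine h.trans_eq ?_
    field_simp
    ring
  rw [mul_sub, mul_div_cancel₀ _ hρ.ne'] at h8
  linarith

namespace LiouvilleCompletion

variable {n : ℕ}
  {M : Type*} [TopologicalSpace M] [ChartedSpace (EuclideanSpace ℝ (Fin (2 * n))) M]
  [IsManifold (𝓡 (2 * n)) ∞ M]
  {N : Type*} [TopologicalSpace N] [ChartedSpace (EuclideanSpace ℝ (Fin (2 * n - 1))) N]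
  [IsManifold (𝓡 (2 * n - 1)) ∞ N]
  (D : LiouvilleCompletion n M N)

/-- The differential of a function, as a one-form. -/
noncomputable def diff (_D : LiouvilleCompletion n M N) (f : M → ℝ) (p : M) :
    TangentSpace (𝓡 (2 * n)) p →L[ℝ] ℝ := mfderiv (𝓡 (2 * n)) 𝓘(ℝ, ℝ) f p

/-- Non-degeneracy in finite dimension makes `inverse` a genuine inverse rather than its default
value zero. -/
theorem omega_hamVF (H : M → ℝ) (p : M) (v : TangentSpace (𝓡 (2 * n)) p) :
    D.omega p (D.hamVF H p) v = -D.diff H p v := by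
  obtain ⟨e, he⟩ := exists_equiv_of_nondegenerate (E := EuclideanSpace ℝ (Fin (2 * n)))
    (D.omega p) (D.nondegenerate p)
  let dH : EuclideanSpace ℝ (Fin (2 * n)) →L[ℝ] ℝ := mfderiv (𝓡 (2 * n)) 𝓘(ℝ, ℝ) H p
  let W : EuclideanSpace ℝ (Fin (2 * n)) →L[ℝ] EuclideanSpace ℝ (Fin (2 * n)) →L[ℝ] ℝ := D.omega p
  have he' : (e : EuclideanSpace ℝ (Fin (2 * n)) →L[ℝ] EuclideanSpace ℝ (Fin (2 * n)) →L[ℝ] ℝ) = W := he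
  change W (W.inverse (-dH)) v = -dH v
  rw [← he', ContinuousLinearMap.inverse_equiv]
  simp
  rfl

theorem diff_hamVF (H : M → ℝ) (p : M) :
    D.diff H p (D.hamVF H p) = 0 := by
  have h1 := D.omega_hamVF H p (D.hamVF H p)
  rw [D.omega_self] at h1
  linarith

theorem hamVF_eq_zero {H : M → ℝ} {p : M} (h : ∀ v, D.diff H p v = 0) :
    D.hamVF H p = 0 := by
  refine D.nondegenerate p _ fun w => ?_
  have := D.omega_hamVF H p w
  rw [h, neg_zero] at this
  exact this

theorem mem_cylEnd {r₀ : ℝ} (hr₀ : 0 < r₀) {w : M} :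
    w ∈ D.cylEnd r₀ ↔ w ∈ D.cyl.target ∧ r₀ ≤ D.radius w := by
  constructor
  · rintro ⟨⟨x, r⟩, ⟨-, hr⟩, rfl⟩
    have hr' : 0 < r := lt_of_lt_of_le hr₀ hr
    exact ⟨D.cyl_mem_target hr', by rw [D.radius_cyl hr']; exact hr⟩
  · rintro ⟨h1, h2⟩
    exact ⟨((D.cyl.symm w).1, D.radius w), ⟨mem_univ _, h2⟩, D.cyl_radius h1⟩

theorem diff_radial {H : M → ℝ} {k : ℝ → ℝ} {k' : ℝ} {w : M} (hw : w ∈ D.cyl.target)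
    (hk : HasDerivAt k k' (D.radius w)) (hH : H =ᶠ[𝓝 w] k ∘ D.radius)
    (v : TangentSpace (𝓡 (2 * n)) w) :
    D.diff H w v = k' * D.diff D.radius w v := by
  have h1 := HasMFDerivAt.comp w hk.hasFDerivAt.hasMFDerivAt
    (D.mdifferentiableAt_radius hw).hasMFDerivAt
  have h2 := h1.mfderiv
  rw [← hH.mfderiv_eq] at h2
  refine (DFunLike.congr_fun h2 v).trans ?_
  let R : EuclideanSpace ℝ (Fin (2 * n)) →L[ℝ] ℝ := mfderiv (𝓡 (2 * n)) 𝓘(ℝ, ℝ) D.radius w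
  change R v * k' = k' * R v
  ring

section Radial

variable {H : M → ℝ} {k : ℝ → ℝ} {k' : ℝ} {w : M} (hw : w ∈ D.cyl.target)
    (hk : HasDerivAt k k' (D.radius w)) (hH : H =ᶠ[𝓝 w] k ∘ D.radius)
include hw hk hH

/-- From `dH(X_H) = 0` and `dH = k' dρ`; where `k'` vanishes, so does `X_H`. -/
theorem diff_radius_hamVF :
    D.diff D.radius w (D.hamVF H w) = 0 := by
  by_cases h : k' = 0
  · have : D.hamVF H w = 0 := D.hamVF_eq_zero fun v => by
      rw [D.diff_radial hw hk hH, h, zero_mul]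
    rw [this, map_zero]
  · have h1 := D.diff_hamVF H w
    rw [D.diff_radial hw hk hH] at h1
    exact (mul_eq_zero.1 h1).resolve_left h

/-- `λ(X_H) = ω(Y, X_H) = dH(Y)` for the Liouville field `Y`, and `dρ(Y) = ρ`. -/
theorem lam_hamVF : D.lam w (D.hamVF H w) = D.radius w * k' := by
  obtain ⟨Y, hY, hRY⟩ := D.exists_liouville hw
  rw [← hY, D.omega_neg, D.omega_hamVF, D.diff_radial hw hk hH, neg_neg]
  have h2 : D.diff D.radius w Y = D.radius w := hRY
  rw [h2]
  ring

end Radial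

variable {J : ℝ → ∀ p : M, TangentSpace (𝓡 (2 * n)) p →L[ℝ] TangentSpace (𝓡 (2 * n)) p}

theorem IsCompatibleLoop.nonneg (hJ : D.IsCompatibleLoop J) (t : ℝ) (p : M)
    (v : TangentSpace (𝓡 (2 * n)) p) : 0 ≤ D.omega p (J t p v) v := by
  by_cases h : v = 0
  · subst h
    simp
  · exact (hJ.pos t p v h).le

theorem IsCompatibleLoop.contact_inequality (hJ : D.IsCompatibleLoop J) {r₀ : ℝ} (hr₀ : 0 < r₀)
    (hJr₀ : D.IsContactType J r₀) (t : ℝ) {w : M} (hw : w ∈ D.cylEnd r₀)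
    (v : TangentSpace (𝓡 (2 * n)) w) :
    D.diff D.radius w v ^ 2 + D.lam w v ^ 2 ≤
      D.radius w * D.omega w (J t w v) v := by
  have hw' := ((D.mem_cylEnd hr₀).1 hw).1
  obtain ⟨Y, hY, hRY⟩ := D.exists_liouville hw'
  let R : EuclideanSpace ℝ (Fin (2 * n)) →L[ℝ] ℝ := mfderiv (𝓡 (2 * n)) 𝓘(ℝ, ℝ) D.radius w
  let W : EuclideanSpace ℝ (Fin (2 * n)) →L[ℝ] EuclideanSpace ℝ (Fin (2 * n)) →L[ℝ] ℝ := D.omega w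
  let J' : EuclideanSpace ℝ (Fin (2 * n)) →L[ℝ] EuclideanSpace ℝ (Fin (2 * n)) := J t w
  exact RabinowitzFloer.contact_inequality (E := EuclideanSpace ℝ (Fin (2 * n))) (fun a b => W a b)
    (fun a b c => by simp) (fun c a b => by simp) (D.omega_neg w)
    (J' : EuclideanSpace ℝ (Fin (2 * n)) →ₗ[ℝ] EuclideanSpace ℝ (Fin (2 * n)))
    (hJ.sq_eq_neg t w) (hJ.symm t w) (hJ.nonneg D t w) (D.lam w) R (fun v => map_neg R v)
    (hJr₀ t w hw) Y hY (D.radius_pos hw') hRY v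

end LiouvilleCompletion

end RabinowitzFloer

/-! ### Continuity of forms and endomorphism fields, read in charts -/

namespace RabinowitzFloer

section Coordinates

variable {d : ℕ} {M : Type*} [TopologicalSpace M] [ChartedSpace (EuclideanSpace ℝ (Fin d)) M]

/-- The derivative of the inverse of the preferred chart at `p`. -/
noncomputable def chartInvDeriv (p : M) (y : EuclideanSpace ℝ (Fin d)) :
    EuclideanSpace ℝ (Fin d) →L[ℝ] EuclideanSpace ℝ (Fin d) :=
  mfderiv 𝓘(ℝ, EuclideanSpace ℝ (Fin d)) (𝓡 d) (extChartAt (𝓡 d) p).symm y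

/-- The derivative of the preferred chart at `p`. -/
noncomputable def chartDeriv (p : M) (y : EuclideanSpace ℝ (Fin d)) :
    EuclideanSpace ℝ (Fin d) →L[ℝ] EuclideanSpace ℝ (Fin d) :=
  mfderiv (𝓡 d) 𝓘(ℝ, EuclideanSpace ℝ (Fin d)) (extChartAt (𝓡 d) p) ((extChartAt (𝓡 d) p).symm y)

variable [IsManifold (𝓡 d) ∞ M]

theorem chartInvDeriv_chartDeriv (p : M) {y : EuclideanSpace ℝ (Fin d)}
    (hy : y ∈ (extChartAt (𝓡 d) p).target) (v : EuclideanSpace ℝ (Fin d)) :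
    chartInvDeriv p y (chartDeriv p y v) = v := by
  have : IsManifold (𝓡 d) 1 M := IsManifold.of_le (n := ∞) (by simp)
  have h := mfderivWithin_extChartAt_symm_comp_mfderiv_extChartAt (I := 𝓡 d) (x := p) hy
  rw [ModelWithCorners.range_eq_univ, mfderivWithin_univ] at h
  exact DFunLike.congr_fun h v

theorem chartDeriv_chartInvDeriv (p : M) {y : EuclideanSpace ℝ (Fin d)}
    (hy : y ∈ (extChartAt (𝓡 d) p).target) (v : EuclideanSpace ℝ (Fin d)) :
    chartDeriv p y (chartInvDeriv p y v) = v := by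
  have : IsManifold (𝓡 d) 1 M := IsManifold.of_le (n := ∞) (by simp)
  have h := mfderiv_extChartAt_comp_mfderivWithin_extChartAt_symm (I := 𝓡 d) (x := p) hy
  rw [ModelWithCorners.range_eq_univ, mfderivWithin_univ] at h
  exact DFunLike.congr_fun h v

/-- The two-form `dλ` in the preferred chart at `p`. -/
noncomputable def OneForm.chartExtDer (lam : OneForm d M) (p : M) (y : EuclideanSpace ℝ (Fin d)) :
    EuclideanSpace ℝ (Fin d) →L[ℝ] EuclideanSpace ℝ (Fin d) →L[ℝ] ℝ :=
  fderiv ℝ (lam.chartRep p) y - (fderiv ℝ (lam.chartRep p) y).flip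

/-- `extDer` is computed at each point in that point's own preferred chart. Naturality of `d`,
applied to the inverse of one fixed chart, expresses all these values by a single field of bilinear
forms, whose continuity can be discussed. -/
theorem OneForm.Smooth.chartExtDer_apply {lam : OneForm d M} (hl : lam.Smooth) (p : M)
    {y : EuclideanSpace ℝ (Fin d)} (hy : y ∈ (extChartAt (𝓡 d) p).target)
    (v w : EuclideanSpace ℝ (Fin d)) :
    lam.extDer ((extChartAt (𝓡 d) p).symm y) (chartInvDeriv p y v) (chartInvDeriv p y w) =
      lam.chartExtDer p y v w := by
  have h := hl.extDer_pull (isOpen_extChartAt_target p) (contMDiffOn_extChartAt_symm p) hy v w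
  have h1 : ∀ a b : EuclideanSpace ℝ (Fin d),
      fderiv ℝ (fun x => OneForm.pull lam (extChartAt (𝓡 d) p).symm x a) y b =
      fderiv ℝ (lam.chartRep p) y b a := by
    intro a b
    have h2 : DifferentiableAt ℝ (lam.chartRep p) y :=
      ((hl.chartRep_contDiffOn p).contDiffAt
        ((isOpen_extChartAt_target p).mem_nhds hy)).differentiableAt (by simp)
    have h3 : HasFDerivAt (fun x => lam.chartRep p x a) ((fderiv ℝ (lam.chartRep p) y).flip a) y := by
      simpa using h2.hasFDerivAt.clm_apply (hasFDerivAt_const a y)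
    exact congrArg (· b) h3.fderiv
  rw [h1, h1] at h
  exact h.symm

theorem OneForm.Smooth.chartExtDer_continuousOn {lam : OneForm d M} (hl : lam.Smooth) (p : M) :
    ContinuousOn (lam.chartExtDer p) (extChartAt (𝓡 d) p).target := by
  have h := (hl.chartRep_contDiffOn p).continuousOn_fderiv_of_isOpen (isOpen_extChartAt_target p)
    (by simp)
  exact h.sub ((ContinuousLinearMap.flipₗᵢ ℝ _ _ ℝ).continuous.comp_continuousOn h)

/-- The family of one-forms `a s`, `s ∈ S`, is continuous in `(s, p)`. -/
def ContinuousForms (S : Set ℝ) (a : ℝ → OneForm d M) : Prop :=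
  ∀ p : M, ContinuousOn (fun q : ℝ × EuclideanSpace ℝ (Fin d) => (a q.1).chartRep p q.2)
    (S ×ˢ (extChartAt (𝓡 d) p).target)

/-- The family of endomorphism fields `K t` is continuous in `(t, p)`. -/
def ContinuousEndos (K : ℝ → ∀ p : M, TangentSpace (𝓡 d) p →L[ℝ] TangentSpace (𝓡 d) p) : Prop :=
  ∀ (p : M) (b : EuclideanSpace ℝ (Fin d)), ContinuousOn (fun q : ℝ × EuclideanSpace ℝ (Fin d) =>
      chartDeriv p q.2 (K q.1 ((extChartAt (𝓡 d) p).symm q.2) (chartInvDeriv p q.2 b)))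
    (univ ×ˢ (extChartAt (𝓡 d) p).target)

theorem continuousEndos_id :
    ContinuousEndos (M := M) (d := d) (fun _ p => ContinuousLinearMap.id ℝ (TangentSpace (𝓡 d) p)) := by
  intro p b
  refine (continuousOn_const (c := b)).congr fun q hq => ?_
  exact chartDeriv_chartInvDeriv p hq.2 b

theorem OneForm.Smooth.continuousForms {lam : OneForm d M} (hl : lam.Smooth) (S : Set ℝ) :
    ContinuousForms S (fun _ => lam) := fun p =>
  (hl.chartRep_contDiffOn p).continuousOn.comp continuousOn_snd fun _ hq => hq.2

end Coordinates

end RabinowitzFloer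

namespace RabinowitzFloer
namespace LiouvilleCompletion

variable {n : ℕ}
  {M : Type*} [TopologicalSpace M] [ChartedSpace (EuclideanSpace ℝ (Fin (2 * n))) M]
  [IsManifold (𝓡 (2 * n)) ∞ M]
  {N : Type*} [TopologicalSpace N] [ChartedSpace (EuclideanSpace ℝ (Fin (2 * n - 1))) N]
  [IsManifold (𝓡 (2 * n - 1)) ∞ N]
  (D : LiouvilleCompletion n M N)

/-- In a chart `dH_s` is the partial derivative, in the second factor, of a smooth function on `S ×
target`; unique differentiability of `S` makes it continuous up to the boundary. -/
theorem continuousForms_diff {S : Set ℝ} (hS : UniqueDiffOn ℝ S) {H : ℝ → M → ℝ}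
    (hH : ContMDiffOn (𝓘(ℝ, ℝ).prod (𝓡 (2 * n))) 𝓘(ℝ, ℝ) ∞
      (fun q : ℝ × M => H q.1 q.2) (S ×ˢ univ)) :
    ContinuousForms S (fun s => D.diff (H s)) := by
  intro p
  set φ := extChartAt (𝓡 (2 * n)) p with hφ
  have hto : IsOpen φ.target := isOpen_extChartAt_target p
  set f : ℝ × EuclideanSpace ℝ (Fin (2 * n)) → ℝ := fun q => H q.1 (φ.symm q.2) with hf
  have hfs : ContDiffOn ℝ ∞ f (S ×ˢ φ.target) := by
    rw [← contMDiffOn_iff_contDiffOn]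
    refine hH.comp (f := fun q : ℝ × EuclideanSpace ℝ (Fin (2 * n)) => (q.1, φ.symm q.2))
      (ContMDiffOn.prodMk contDiff_fst.contMDiff.contMDiffOn
        ((contMDiffOn_extChartAt_symm p).comp contDiff_snd.contMDiff.contMDiffOn
          (fun z hz => hz.2))) (fun z hz => ⟨hz.1, mem_univ _⟩)
  have hud : UniqueDiffOn ℝ (S ×ˢ φ.target) := hS.prod hto.uniqueDiffOn
  have h1 := hfs.continuousOn_fderivWithin hud (by simp)
  have h2 : ContinuousOn (fun q => (fderivWithin ℝ f (S ×ˢ φ.target) q).comp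
      (ContinuousLinearMap.inr ℝ ℝ (EuclideanSpace ℝ (Fin (2 * n))))) (S ×ˢ φ.target) :=
    h1.clm_comp continuousOn_const
  refine h2.congr fun q hq => ?_
  obtain ⟨s, y⟩ := q
  have hHs : ContMDiff (𝓡 (2 * n)) 𝓘(ℝ, ℝ) ∞ (H s) := by
    rw [← contMDiffOn_univ]
    exact hH.comp (f := fun q : M => (s, q)) (contMDiff_const.prodMk contMDiff_id).contMDiffOn
      (fun z hz => ⟨hq.1, mem_univ _⟩)
  have h3 : MDifferentiableAt 𝓘(ℝ, EuclideanSpace ℝ (Fin (2 * n))) (𝓡 (2 * n)) φ.symm y :=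
    ((contMDiffOn_extChartAt_symm (n := ∞) p).contMDiffAt (hto.mem_nhds hq.2)).mdifferentiableAt
      (by simp)
  have h4 := HasMFDerivAt.comp y ((hHs _).mdifferentiableAt (by simp)).hasMFDerivAt h3.hasMFDerivAt
  have h5 : HasFDerivAt (fun y => f (s, y)) ((fderivWithin ℝ f (S ×ˢ φ.target) (s, y)).comp
      (ContinuousLinearMap.inr ℝ ℝ (EuclideanSpace ℝ (Fin (2 * n))))) y := by
    have h6 := ((hfs.differentiableOn (by simp)) (s, y) hq).hasFDerivWithinAt
    have h7 := h6.comp y (t := S ×ˢ φ.target) (hasFDerivAt_prodMk_right s y).hasFDerivWithinAt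
      (s := φ.target) (fun z hz => ⟨hq.1, hz⟩)
    exact h7.hasFDerivAt (hto.mem_nhds hq.2)
  exact h4.mfderiv.symm.trans h5.hasMFDerivAt.mfderiv

variable {J : ℝ → ∀ p : M, TangentSpace (𝓡 (2 * n)) p →L[ℝ] TangentSpace (𝓡 (2 * n)) p}

theorem IsCompatibleLoop.continuousEndos (hJ : D.IsCompatibleLoop J) : ContinuousEndos J := by
  intro p b
  set φ := extChartAt (𝓡 (2 * n)) p with hφ
  have hto : IsOpen φ.target := isOpen_extChartAt_target p
  have hΩ : IsOpen ((univ : Set ℝ) ×ˢ φ.target) := isOpen_univ.prod hto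
  have hu : ContMDiffOn 𝓘(ℝ, ℝ × EuclideanSpace ℝ (Fin (2 * n))) (𝓡 (2 * n)) ∞
      (fun q : ℝ × EuclideanSpace ℝ (Fin (2 * n)) => φ.symm q.2) (univ ×ˢ φ.target) :=
    (contMDiffOn_extChartAt_symm p).comp contDiff_snd.contMDiff.contMDiffOn (fun z hz => hz.2)
  have h1 := contMDiffOn_mfderiv_apply hΩ hu (0, b)
  have h2 := hJ.smooth.comp_contMDiffOn
    (f := fun q : ℝ × EuclideanSpace ℝ (Fin (2 * n)) => (q.1, φ.symm q.2))
    (ContMDiffOn.prodMk contDiff_fst.contMDiff.contMDiffOn hu)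
  have h3 := ContMDiffOn.clm_bundle_apply (E₁ := fun q : M => TangentSpace (𝓡 (2 * n)) q)
    (E₂ := fun q : M => TangentSpace (𝓡 (2 * n)) q) (F₂ := EuclideanSpace ℝ (Fin (2 * n)))
    (F₁ := EuclideanSpace ℝ (Fin (2 * n))) (b := fun q : ℝ × EuclideanSpace ℝ (Fin (2 * n)) => φ.symm q.2)
    (ϕ := fun q : ℝ × EuclideanSpace ℝ (Fin (2 * n)) => J q.1 (φ.symm q.2)) (v := fun q : ℝ × EuclideanSpace ℝ (Fin (2 * n)) =>
      mfderiv 𝓘(ℝ, ℝ × EuclideanSpace ℝ (Fin (2 * n))) (𝓡 (2 * n))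
        (fun q : ℝ × EuclideanSpace ℝ (Fin (2 * n)) => φ.symm q.2) q (0, b)) h2 h1
  have h4 : ContMDiffOn (𝓡 (2 * n)) 𝓘(ℝ, EuclideanSpace ℝ (Fin (2 * n))) ∞ φ φ.source :=
    contMDiffOn_extChartAt.mono (by simp [hφ])
  have h5 := h4.contMDiffOn_tangentMapWithin (m := ∞) (by simp)
    (isOpen_extChartAt_source p).uniqueMDiffOn
  have h6 := h5.comp h3 (fun z hz => φ.map_target hz.2)
  intro z hz
  have h7 := (contMDiffWithinAt_totalSpace.1 (h6 z hz)).2.continuousWithinAt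
  refine ContinuousWithinAt.congr_of_mem (f := fun q => _) h7 ?_ hz
  intro q hq
  have h8 : mfderivWithin (𝓡 (2 * n)) 𝓘(ℝ, EuclideanSpace ℝ (Fin (2 * n))) φ φ.source (φ.symm q.2) =
      mfderiv (𝓡 (2 * n)) 𝓘(ℝ, EuclideanSpace ℝ (Fin (2 * n))) φ (φ.symm q.2) :=
    mfderivWithin_of_isOpen (isOpen_extChartAt_source p) (φ.map_target hq.2)
  have h9 : mfderiv 𝓘(ℝ, ℝ × EuclideanSpace ℝ (Fin (2 * n))) (𝓡 (2 * n))
      (fun q : ℝ × EuclideanSpace ℝ (Fin (2 * n)) => φ.symm q.2) q (0, b) =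
      chartInvDeriv p q.2 b := by
    have h10 : MDifferentiableAt 𝓘(ℝ, EuclideanSpace ℝ (Fin (2 * n))) (𝓡 (2 * n)) φ.symm q.2 :=
      ((contMDiffOn_extChartAt_symm (n := ∞) p).contMDiffAt (hto.mem_nhds hq.2)).mdifferentiableAt
        (by simp)
    have h11 := HasMFDerivAt.comp q h10.hasMFDerivAt
      (hasFDerivAt_snd (𝕜 := ℝ) (E := ℝ) (p := q)).hasMFDerivAt
    exact DFunLike.congr_fun h11.mfderiv (0, b)
  simp [tangentMapWithin]
  erw [h8, h9]
  rfl

/-- The vector field dual to the one-form `a`. -/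
noncomputable def sharp (a : OneForm (2 * n) M) (p : M) : TangentSpace (𝓡 (2 * n)) p :=
  (D.omega p).inverse (a p)

theorem omega_sharp (a : OneForm (2 * n) M) (p : M) (v : TangentSpace (𝓡 (2 * n)) p) :
    D.omega p (D.sharp a p) v = a p v := by
  obtain ⟨e, he⟩ := exists_equiv_of_nondegenerate (E := EuclideanSpace ℝ (Fin (2 * n)))
    (D.omega p) (D.nondegenerate p)
  let a' : EuclideanSpace ℝ (Fin (2 * n)) →L[ℝ] ℝ := a p
  let W : EuclideanSpace ℝ (Fin (2 * n)) →L[ℝ] EuclideanSpace ℝ (Fin (2 * n)) →L[ℝ] ℝ := D.omega p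
  have he' : (e : EuclideanSpace ℝ (Fin (2 * n)) →L[ℝ] EuclideanSpace ℝ (Fin (2 * n)) →L[ℝ] ℝ) = W := he
  change W (W.inverse a') v = a' v
  rw [← he', ContinuousLinearMap.inverse_equiv]
  simp

theorem eq_sharp {a : OneForm (2 * n) M} {p : M} {w : TangentSpace (𝓡 (2 * n)) p}
    (h : ∀ v, D.omega p w v = a p v) : w = D.sharp a p := by
  rw [← sub_eq_zero]
  refine D.nondegenerate p _ fun v => ?_
  have := D.omega_sharp a p v
  rw [map_sub]
  exact sub_eq_zero.2 ((h v).trans this.symm)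

/-- The source of the uniform constants below. With `K = J` and `b = a` the value is minus the
square norm of `a s` for the metric `ω(J_t ·, ·)`; with `K = id`, `a = dH_s`, `b = λ` it is
`-λ(X_{H_s})`. Continuity rests on that of operator inversion at the invertible operator
representing `ω`. -/
theorem continuousOn_pairing {S : Set ℝ} {a b : ℝ → OneForm (2 * n) M}
    {K : ℝ → ∀ p : M, TangentSpace (𝓡 (2 * n)) p →L[ℝ] TangentSpace (𝓡 (2 * n)) p}
    (ha : ContinuousForms S a) (hb : ContinuousForms S b) (hK : ContinuousEndos K) :
    ContinuousOn (fun q : ℝ × ℝ × M => b q.2.1 q.2.2 (K q.1 q.2.2 (D.sharp (a q.2.1) q.2.2)))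
      (univ ×ˢ (S ×ˢ univ)) := by
  rintro ⟨t₀, s₀, p⟩ ⟨-, hs₀, -⟩
  set φ := extChartAt (𝓡 (2 * n)) p with hφ
  have hto : IsOpen φ.target := isOpen_extChartAt_target p
  set Wc := D.lam.chartExtDer p with hWc
  -- invertibility in the chart
  have hinv : ∀ y ∈ φ.target, ∃ e : EuclideanSpace ℝ (Fin (2 * n)) ≃L[ℝ]
      (EuclideanSpace ℝ (Fin (2 * n)) →L[ℝ] ℝ),
      (e : EuclideanSpace ℝ (Fin (2 * n)) →L[ℝ] EuclideanSpace ℝ (Fin (2 * n)) →L[ℝ] ℝ) = Wc y := by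
    intro y hy
    refine exists_equiv_of_nondegenerate _ fun v hv => ?_
    have h1 : chartInvDeriv p y v = 0 := by
      refine D.nondegenerate (φ.symm y) _ fun w => ?_
      have h2 := D.lam_smooth.chartExtDer_apply p hy v (chartDeriv p y w)
      erw [chartInvDeriv_chartDeriv p hy] at h2
      exact h2.trans (hv _)
    rw [← chartDeriv_chartInvDeriv p hy v, h1, map_zero]
  have hsharp : ∀ s, ∀ y ∈ φ.target, D.sharp (a s) (φ.symm y) =
      chartInvDeriv p y ((Wc y).inverse ((a s).chartRep p y)) := by
    intro s y hy
    symm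
    refine D.eq_sharp (a := a s) fun v => ?_
    obtain ⟨e, he⟩ := hinv y hy
    have h2 := D.lam_smooth.chartExtDer_apply p hy ((Wc y).inverse ((a s).chartRep p y))
      (chartDeriv p y v)
    erw [chartInvDeriv_chartDeriv p hy] at h2
    refine h2.trans ?_
    change Wc y _ _ = _
    rw [← he, ContinuousLinearMap.inverse_equiv]
    have h3 : (e : EuclideanSpace ℝ (Fin (2 * n)) →L[ℝ] EuclideanSpace ℝ (Fin (2 * n)) →L[ℝ] ℝ)
        ((e.symm : (EuclideanSpace ℝ (Fin (2 * n)) →L[ℝ] ℝ) →L[ℝ] EuclideanSpace ℝ (Fin (2 * n)))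
          ((a s).chartRep p y)) = (a s).chartRep p y := e.apply_symm_apply _
    rw [h3]
    have h4 : (a s).chartRep p y (chartDeriv p y v) =
      (a s (φ.symm y) : EuclideanSpace ℝ (Fin (2 * n)) →L[ℝ] ℝ)
        (chartInvDeriv p y (chartDeriv p y v)) := rfl
    rw [h4]
    exact congrArg (a s (φ.symm y)) (chartInvDeriv_chartDeriv p hy v)
  -- the expression in the chart
  let Kc : ℝ × EuclideanSpace ℝ (Fin (2 * n)) → EuclideanSpace ℝ (Fin (2 * n)) →L[ℝ]
      EuclideanSpace ℝ (Fin (2 * n)) := fun q =>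
    (chartDeriv p q.2).comp ((K q.1 (φ.symm q.2) : EuclideanSpace ℝ (Fin (2 * n)) →L[ℝ]
      EuclideanSpace ℝ (Fin (2 * n))).comp (chartInvDeriv p q.2))
  have hKc : ContinuousOn Kc (univ ×ˢ φ.target) := by
    rw [continuousOn_clm_apply]
    exact fun b => hK p b
  let G : ℝ × ℝ × EuclideanSpace ℝ (Fin (2 * n)) → ℝ := fun q =>
    (b q.2.1).chartRep p q.2.2 (Kc (q.1, q.2.2) ((Wc q.2.2).inverse ((a q.2.1).chartRep p q.2.2)))
  have hG : ContinuousOn G (univ ×ˢ (S ×ˢ φ.target)) := by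
    have hWi : ContinuousOn (fun y => (Wc y).inverse) φ.target := by
      intro y hy
      obtain ⟨e, he⟩ := hinv y hy
      have h1 : ContinuousAt ContinuousLinearMap.inverse (Wc y) := by
        rw [← he]
        exact (contDiffAt_map_inverse (n := 0) e).continuousAt
      exact h1.comp_continuousWithinAt (D.lam_smooth.chartExtDer_continuousOn p y hy)
    refine ContinuousOn.clm_apply ((hb p).comp (f := fun q : ℝ × ℝ × EuclideanSpace ℝ (Fin (2 * n)) => q.2)
      (by fun_prop) fun q hq => hq.2) (ContinuousOn.clm_apply (hKc.comp
        (f := fun q : ℝ × ℝ × EuclideanSpace ℝ (Fin (2 * n)) => (q.1, q.2.2)) (by fun_prop) fun q hq => ⟨mem_univ _, hq.2.2⟩)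
        (ContinuousOn.clm_apply (hWi.comp (f := fun q : ℝ × ℝ × EuclideanSpace ℝ (Fin (2 * n)) => q.2.2)
          (by fun_prop) fun q hq => hq.2.2) ((ha p).comp (f := fun q : ℝ × ℝ × EuclideanSpace ℝ (Fin (2 * n)) => q.2)
      (by fun_prop) fun q hq => hq.2)))
  have hGeq : ∀ t s, ∀ q ∈ φ.source, G (t, s, φ q) = b s q (K t q (D.sharp (a s) q)) := by
    intro t s q hq
    have hy := φ.map_source hq
    let B : M → EuclideanSpace ℝ (Fin (2 * n)) →L[ℝ] ℝ := b s
    let Kt : M → EuclideanSpace ℝ (Fin (2 * n)) →L[ℝ] EuclideanSpace ℝ (Fin (2 * n)) := K t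
    let Sh : M → EuclideanSpace ℝ (Fin (2 * n)) := D.sharp (a s)
    have h1 : Sh (φ.symm (φ q)) = _ := hsharp s (φ q) hy
    change B (φ.symm (φ q)) (chartInvDeriv p (φ q) (chartDeriv p (φ q) (Kt (φ.symm (φ q))
      (chartInvDeriv p (φ q) ((Wc (φ q)).inverse ((a s).chartRep p (φ q))))))) = B q (Kt q (Sh q))
    rw [chartInvDeriv_chartDeriv p hy, ← h1, φ.left_inv hq]
  have hnh : (univ : Set ℝ) ×ˢ ((univ : Set ℝ) ×ˢ φ.source) ∈ 𝓝 (t₀, s₀, p) :=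
    (isOpen_univ.prod (isOpen_univ.prod (isOpen_extChartAt_source p))).mem_nhds
      ⟨mem_univ _, mem_univ _, mem_extChartAt_source p⟩
  have hφc : ContinuousAt φ p := continuousAt_extChartAt p
  have hcomp : ContinuousWithinAt (fun q : ℝ × ℝ × M => G (q.1, q.2.1, φ q.2.2))
      ((univ ×ˢ (S ×ˢ univ)) ∩ (univ ×ˢ (univ ×ˢ φ.source))) (t₀, s₀, p) := by
    refine ContinuousWithinAt.comp (t := univ ×ˢ (S ×ˢ φ.target)) (x := (t₀, s₀, p)) (g := G)
      (f := fun q : ℝ × ℝ × M => (q.1, q.2.1, φ q.2.2))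
      (hG (t₀, s₀, φ p) ⟨mem_univ _, hs₀, mem_extChartAt_target p⟩) ?_ ?_
    · refine ContinuousAt.continuousWithinAt ?_
      refine continuousAt_fst.prodMk ((continuousAt_fst.comp continuousAt_snd).prodMk ?_)
      exact ContinuousAt.comp (f := fun q : ℝ × ℝ × M => q.2.2) hφc (by fun_prop)
    · rintro q ⟨h1, h2⟩
      exact ⟨mem_univ _, h1.2.1, φ.map_source h2.2.2⟩
  have hfin := hcomp.congr (f := fun q : ℝ × ℝ × M => G (q.1, q.2.1, φ q.2.2))
    (g := fun q : ℝ × ℝ × M => b q.2.1 q.2.2 (K q.1 q.2.2 (D.sharp (a q.2.1) q.2.2)))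
    (fun q hq => (hGeq _ _ _ hq.2.2.2).symm) (hGeq _ _ _ (mem_extChartAt_source p)).symm
  exact (continuousWithinAt_inter hnh).1 hfin

end LiouvilleCompletion
end RabinowitzFloer

/-! ### Uniform constants from compactness -/

namespace RabinowitzFloer

theorem sq_pairing_le {E : Type*} [AddCommGroup E] [Module ℝ E] (g : E → E → ℝ)
    (hadd : ∀ u v w, g (u + v) w = g u w + g v w) (hsm : ∀ (c : ℝ) v w, g (c • v) w = c * g v w)
    (hsymm : ∀ v w, g v w = g w v) (hpos : ∀ v, 0 ≤ g v v) (v w : E) :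
    g v w ^ 2 ≤ g v v * g w w := by
  have h : ∀ x : ℝ, 0 ≤ g v v * (x * x) + 2 * g v w * x + g w w := by
    intro x
    have h1 := hpos (x • v + w)
    rw [hadd, hsm, hsymm v, hsymm w, hadd, hsm, hadd, hsm, hsymm w v] at h1
    linarith
  have h2 := discrim_le_zero h
  rw [discrim] at h2
  linarith

section HalfLine

variable {S : Set ℝ} (hS : S = Ici 0 ∨ S = Iic 0)
include hS

theorem halfLine_isClosed : IsClosed S := by
  rcases hS with rfl | rfl
  exacts [isClosed_Ici, isClosed_Iic]

theorem halfLine_uniqueDiffOn : UniqueDiffOn ℝ S := by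
  rcases hS with rfl | rfl
  exacts [uniqueDiffOn_Ici 0, uniqueDiffOn_Iic 0]

end HalfLine

namespace LiouvilleCompletion

variable {n : ℕ}
  {M : Type*} [TopologicalSpace M] [ChartedSpace (EuclideanSpace ℝ (Fin (2 * n))) M]
  [IsManifold (𝓡 (2 * n)) ∞ M]
  {N : Type*} [TopologicalSpace N] [ChartedSpace (EuclideanSpace ℝ (Fin (2 * n - 1))) N]
  [IsManifold (𝓡 (2 * n - 1)) ∞ N]
  (D : LiouvilleCompletion n M N)

/-- The Liouville domain together with the part `ρ ≤ R` of the cylinder, for `R ≥ 1`. -/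
def filled (R : ℝ) : Set M := (D.cyl '' (univ ×ˢ Ioi R))ᶜ

theorem mem_filled_compl {R : ℝ} (hR : 0 < R) {w : M} :
    w ∉ D.filled R ↔ w ∈ D.cyl.target ∧ R < D.radius w := by
  rw [filled, notMem_compl_iff]
  constructor
  · rintro ⟨⟨x, r⟩, ⟨-, hr⟩, rfl⟩
    have hr' : 0 < r := hR.trans hr
    exact ⟨D.cyl_mem_target hr', by rw [D.radius_cyl hr']; exact hr⟩
  · rintro ⟨h1, h2⟩
    exact ⟨((D.cyl.symm w).1, D.radius w), ⟨mem_univ _, h2⟩, D.cyl_radius h1⟩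

theorem isClosed_filled {R : ℝ} (hR : 0 < R) : IsClosed (D.filled R) := by
  rw [filled, isClosed_compl_iff]
  refine D.cyl.isOpen_image_of_subset_source (isOpen_univ.prod isOpen_Ioi) ?_
  rw [D.cyl_source]
  exact prod_mono le_rfl (Ioi_subset_Ioi hR.le)

variable [T2Space M]

-- `N` is the projection of the frontier of the compact core, that is, of `N × {1}`.
include D in
theorem compactSpace_boundary : CompactSpace N := by
  have h1 : IsCompact (frontier D.core) := D.core_compact.of_isClosed_subset isClosed_frontier
    D.core_compact.isClosed.frontier_subset
  have h2 : ContinuousOn (fun q => (D.cyl.symm q).1) (frontier D.core) := by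
    refine continuous_fst.comp_continuousOn (D.cyl.continuousOn_symm.mono ?_)
    rw [D.core_frontier]
    rintro _ ⟨⟨x, r⟩, ⟨-, hr⟩, rfl⟩
    refine D.cyl_mem_target ?_
    have hr' : r = 1 := hr
    rw [hr']
    exact one_pos
  have h3 := h1.image_of_continuousOn h2
  refine ⟨h3.of_isClosed_subset isClosed_univ fun x _ => ?_⟩
  refine ⟨D.cyl (x, 1), ?_, ?_⟩
  · rw [D.core_frontier]
    exact ⟨(x, 1), ⟨mem_univ _, rfl⟩, rfl⟩
  · exact congrArg Prod.fst (D.cyl_symm_cyl one_pos)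

theorem isCompact_filled {R : ℝ} (hR : 1 ≤ R) : IsCompact (D.filled R) := by
  have := D.compactSpace_boundary
  have h1 : IsCompact (D.core ∪ D.cyl '' (univ ×ˢ Icc 1 R)) := by
    refine D.core_compact.union ((isCompact_univ.prod isCompact_Icc).image_of_continuousOn
      (D.cyl.continuousOn.mono ?_))
    rw [D.cyl_source]
    exact prod_mono le_rfl fun r hr => one_pos.trans_le hr.1
  refine h1.of_isClosed_subset (D.isClosed_filled (one_pos.trans_le hR)) fun w hw => ?_
  by_cases hc : w ∈ D.core
  · exact Or.inl hc
  · right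
    have h2 : w ∈ D.coreᶜ := hc
    rw [D.core_compl] at h2
    obtain ⟨⟨x, r⟩, ⟨-, hr⟩, rfl⟩ := h2
    refine ⟨(x, r), ⟨mem_univ _, ⟨le_of_lt hr, ?_⟩⟩, rfl⟩
    by_contra! hcon
    exact hw ⟨(x, r), ⟨mem_univ _, hcon⟩, rfl⟩

variable {J : ℝ → ∀ p : M, TangentSpace (𝓡 (2 * n)) p →L[ℝ] TangentSpace (𝓡 (2 * n)) p}

-- Cauchy–Schwarz for the metric `ω(J_t ·, ·)`: the gradient of `a` for this metric is `-J_t a^♯`,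
-- where `ω(a^♯, ·) = a`.
omit [T2Space M] in
theorem IsCompatibleLoop.sq_le (hJ : D.IsCompatibleLoop J) (t : ℝ) (a : OneForm (2 * n) M) (p : M)
    (ζ : TangentSpace (𝓡 (2 * n)) p) :
    a p ζ ^ 2 ≤ (-a p (J t p (D.sharp a p))) * D.omega p (J t p ζ) ζ := by
  let W : EuclideanSpace ℝ (Fin (2 * n)) →L[ℝ] EuclideanSpace ℝ (Fin (2 * n)) →L[ℝ] ℝ := D.omega p
  let J' : EuclideanSpace ℝ (Fin (2 * n)) →L[ℝ] EuclideanSpace ℝ (Fin (2 * n)) := J t p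
  let X : EuclideanSpace ℝ (Fin (2 * n)) := D.sharp a p
  let a' : EuclideanSpace ℝ (Fin (2 * n)) →L[ℝ] ℝ := a p
  let ζ' : EuclideanSpace ℝ (Fin (2 * n)) := ζ
  have hX : ∀ v, W X v = a' v := D.omega_sharp a p
  have hJJ : ∀ v, J' (J' v) = -v := hJ.sq_eq_neg t p
  have h := sq_pairing_le (E := EuclideanSpace ℝ (Fin (2 * n))) (fun v w => W (J' v) w)
    (fun u v w => by simp) (fun c v w => by simp) (hJ.symm t p) (hJ.nonneg D t p) (J' X) ζ'
  simp only [hJJ, map_neg, _root_.neg_apply, hX, even_two, Even.neg_pow] at h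
  exact h

omit [T2Space M] in
theorem IsCompatibleLoop.fract (hJ : D.IsCompatibleLoop J) (t : ℝ) : J t = J (Int.fract t) := by
  have h : Function.Periodic J 1 := hJ.periodic
  conv_lhs => rw [← Int.fract_add_floor t]
  simpa using h.int_mul ⌊t⌋ (Int.fract t)

-- By periodicity `t` may be taken in `[0, 1]`, so the norm of the form is a continuous function on
-- a compact set.
omit [T2Space M] in
theorem IsCompatibleLoop.exists_sq_le (hJ : D.IsCompatibleLoop J) {S S₁ : Set ℝ} (hS₁ : S₁ ⊆ S)
    (hS₁c : IsCompact S₁) {K : Set M} (hK : IsCompact K) {a : ℝ → OneForm (2 * n) M}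
    (ha : ContinuousForms S a) :
    ∃ c : ℝ, 0 < c ∧ ∀ t, ∀ s ∈ S₁, ∀ p ∈ K, ∀ ζ : TangentSpace (𝓡 (2 * n)) p,
      a s p ζ ^ 2 ≤ c * D.omega p (J t p ζ) ζ := by
  have h1 := D.continuousOn_pairing ha ha (hJ.continuousEndos D)
  obtain ⟨C, hC⟩ := (isCompact_Icc.prod (hS₁c.prod hK)).exists_bound_of_continuousOn
    (h1.mono (prod_mono (subset_univ (Icc (0 : ℝ) 1)) (prod_mono hS₁ (subset_univ K))))
  refine ⟨|C| + 1, by positivity, fun t s hs p hp ζ => ?_⟩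
  rw [hJ.fract D t]
  refine (hJ.sq_le D (Int.fract t) (a s) p ζ).trans ?_
  refine mul_le_mul_of_nonneg_right ?_ (hJ.nonneg D _ p ζ)
  have h2 := hC (Int.fract t, s, p) ⟨⟨Int.fract_nonneg t, (Int.fract_lt_one t).le⟩, hs, hp⟩
  have h3 := neg_le_of_abs_le ((Real.norm_eq_abs _).symm ▸ h2)
  have h4 := le_abs_self C
  linarith

section Family

variable {S : Set ℝ} (hS : S = Ici 0 ∨ S = Iic 0) {H : ℝ → M → ℝ} {r₀ : ℝ} {h : ℝ → ℝ → ℝ}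

-- The family is stationary for `|s| ≥ 1`, so the part over `S ∩ [-1, 1]` already contains every
-- Hamiltonian that occurs.
omit [T2Space M] in
include hS in
theorem IsHamiltonianFamily.exists_compact (hH : D.IsHamiltonianFamily S H r₀ h) :
    ∃ S₁ ⊆ S, IsCompact S₁ ∧ ∀ s ∈ S, ∃ s' ∈ S₁, H s = H s' := by
  refine ⟨S ∩ Icc (-1) 1, inter_subset_left, isCompact_Icc.inter_left (halfLine_isClosed hS), ?_⟩
  intro s hs
  have h0 : s ∈ S → 1 ≤ s → (1 : ℝ) ∈ S := by
    rcases hS with rfl | rfl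
    · intro _ _; exact mem_Ici.2 zero_le_one
    · intro h1 h2; exact absurd (mem_Iic.1 h1) (by linarith)
  have h0' : s ∈ S → s ≤ -1 → (-1 : ℝ) ∈ S := by
    rcases hS with rfl | rfl
    · intro h1 h2; exact absurd (mem_Ici.1 h1) (by linarith)
    · intro _ _; exact mem_Iic.2 (by norm_num)
  rcases le_or_gt 1 s with h1 | h1
  · exact ⟨1, ⟨h0 hs h1, by norm_num⟩, hH.const_pos s hs h1⟩
  rcases le_or_gt s (-1) with h2 | h2
  · exact ⟨-1, ⟨h0' hs h2, by norm_num⟩, hH.const_neg s hs h2⟩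
  · exact ⟨s, ⟨hs, h2.le, h1.le⟩, rfl⟩

omit [T2Space M] in
theorem IsHamiltonianFamily.contMDiff (hH : D.IsHamiltonianFamily S H r₀ h) {s : ℝ} (hs : s ∈ S) :
    ContMDiff (𝓡 (2 * n)) 𝓘(ℝ, ℝ) ∞ (H s) := by
  rw [← contMDiffOn_univ]
  exact hH.smooth.comp (f := fun q : M => (s, q)) (contMDiff_const.prodMk contMDiff_id).contMDiffOn
    (fun z hz => ⟨hs, mem_univ _⟩)

omit [T2Space M] in
theorem radial_of_mem (hr₀ : 0 < r₀) (hH : D.IsHamiltonianFamily S H r₀ h) {s : ℝ} (hs : s ∈ S)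
    {w : M} (hw : w ∈ D.cylEnd r₀) : H s w = h s (D.radius w) := by
  obtain ⟨h1, h2⟩ := (D.mem_cylEnd hr₀).1 hw
  have := hH.radial s hs (D.cyl.symm w).1 (D.radius w) h2
  rwa [D.cyl_radius h1] at this

include hS in
theorem IsHamiltonianFamily.exists_lower_bound (hr₀ : 0 < r₀) (hH : D.IsHamiltonianFamily S H r₀ h)
    (hpos : ∀ s ∈ S, ∀ r, r₀ ≤ r → 0 < h s r) :
    ∃ m : ℝ, 0 ≤ m ∧ ∀ s ∈ S, ∀ w, -m ≤ H s w := by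
  obtain ⟨S₁, hS₁, hS₁c, hS₁e⟩ := hH.exists_compact D hS
  obtain ⟨C, hC⟩ := (hS₁c.prod (D.isCompact_filled (R := max 1 r₀) (le_max_left _ _))).exists_bound_of_continuousOn
    (hH.smooth.continuousOn.mono (prod_mono hS₁ (subset_univ _)))
  refine ⟨|C|, abs_nonneg _, fun s hs w => ?_⟩
  obtain ⟨s', hs', he⟩ := hS₁e s hs
  rw [he]
  by_cases hw : w ∈ D.filled (max 1 r₀)
  · have h2 := hC (s', w) ⟨hs', hw⟩
    have h3 := neg_le_of_abs_le ((Real.norm_eq_abs _).symm ▸ h2)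
    have h4 := le_abs_self C
    linarith
  · obtain ⟨h1, h2⟩ := (D.mem_filled_compl (by positivity)).1 hw
    have h3 : w ∈ D.cylEnd r₀ := (D.mem_cylEnd hr₀).2 ⟨h1, (le_max_right _ _).trans h2.le⟩
    rw [D.radial_of_mem hr₀ hH (hS₁ hs') h3]
    have := hpos s' (hS₁ hs') _ ((D.mem_cylEnd hr₀).1 h3).2
    linarith [abs_nonneg C]

omit [T2Space M] in
include hS in
theorem IsHamiltonianFamily.continuousOn_lam_hamVF (hH : D.IsHamiltonianFamily S H r₀ h) :
    ContinuousOn (fun q : ℝ × M => D.lam q.2 (D.hamVF (H q.1) q.2)) (S ×ˢ univ) := by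
  have h1 := D.continuousOn_pairing (D.continuousForms_diff (halfLine_uniqueDiffOn hS) hH.smooth)
    (D.lam_smooth.continuousForms S) continuousEndos_id
  have h2 := (h1.comp (f := fun q : ℝ × M => ((0 : ℝ), q)) (s := S ×ˢ univ) (by fun_prop)
    (fun q hq => ⟨mem_univ _, hq⟩)).neg
  refine h2.congr fun q hq => ?_
  have h3 : D.hamVF (H q.1) q.2 = -D.sharp (D.diff (H q.1)) q.2 := by
    rw [eq_neg_iff_add_eq_zero]
    refine D.nondegenerate q.2 _ fun w => ?_
    have h4 := D.omega_hamVF (H q.1) q.2 w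
    have h5 := D.omega_sharp (D.diff (H q.1)) q.2 w
    rw [map_add]
    change D.omega _ _ _ + D.omega _ _ _ = 0
    rw [h4, h5]
    ring
  rw [h3, map_neg]
  rfl

-- Transversality is assumed on the zero level only. On a compact set it spreads to a neighbourhood
-- of that level, at the price of half the constant.
omit [T2Space M] in
include hS in
theorem IsHamiltonianFamily.exists_transverse (hH : D.IsHamiltonianFamily S H r₀ h) {K : Set M}
    (hK : IsCompact K) :
    ∃ θ δ : ℝ, 0 < θ ∧ 0 < δ ∧ ∀ s ∈ S, ∀ w ∈ K, |H s w| ≤ δ → θ ≤ D.lam w (D.hamVF (H s) w) - H s w := by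
  obtain ⟨θ, hθ, hθ'⟩ := hH.transverse
  obtain ⟨S₁, hS₁, hS₁c, hS₁e⟩ := hH.exists_compact D hS
  have hSK : S₁ ×ˢ K ⊆ S ×ˢ univ := prod_mono hS₁ (subset_univ _)
  have hc1 : ContinuousOn (fun q : ℝ × M => H q.1 q.2) (S₁ ×ˢ K) := hH.smooth.continuousOn.mono hSK
  have hc2 : ContinuousOn (fun q : ℝ × M => D.lam q.2 (D.hamVF (H q.1) q.2) - H q.1 q.2) (S₁ ×ˢ K) :=
    ((hH.continuousOn_lam_hamVF D hS).mono hSK).sub hc1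
  suffices hsuff : ∃ δ : ℝ, 0 < δ ∧ ∀ q ∈ S₁ ×ˢ K, |H q.1 q.2| ≤ δ →
      θ / 2 ≤ D.lam q.2 (D.hamVF (H q.1) q.2) - H q.1 q.2 by
    obtain ⟨δ, hδ, hδ'⟩ := hsuff
    refine ⟨θ / 2, δ, by positivity, hδ, fun s hs w hw hHw => ?_⟩
    obtain ⟨s', hs', he⟩ := hS₁e s hs
    rw [he] at hHw ⊢
    exact hδ' (s', w) ⟨hs', hw⟩ hHw
  have hcpt : IsCompact (S₁ ×ˢ K) := hS₁c.prod hK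
  -- Positive everywhere: the second entry is at least `θ / 2` where `H = 0`, and the first is
  -- positive elsewhere. Below half the minimum of `f`, the entry `|H|` cannot be the one realizing
  -- `f`.
  let f : ℝ × M → ℝ := fun q => max |H q.1 q.2|
    ((D.lam q.2 (D.hamVF (H q.1) q.2) - H q.1 q.2) - θ / 2)
  have hf : ContinuousOn f (S₁ ×ˢ K) := ContinuousOn.sup hc1.abs (hc2.sub continuousOn_const)
  have hfpos : ∀ q ∈ S₁ ×ˢ K, 0 < f q := by
    intro q hq
    by_cases h0 : H q.1 q.2 = 0
    · have := hθ' q.1 (hS₁ hq.1) q.2 h0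
      exact lt_max_of_lt_right (by linarith)
    · exact lt_max_of_lt_left (abs_pos.2 h0)
  rcases (S₁ ×ˢ K).eq_empty_or_nonempty with he | hne
  · exact ⟨1, one_pos, fun q hq => by simp [he] at hq⟩
  obtain ⟨q₀, hq₀, hmin⟩ := hcpt.exists_isMinOn hne hf
  refine ⟨f q₀ / 2, half_pos (hfpos q₀ hq₀), fun q hq hle => ?_⟩
  have h1 : f q₀ ≤ f q := hmin hq
  rcases le_max_iff.1 h1 with h2 | h2
  · linarith [hfpos q₀ hq₀]
  · linarith [hfpos q₀ hq₀]

end Family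

end LiouvilleCompletion
end RabinowitzFloer

/-! ### Small gradient: confinement of the loop and bound on the multiplier -/

namespace RabinowitzFloer
namespace LiouvilleCompletion

variable {n : ℕ}
  {M : Type*} [TopologicalSpace M] [ChartedSpace (EuclideanSpace ℝ (Fin (2 * n))) M]
  [IsManifold (𝓡 (2 * n)) ∞ M]
  {N : Type*} [TopologicalSpace N] [ChartedSpace (EuclideanSpace ℝ (Fin (2 * n - 1))) N]
  [IsManifold (𝓡 (2 * n - 1)) ∞ N]
  (D : LiouvilleCompletion n M N)
  {J : ℝ → ∀ p : M, TangentSpace (𝓡 (2 * n)) p →L[ℝ] TangentSpace (𝓡 (2 * n)) p}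

/-- The defect `x' - η X_H(x)`. -/
noncomputable def defect (H : M → ℝ) (x : ℝ → M) (η : ℝ) (t : ℝ) : TangentSpace (𝓡 (2 * n)) (x t) :=
  velocity (2 * n) x t - η • D.hamVF H (x t)

/-- The square norm of the defect, for the metric `ω(J_t ·, ·)`. -/
noncomputable def defectSq
    (J : ℝ → ∀ p : M, TangentSpace (𝓡 (2 * n)) p →L[ℝ] TangentSpace (𝓡 (2 * n)) p)
    (H : M → ℝ) (x : ℝ → M) (η : ℝ) (t : ℝ) : ℝ :=
  D.omega (x t) (J t (x t) (D.defect H x η t)) (D.defect H x η t)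

theorem IsCompatibleLoop.omega_J (hJ : D.IsCompatibleLoop J) (t : ℝ) (p : M)
    (v : TangentSpace (𝓡 (2 * n)) p) :
    D.omega p (J t p (J t p v)) (J t p v) = D.omega p (J t p v) v := by
  rw [hJ.sq_eq_neg, map_neg, D.omega_neg p (J t p v) v]
  rfl

theorem IsCompatibleLoop.gradNormSq_eq (hJ : D.IsCompatibleLoop J) (H : M → ℝ) (x : ℝ → M) (η : ℝ) :
    D.gradNormSq J H x η = (∫ t in (0 : ℝ)..1, D.defectSq J H x η t) +
      (∫ t in (0 : ℝ)..1, H (x t)) ^ 2 := by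
  rw [gradNormSq, gradReal, neg_sq]
  congr 2
  funext t
  exact hJ.omega_J D t (x t) (D.defect H x η t)

/-- Since `dH(X_H) = 0`, the velocity may be replaced by the defect whatever `η` is. The oscillation
of `H` along the loop is therefore controlled by the gradient without any bound on `η`. -/
theorem hasDerivAt_comp_loop {H : M → ℝ} (hH : ContMDiff (𝓡 (2 * n)) 𝓘(ℝ, ℝ) ∞ H) {x : ℝ → M}
    (hx : ContMDiff 𝓘(ℝ, ℝ) (𝓡 (2 * n)) ∞ x) (η t : ℝ) :
    HasDerivAt (fun t => H (x t)) (D.diff H (x t) (D.defect H x η t)) t := by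
  have h1 := HasMFDerivAt.comp t ((hH (x t)).mdifferentiableAt (by simp)).hasMFDerivAt
    ((hx t).mdifferentiableAt (by simp)).hasMFDerivAt
  let f' : ℝ →L[ℝ] ℝ := (mfderiv (𝓡 (2 * n)) 𝓘(ℝ, ℝ) H (x t)).comp (mfderiv 𝓘(ℝ, ℝ) (𝓡 (2 * n)) x t)
  have h0 : HasFDerivAt (fun t => H (x t)) f' t := hasMFDerivAt_iff_hasFDerivAt.1 h1
  have h2 := h0.hasDerivAt
  have h3 : D.diff H (x t) (D.defect H x η t) = D.diff H (x t) (velocity (2 * n) x t) := by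
    rw [defect, map_sub, map_smul, D.diff_hamVF, smul_zero, sub_zero]
  rw [h3]
  exact h2

theorem continuous_lam_velocity {x : ℝ → M} (hx : ContMDiff 𝓘(ℝ, ℝ) (𝓡 (2 * n)) ∞ x) :
    Continuous fun t => D.lam (x t) (velocity (2 * n) x t) := by
  have h := D.lam_smooth.pull_contDiffOn isOpen_univ hx.contMDiffOn (1 : ℝ)
  exact continuousOn_univ.1 h.continuousOn

variable [T2Space M] {S : Set ℝ} {H : ℝ → M → ℝ} {r₀ : ℝ} {h : ℝ → ℝ → ℝ}

/-- If the gradient of the action functional is small, then the loop stays in the region where the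
Hamiltonian is small, and the multiplier is bounded in terms of the action. -/
theorem IsHamiltonianFamily.exists_gradient_gap (hJ : D.IsCompatibleLoop J) (hr₀ : 0 < r₀)
    (hS : S = Ici 0 ∨ S = Iic 0) (hH : D.IsHamiltonianFamily S H r₀ h) {μ : ℝ} (hμ : 0 < μ)
    (hhμ : ∀ s ∈ S, ∀ r, r₀ ≤ r → μ ≤ h s r) (A : ℝ) :
    ∃ ε C : ℝ, 0 < ε ∧ ∀ s ∈ S, ∀ x : ℝ → M, ContMDiff 𝓘(ℝ, ℝ) (𝓡 (2 * n)) ∞ x → ∀ η : ℝ,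
      IntervalIntegrable (D.defectSq J (H s) x η) volume 0 1 → |D.action (H s) x η| ≤ A →
      D.gradNormSq J (H s) x η < ε ^ 2 → |η| ≤ C ∧ ∀ t ∈ Icc (0 : ℝ) 1, x t ∉ D.cylEnd r₀ := by
  set R := max 1 r₀ with hR
  have hKc : IsCompact (D.filled R) := D.isCompact_filled (le_max_left _ _)
  obtain ⟨m, hm0, hm⟩ := hH.exists_lower_bound D hS hr₀ (fun s hs r hr => hμ.trans_le (hhμ s hs r hr))
  obtain ⟨S₁, hS₁, hS₁c, hS₁e⟩ := hH.exists_compact D hS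
  obtain ⟨c₁, hc₁, hdH⟩ := hJ.exists_sq_le D hS₁ hS₁c hKc
    (D.continuousForms_diff (halfLine_uniqueDiffOn hS) hH.smooth)
  obtain ⟨c₂, hc₂, hlam⟩ := hJ.exists_sq_le D hS₁ hS₁c hKc (D.lam_smooth.continuousForms S)
  obtain ⟨θ, δ, hθ, hδ, hθδ⟩ := hH.exists_transverse D hS hKc
  -- The width `min δ (μ / 2)` keeps `H` within the range where transversality holds and also
  -- strictly below `μ`, the lower bound of `H` on the end.
  obtain ⟨ε, hε, hε1, hconf⟩ := exists_confinement hc₁ hμ hm0 (δ := min δ (μ / 2)) (by positivity)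
    ((min_le_right _ _).trans (by linarith))
  refine ⟨ε, (A + (c₂ + 1)) / θ, hε, fun s hs x hx η hint hA hgrad => ?_⟩
  have hnotEnd : ∀ w, w ∉ D.filled R → w ∈ D.cylEnd r₀ := by
    intro w hw
    obtain ⟨h1, h2⟩ := (D.mem_filled_compl (by positivity)).1 hw
    exact (D.mem_cylEnd hr₀).2 ⟨h1, (le_max_right _ _).trans h2.le⟩
  have hμend : ∀ w, w ∈ D.cylEnd r₀ → μ ≤ H s w := by
    intro w hw
    rw [D.radial_of_mem hr₀ hH hs hw]
    exact hhμ s hs _ ((D.mem_cylEnd hr₀).1 hw).2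
  have hlow : ∀ w, H s w < μ → w ∈ D.filled R := by
    intro w hw
    by_contra hcon
    exact absurd (hμend w (hnotEnd w hcon)) (not_le.2 hw)
  rw [hJ.gradNormSq_eq D] at hgrad
  have hHs := hH.contMDiff D hs
  have hy := fun t => D.hasDerivAt_comp_loop hHs hx η t
  have hyc : Continuous fun t => H s (x t) := continuous_iff_continuousAt.2 fun t => (hy t).continuousAt
  have hy' : Continuous fun t => D.diff (H s) (x t) (D.defect (H s) x η t) := by
    have h1 : ContDiff ℝ ∞ (fun t => H s (x t)) := by
      rw [← contMDiff_iff_contDiff]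
      exact hHs.comp hx
    have h2 := h1.continuous_deriv (by simp)
    have h3 : deriv (fun t => H s (x t)) = fun t => D.diff (H s) (x t) (D.defect (H s) x η t) :=
      funext fun t => (hy t).deriv
    rwa [h3] at h2
  have hN0 : ∀ t, 0 ≤ D.defectSq J (H s) x η t := fun t => hJ.nonneg D t _ _
  have hNi0 : 0 ≤ ∫ t in (0 : ℝ)..1, D.defectSq J (H s) x η t :=
    intervalIntegral.integral_nonneg (by norm_num) fun t _ => hN0 t
  have hsq := sq_nonneg (∫ t in (0 : ℝ)..1, H s (x t))
  have hbound := hconf (fun t => H s (x t)) _ (D.defectSq J (H s) x η) hy hy' hN0 hint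
    (by
      intro t ht
      obtain ⟨s', hs', he⟩ := hS₁e s hs
      have := hdH t s' hs' (x t) (hlow _ ht) (D.defect (H s) x η t)
      rw [← he] at this
      exact this)
    (fun t => hm s hs (x t)) (by linarith) (by
      refine abs_lt_of_sq_lt_sq ?_ hε.le
      linarith)
  have hlow' : ∀ t ∈ Icc (0 : ℝ) 1, H s (x t) < μ := by
    intro t ht
    have h1 := (abs_le.1 (hbound t ht)).2
    have h2 : min δ (μ / 2) ≤ μ / 2 := min_le_right _ _
    linarith
  refine ⟨?_, fun t ht hcon => absurd (hμend _ hcon) (not_le.2 (hlow' t ht))⟩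
  -- the bound on the multiplier
  have hcl := D.continuous_lam_velocity hx
  have hcX : Continuous fun t => D.lam (x t) (D.hamVF (H s) (x t)) := by
    have h1 := (hH.continuousOn_lam_hamVF D hS).comp (f := fun t => (s, x t)) (s := univ)
      (continuous_const.prodMk hx.continuous).continuousOn (fun t _ => ⟨hs, mem_univ _⟩)
    exact continuousOn_univ.1 h1
  have hsplit : ∀ t, D.lam (x t) (velocity (2 * n) x t) =
      D.lam (x t) (D.defect (H s) x η t) + η * D.lam (x t) (D.hamVF (H s) (x t)) := by
    intro t
    rw [defect, map_sub, map_smul, smul_eq_mul]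
    ring
  have hcd : Continuous fun t => D.lam (x t) (D.defect (H s) x η t) := by
    have h1 : (fun t => D.lam (x t) (D.defect (H s) x η t)) = fun t =>
        D.lam (x t) (velocity (2 * n) x t) - η * D.lam (x t) (D.hamVF (H s) (x t)) := by
      funext t
      rw [hsplit]
      ring
    rw [h1]
    exact hcl.sub (continuous_const.mul hcX)
  -- The first integral is controlled by the gradient and the factor of `η` is at least `θ`, so the
  -- action bounds `η`.
  have hact : D.action (H s) x η = (∫ t in (0 : ℝ)..1, D.lam (x t) (D.defect (H s) x η t)) +
      η * ∫ t in (0 : ℝ)..1, (D.lam (x t) (D.hamVF (H s) (x t)) - H s (x t)) := by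
    have hcX' : Continuous fun t => η * D.lam (x t) (D.hamVF (H s) (x t)) := continuous_const.mul hcX
    rw [action, intervalIntegral.integral_congr (fun t _ => hsplit t), intervalIntegral.integral_add
      (hcd.intervalIntegrable _ _) (hcX'.intervalIntegrable _ _),
      intervalIntegral.integral_const_mul, intervalIntegral.integral_sub
      (hcX.intervalIntegrable _ _) (hyc.intervalIntegrable _ _)]
    ring
  have hI1 : |∫ t in (0 : ℝ)..1, D.lam (x t) (D.defect (H s) x η t)| ≤ c₂ + 1 := by
    have h1 : |∫ t in (0 : ℝ)..1, D.lam (x t) (D.defect (H s) x η t)| ≤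
        ∫ t in (0 : ℝ)..1, (c₂ * D.defectSq J (H s) x η t + 1) := by
      refine intervalIntegral.norm_integral_le_of_norm_le
        (f := fun t => D.lam (x t) (D.defect (H s) x η t)) (by norm_num)
        (ae_of_all _ fun t ht => ?_) ((hint.const_mul c₂).add intervalIntegrable_const)
      obtain ⟨s', hs', he⟩ := hS₁e s hs
      have h2 := hlam t s' hs' (x t) (hlow _ (hlow' t (Ioc_subset_Icc_self ht))) (D.defect (H s) x η t)
      rw [Real.norm_eq_abs]
      have h3 : |D.lam (x t) (D.defect (H s) x η t)| ≤ D.lam (x t) (D.defect (H s) x η t) ^ 2 + 1 := by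
        rw [← sq_abs]
        nlinarith [sq_nonneg (|D.lam (x t) (D.defect (H s) x η t)| - 1 / 2)]
      exact h3.trans (by gcongr; exact h2)
    rw [intervalIntegral.integral_add (hint.const_mul c₂) intervalIntegrable_const,
      intervalIntegral.integral_const_mul] at h1
    simp only [intervalIntegral.integral_const, sub_zero, smul_eq_mul, mul_one] at h1
    have h4 : (∫ t in (0 : ℝ)..1, D.defectSq J (H s) x η t) ≤ 1 := by nlinarith
    nlinarith
  have hI2 : θ ≤ ∫ t in (0 : ℝ)..1, (D.lam (x t) (D.hamVF (H s) (x t)) - H s (x t)) := by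
    have h1 : ∫ t in (0 : ℝ)..1, θ ≤
        ∫ t in (0 : ℝ)..1, (D.lam (x t) (D.hamVF (H s) (x t)) - H s (x t)) :=
      intervalIntegral.integral_mono_on (by norm_num) intervalIntegrable_const
        ((hcX.sub hyc).intervalIntegrable _ _) fun t ht =>
        hθδ s hs _ (hlow _ (hlow' t ht)) ((hbound t ht).trans (min_le_left _ _))
    simpa using h1
  set I₂ := ∫ t in (0 : ℝ)..1, (D.lam (x t) (D.hamVF (H s) (x t)) - H s (x t)) with hI₂
  rw [le_div_iff₀ hθ]
  have h5 : |η| * I₂ ≤ A + (c₂ + 1) := by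
    have h6 : |η| * I₂ = |η * I₂| := by rw [abs_mul, abs_of_nonneg (hθ.le.trans hI2)]
    rw [h6]
    have h7 : η * I₂ = D.action (H s) x η - ∫ t in (0 : ℝ)..1, D.lam (x t) (D.defect (H s) x η t) := by
      rw [hact]; ring
    rw [h7]
    exact (abs_sub _ _).trans (by linarith)
  exact (mul_le_mul_of_nonneg_left hI2 (abs_nonneg η)).trans h5

end LiouvilleCompletion
end RabinowitzFloer

/-! ### The exhausting function -/

namespace RabinowitzFloer

/-- A smooth convex function which vanishes on `(-∞, 0]` and has slope `1` on `[1, ∞)`. -/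
noncomputable def ramp (x : ℝ) : ℝ := ∫ y in (0 : ℝ)..x, Real.smoothTransition y

theorem hasDerivAt_ramp (x : ℝ) : HasDerivAt ramp (Real.smoothTransition x) x :=
  (Real.smoothTransition.continuous.integral_hasStrictDerivAt 0 x).hasDerivAt

theorem contDiff_ramp : ContDiff ℝ ∞ ramp := by
  rw [contDiff_infty_iff_deriv]
  refine ⟨fun x => (hasDerivAt_ramp x).differentiableAt, ?_⟩
  have : deriv ramp = Real.smoothTransition := funext fun x => (hasDerivAt_ramp x).deriv
  rw [this]
  exact Real.smoothTransition.contDiff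

theorem ramp_of_nonpos {x : ℝ} (hx : x ≤ 0) : ramp x = 0 := by
  rw [ramp, intervalIntegral.integral_symm, neg_eq_zero]
  rw [intervalIntegral.integral_congr (g := fun _ => (0 : ℝ)) fun y hy => ?_]
  · simp
  · rw [uIcc_of_le hx] at hy
    exact Real.smoothTransition.zero_of_nonpos hy.2

theorem monotone_ramp : Monotone ramp :=
  monotone_of_hasDerivAt_nonneg hasDerivAt_ramp fun x => Real.smoothTransition.nonneg x

theorem ramp_nonneg (x : ℝ) : 0 ≤ ramp x := by
  rcases le_total x 0 with h | h
  · exact (ramp_of_nonpos h).ge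
  · exact (ramp_of_nonpos le_rfl).ge.trans (monotone_ramp h)

theorem ramp_le {x : ℝ} (hx : 0 ≤ x) : ramp x ≤ x := by
  have h1 : Monotone fun x => x - ramp x :=
    monotone_of_hasDerivAt_nonneg (fun x => (hasDerivAt_id x).sub (hasDerivAt_ramp x)) fun x => by
      simpa using Real.smoothTransition.le_one x
  have h2 := h1 hx
  simp only [ramp_of_nonpos le_rfl] at h2
  linarith

theorem sub_one_le_ramp (x : ℝ) : x - 1 ≤ ramp x := by
  rcases le_total x 1 with h | h
  · linarith [ramp_nonneg x]
  · have h1 : ∫ y in (1 : ℝ)..x, Real.smoothTransition y = x - 1 := by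
      rw [intervalIntegral.integral_congr (g := fun _ => (1 : ℝ)) fun y hy => ?_]
      · simp
      · rw [uIcc_of_le h] at hy
        exact Real.smoothTransition.one_of_one_le hy.1
    have h2 : ramp x = ramp 1 + ∫ y in (1 : ℝ)..x, Real.smoothTransition y :=
      (intervalIntegral.integral_add_adjacent_intervals
        (Real.smoothTransition.continuous.intervalIntegrable _ _)
        (Real.smoothTransition.continuous.intervalIntegrable _ _)).symm
    linarith [ramp_nonneg 1]

theorem monotone_smoothTransition : Monotone Real.smoothTransition := by
  intro x y hxy
  have h1 : expNegInvGlue x ≤ expNegInvGlue y := expNegInvGlue.monotone hxy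
  have h2 : expNegInvGlue (1 - y) ≤ expNegInvGlue (1 - x) := expNegInvGlue.monotone (by linarith)
  rw [Real.smoothTransition, Real.smoothTransition,
    div_le_div_iff₀ (Real.smoothTransition.pos_denom x) (Real.smoothTransition.pos_denom y)]
  nlinarith [expNegInvGlue.nonneg x, expNegInvGlue.nonneg (1 - y)]

theorem deriv_smoothTransition_nonneg (x : ℝ) : 0 ≤ deriv Real.smoothTransition x :=
  monotone_smoothTransition.deriv_nonneg

theorem hasDerivAt_smoothTransition (x : ℝ) :
    HasDerivAt Real.smoothTransition (deriv Real.smoothTransition x) x :=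
  ((Real.smoothTransition.contDiff (n := 1)).differentiable (by simp) x).hasDerivAt

/-- First derivative of `ramp (log r - a)` along a curve. -/
theorem hasDerivAt_ramp_log {r : ℝ → ℝ} {r' s a : ℝ} (hr : HasDerivAt r r' s) (h0 : 0 < r s) :
    HasDerivAt (fun σ => ramp (Real.log (r σ) - a))
      (Real.smoothTransition (Real.log (r s) - a) * (r' / r s)) s :=
  (hasDerivAt_ramp _).comp s ((hr.log h0.ne').sub_const a)

/-- Second derivative of `ramp (log r - a)` along a curve. -/
theorem hasDerivAt_ramp_log_deriv {r r₁ : ℝ → ℝ} {r₂ s a : ℝ} (hr : HasDerivAt r (r₁ s) s)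
    (hr₁ : HasDerivAt r₁ r₂ s) (h0 : 0 < r s) :
    HasDerivAt (fun σ => Real.smoothTransition (Real.log (r σ) - a) * (r₁ σ / r σ))
      (deriv Real.smoothTransition (Real.log (r s) - a) * (r₁ s / r s) ^ 2 +
        Real.smoothTransition (Real.log (r s) - a) * (r₂ / r s - (r₁ s / r s) ^ 2)) s := by
  have h1 := (hasDerivAt_smoothTransition _).comp s ((hr.log h0.ne').sub_const a)
  have h2 := h1.mul (hr₁.div hr h0.ne')
  refine h2.congr_deriv ?_
  simp only [Function.comp_apply, Pi.div_apply]
  field_simp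

namespace LiouvilleCompletion

variable {n : ℕ}
  {M : Type*} [TopologicalSpace M] [ChartedSpace (EuclideanSpace ℝ (Fin (2 * n))) M]
  [IsManifold (𝓡 (2 * n)) ∞ M]
  {N : Type*} [TopologicalSpace N] [ChartedSpace (EuclideanSpace ℝ (Fin (2 * n - 1))) N]
  [IsManifold (𝓡 (2 * n - 1)) ∞ N]
  (D : LiouvilleCompletion n M N)

open Classical in
/-- The exhausting function `ramp (log ρ - a)`, extended by zero to `M`. -/
noncomputable def exhaustion (a : ℝ) (w : M) : ℝ :=
  if w ∈ D.cyl.target then ramp (Real.log (D.radius w) - a) else 0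

theorem exhaustion_of_mem {a : ℝ} {w : M} (hw : w ∈ D.cyl.target) :
    D.exhaustion a w = ramp (Real.log (D.radius w) - a) := if_pos hw

theorem exhaustion_nonneg (a : ℝ) (w : M) : 0 ≤ D.exhaustion a w := by
  rw [exhaustion]
  split_ifs
  · exact ramp_nonneg _
  · exact le_rfl

theorem exhaustion_eventuallyEq {a : ℝ} {w : M} (hw : w ∈ D.cyl.target) :
    D.exhaustion a =ᶠ[𝓝 w] fun q => ramp (Real.log (D.radius q) - a) := by
  filter_upwards [D.cyl.open_target.mem_nhds hw] with q hq
  exact D.exhaustion_of_mem hq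

/-- Such a point lies in the interior of the core. Nearby, `ρ ≤ 1` wherever `ρ` is defined, and then
`log ρ - a ≤ 0` because `a ≥ 0`. -/
theorem exhaustion_eq_zero_of_notMem_target [T2Space M] {a : ℝ} (ha : 0 ≤ a) {w : M} (hw : w ∉ D.cyl.target) :
    D.exhaustion a =ᶠ[𝓝 w] fun _ => 0 := by
  have h1 : w ∈ D.core := by
    by_contra hcon
    have h2 : w ∈ D.coreᶜ := hcon
    rw [D.core_compl] at h2
    obtain ⟨⟨x, r⟩, ⟨-, hr⟩, rfl⟩ := h2
    exact hw (D.cyl_mem_target (one_pos.trans hr))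
  have h2 : w ∈ interior D.core := by
    by_contra hcon
    have h3 : w ∈ frontier D.core := ⟨subset_closure h1, hcon⟩
    rw [D.core_frontier] at h3
    obtain ⟨⟨x, r⟩, ⟨-, hr⟩, rfl⟩ := h3
    have hr' : r = 1 := hr
    exact hw (D.cyl_mem_target (by rw [hr']; exact one_pos))
  filter_upwards [isOpen_interior.mem_nhds h2] with q hq
  by_cases hqt : q ∈ D.cyl.target
  · rw [D.exhaustion_of_mem hqt]
    refine ramp_of_nonpos ?_
    have h4 : D.radius q ≤ 1 := by
      by_contra! hcon
      have h5 : q ∈ D.coreᶜ := by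
        rw [D.core_compl]
        exact ⟨((D.cyl.symm q).1, D.radius q), ⟨mem_univ _, hcon⟩, D.cyl_radius hqt⟩
      exact h5 (interior_subset hq)
    have h6 := Real.log_nonpos (D.radius_pos hqt).le h4
    linarith
  · exact if_neg hqt

theorem contMDiff_exhaustion [T2Space M] {a : ℝ} (ha : 0 ≤ a) :
    ContMDiff (𝓡 (2 * n)) 𝓘(ℝ, ℝ) ∞ (D.exhaustion a) := by
  intro w
  by_cases hw : w ∈ D.cyl.target
  · refine ContMDiffAt.congr_of_eventuallyEq ?_ (D.exhaustion_eventuallyEq hw)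
    have h1 := D.contMDiffOn_radius.contMDiffAt (D.cyl.open_target.mem_nhds hw)
    have h2 : ContDiffAt ℝ ∞ (fun r => ramp (Real.log r - a)) (D.radius w) :=
      contDiff_ramp.contDiffAt.comp _ ((Real.contDiffAt_log.2 (D.radius_pos hw).ne').sub
        contDiffAt_const)
    exact ContMDiffAt.comp w h2.contMDiffAt h1
  · exact contMDiffAt_const.congr_of_eventuallyEq (D.exhaustion_eq_zero_of_notMem_target ha hw)

/-- The exhausting function vanishes near the points which do not lie in `ρ > r₀`. -/
theorem exhaustion_eq_zero [T2Space M] {a r₀ : ℝ} (ha : 0 ≤ a) (hra : Real.log r₀ < a) {w : M}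
    (hw : ¬ (w ∈ D.cyl.target ∧ r₀ < D.radius w)) : D.exhaustion a =ᶠ[𝓝 w] fun _ => 0 := by
  by_cases ht : w ∈ D.cyl.target
  · have h1 : D.radius w ≤ r₀ := not_lt.1 fun hcon => hw ⟨ht, hcon⟩
    have h2 : Real.log (D.radius w) < a :=
      (Real.log_le_log (D.radius_pos ht) h1).trans_lt hra
    have h3 : ContinuousAt (fun q => Real.log (D.radius q)) w :=
      (D.mdifferentiableAt_radius ht).continuousAt.log (D.radius_pos ht).ne'
    filter_upwards [h3.eventually_lt continuousAt_const h2, D.cyl.open_target.mem_nhds ht] with q hq hq'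
    rw [D.exhaustion_of_mem hq']
    exact ramp_of_nonpos (by linarith)
  · exact D.exhaustion_eq_zero_of_notMem_target ha ht

/-- Converts a bound on the exhausting function back into a bound on the radius. -/
theorem log_radius_le {a : ℝ} {w : M} (hw : w ∈ D.cyl.target) :
    Real.log (D.radius w) ≤ D.exhaustion a w + a + 1 := by
  rw [D.exhaustion_of_mem hw]
  linarith [sub_one_le_ramp (Real.log (D.radius w) - a)]

end LiouvilleCompletion
end RabinowitzFloer

/-! ### The energy density of a solution -/

namespace RabinowitzFloer
namespace LiouvilleCompletion

variable {n : ℕ}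
  {M : Type*} [TopologicalSpace M] [ChartedSpace (EuclideanSpace ℝ (Fin (2 * n))) M]
  [IsManifold (𝓡 (2 * n)) ∞ M]
  {N : Type*} [TopologicalSpace N] [ChartedSpace (EuclideanSpace ℝ (Fin (2 * n - 1))) N]
  [IsManifold (𝓡 (2 * n - 1)) ∞ N]
  (D : LiouvilleCompletion n M N)
  {J : ℝ → ∀ p : M, TangentSpace (𝓡 (2 * n)) p →L[ℝ] TangentSpace (𝓡 (2 * n)) p}

/-- The differential of `(s, t) ↦ u s t`. -/
noncomputable def dmap (_D : LiouvilleCompletion n M N) (u : ℝ → ℝ → M) (q : ℝ × ℝ) :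
    ℝ × ℝ →L[ℝ] TangentSpace (𝓡 (2 * n)) (u q.1 q.2) :=
  mfderiv 𝓘(ℝ, ℝ × ℝ) (𝓡 (2 * n)) (fun q : ℝ × ℝ => u q.1 q.2) q

section Curves

variable {u : ℝ → ℝ → M} {q : ℝ × ℝ}
  (hu : MDifferentiableAt 𝓘(ℝ, ℝ × ℝ) (𝓡 (2 * n)) (fun q : ℝ × ℝ => u q.1 q.2) q)
include hu

omit [IsManifold (𝓡 (2 * n)) ∞ M] in
theorem hasMFDerivAt_curve {c : ℝ → ℝ × ℝ} {c' : ℝ × ℝ} {x : ℝ} (hc : HasDerivAt c c' x)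
    (hcq : c x = q) [IsManifold (𝓡 (2 * n)) ∞ M] (D : LiouvilleCompletion n M N) :
    (mfderiv 𝓘(ℝ, ℝ) (𝓡 (2 * n)) (fun x => u (c x).1 (c x).2) x (1 : ℝ) : EuclideanSpace ℝ (Fin (2 * n)))
      = D.dmap u q c' := by
  subst hcq
  have h1 := HasMFDerivAt.comp x hu.hasMFDerivAt hc.hasFDerivAt.hasMFDerivAt
  have h2 := DFunLike.congr_fun h1.mfderiv (1 : ℝ)
  refine h2.trans ?_
  change D.dmap u (c x) ((1 : ℝ) • c') = _
  rw [one_smul]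

theorem velocity_snd : velocity (2 * n) (u q.1) q.2 = D.dmap u q (0, 1) := by
  have hc : HasDerivAt (fun t : ℝ => (q.1, t)) (0, 1) q.2 :=
    (hasDerivAt_const _ _).prodMk (hasDerivAt_id _)
  exact hasMFDerivAt_curve hu hc rfl D

theorem velocityWithin_fst {S : Set ℝ} (hq : q.1 ∈ interior S) :
    velocityWithin (2 * n) (fun σ => u σ q.2) S q.1 = D.dmap u q (1, 0) := by
  have hc : HasDerivAt (fun s : ℝ => (s, q.2)) (1, 0) q.1 :=
    (hasDerivAt_id _).prodMk (hasDerivAt_const _ _)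
  rw [velocityWithin, mfderivWithin_of_mem_nhds (mem_interior_iff_mem_nhds.1 hq)]
  exact hasMFDerivAt_curve hu hc rfl D

theorem hasFDerivAt_comp_map {f : M → ℝ} (hf : MDifferentiableAt (𝓡 (2 * n)) 𝓘(ℝ, ℝ) f (u q.1 q.2)) :
    HasFDerivAt (fun q : ℝ × ℝ => f (u q.1 q.2)) ((D.diff f (u q.1 q.2)).comp (D.dmap u q)) q := by
  have h1 := HasMFDerivAt.comp q hf.hasMFDerivAt hu.hasMFDerivAt
  exact hasMFDerivAt_iff_hasFDerivAt.1 h1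

end Curves

section Solution

variable {S : Set ℝ} {H : ℝ → M → ℝ} {u : ℝ → ℝ → M} {η : ℝ → ℝ}
  (sol : D.IsSolution J S H u η)
include sol

theorem IsSolution.contMDiffOn_interior : ContMDiffOn 𝓘(ℝ, ℝ × ℝ) (𝓡 (2 * n)) ∞
    (fun q : ℝ × ℝ => u q.1 q.2) (interior S ×ˢ univ) :=
  sol.u_smooth.mono (prod_mono interior_subset le_rfl)

omit sol in
theorem isOpen_interior_prod : IsOpen (interior S ×ˢ (univ : Set ℝ)) :=
  isOpen_interior.prod isOpen_univ

theorem IsSolution.mdifferentiableAt {q : ℝ × ℝ} (hq : q.1 ∈ interior S) :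
    MDifferentiableAt 𝓘(ℝ, ℝ × ℝ) (𝓡 (2 * n)) (fun q : ℝ × ℝ => u q.1 q.2) q :=
  ((sol.contMDiffOn_interior D).contMDiffAt
    (isOpen_interior_prod.mem_nhds ⟨hq, mem_univ _⟩)).mdifferentiableAt (by simp)

/-- The Floer equation multiplied by `J`. In this form the energy density becomes `ω(∂_t u - ηX_H,
∂_s u)`. -/
theorem IsSolution.J_dmap (hJ : D.IsCompatibleLoop J) {q : ℝ × ℝ} (hq : q.1 ∈ interior S) :
    J q.2 (u q.1 q.2) (D.dmap u q (1, 0)) = D.defect (H q.1) (u q.1) (η q.1) q.2 := by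
  have h1 := sol.u_eq q.1 (interior_subset hq) q.2
  rw [D.velocityWithin_fst (sol.mdifferentiableAt D hq) hq] at h1
  have h2 := congrArg (J q.2 (u q.1 q.2)) h1
  rw [map_add, hJ.sq_eq_neg, map_zero] at h2
  exact add_neg_eq_zero.1 h2

theorem IsSolution.defectSq_eq_omega (hJ : D.IsCompatibleLoop J) {q : ℝ × ℝ} (hq : q.1 ∈ interior S) :
    D.defectSq J (H q.1) (u q.1) (η q.1) q.2 =
      D.omega (u q.1 q.2) (J q.2 (u q.1 q.2) (D.dmap u q (1, 0))) (D.dmap u q (1, 0)) := by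
  rw [defectSq, ← sol.J_dmap D hJ hq, hJ.omega_J]

/-- The density is `ω(∂_t u, ∂_s u) - η ω(X_H, ∂_s u)`; the first term is read off from `u^* dλ =
d(u^* λ)` and the second is `η dH(∂_s u)`. The identity shows that the density is continuous, and
later it supplies the second derivatives in the Laplacian of `ρ(u)`. -/
theorem IsSolution.defectSq_eq (hJ : D.IsCompatibleLoop J) {q : ℝ × ℝ} (hq : q.1 ∈ interior S) :
    D.defectSq J (H q.1) (u q.1) (η q.1) q.2 =
      fderiv ℝ (fun x => OneForm.pull D.lam (fun q : ℝ × ℝ => u q.1 q.2) x (1, 0)) q (0, 1) -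
      fderiv ℝ (fun x => OneForm.pull D.lam (fun q : ℝ × ℝ => u q.1 q.2) x (0, 1)) q (1, 0) +
      η q.1 * D.diff (H q.1) (u q.1 q.2) (D.dmap u q (1, 0)) := by
  have h1 := D.lam_smooth.extDer_pull isOpen_interior_prod (sol.contMDiffOn_interior D)
    (z := q) ⟨hq, mem_univ _⟩ (0, 1) (1, 0)
  rw [h1, sol.defectSq_eq_omega D hJ hq, sol.J_dmap D hJ hq, defect,
    D.velocity_snd (sol.mdifferentiableAt D hq), map_sub, map_smul]
  change D.omega (u q.1 q.2) (D.dmap u q (0, 1)) (D.dmap u q (1, 0)) -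
    η q.1 * D.omega (u q.1 q.2) (D.hamVF (H q.1) (u q.1 q.2)) (D.dmap u q (1, 0)) =
    D.omega (u q.1 q.2) (D.dmap u q (0, 1)) (D.dmap u q (1, 0)) + _
  rw [D.omega_hamVF]
  ring

/-- The energy density `|∂_s u|²` is continuous. -/
theorem IsSolution.continuousOn_defectSq {r₀ : ℝ} {h : ℝ → ℝ → ℝ} (hJ : D.IsCompatibleLoop J)
    (hH : D.IsHamiltonianFamily S H r₀ h) :
    ContinuousOn (fun q : ℝ × ℝ => D.defectSq J (H q.1) (u q.1) (η q.1) q.2)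
      (interior S ×ˢ univ) := by
  have hpull : ∀ v w : ℝ × ℝ, ContinuousOn (fun q => fderiv ℝ (fun x =>
      OneForm.pull D.lam (fun q : ℝ × ℝ => u q.1 q.2) x v) q w) (interior S ×ˢ univ) := by
    intro v w
    have h1 := (D.lam_smooth.pull_contDiffOn isOpen_interior_prod (sol.contMDiffOn_interior D)
      v).continuousOn_fderiv_of_isOpen isOpen_interior_prod (by simp)
    exact h1.clm_apply continuousOn_const
  -- the function `(s, (σ, t)) ↦ H_s (u (σ, t))`
  set k : ℝ × ℝ × ℝ → ℝ := fun x => H x.1 (u x.2.1 x.2.2) with hk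
  have hΩ : IsOpen (interior S ×ˢ (interior S ×ˢ (univ : Set ℝ))) :=
    isOpen_interior.prod isOpen_interior_prod
  have hks : ContDiffOn ℝ ∞ k (interior S ×ˢ (interior S ×ˢ univ)) := by
    rw [← contMDiffOn_iff_contDiffOn]
    refine hH.smooth.comp (f := fun x : ℝ × ℝ × ℝ => (x.1, u x.2.1 x.2.2))
      (ContMDiffOn.prodMk contDiff_fst.contMDiff.contMDiffOn
        ((sol.contMDiffOn_interior D).comp contDiff_snd.contMDiff.contMDiffOn
          (fun z hz => hz.2))) (fun z hz => ⟨interior_subset hz.1, mem_univ _⟩)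
  have hk1 := hks.continuousOn_fderiv_of_isOpen hΩ (by simp)
  -- Separating the parameter of `H` from the argument of `u` isolates `dH_s(∂_s u)`, the derivative
  -- with the Hamiltonian frozen.
  have hk2 : ContinuousOn (fun q : ℝ × ℝ => fderiv ℝ k (q.1, q.1, q.2) (0, 1, 0))
      (interior S ×ˢ univ) := by
    refine ContinuousOn.clm_apply (hk1.comp (f := fun q : ℝ × ℝ => (q.1, q.1, q.2))
      (by fun_prop) fun q hq => ⟨hq.1, hq.1, mem_univ _⟩) continuousOn_const
  have hη : ContinuousOn (fun q : ℝ × ℝ => η q.1) (interior S ×ˢ univ) :=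
    sol.η_smooth.continuousOn.comp continuousOn_fst fun q hq => interior_subset hq.1
  refine (((hpull (1, 0) (0, 1)).sub (hpull (0, 1) (1, 0))).add (hη.mul hk2)).congr ?_
  rintro ⟨s, t⟩ ⟨hs, -⟩
  refine (sol.defectSq_eq D hJ (q := (s, t)) hs).trans ?_
  have hkd := ((hks.contDiffAt (hΩ.mem_nhds (⟨hs, hs, mem_univ _⟩ : ((s, s, t) : ℝ × ℝ × ℝ) ∈ interior S ×ˢ (interior S ×ˢ (univ : Set ℝ))))).differentiableAt
    (by simp)).hasFDerivAt
  have h1 : HasDerivAt (fun σ : ℝ => (s, σ, t)) (0, 1, 0) s :=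
    (hasDerivAt_const _ _).prodMk ((hasDerivAt_id _).prodMk (hasDerivAt_const _ _))
  have h2 := HasFDerivAt.comp_hasDerivAt s hkd h1
  have hHs := hH.contMDiff D (interior_subset hs)
  have h3 := D.hasFDerivAt_comp_map (sol.mdifferentiableAt D (q := (s, t)) hs) (f := H s)
    ((hHs _).mdifferentiableAt (by simp))
  have h4 : HasDerivAt (fun σ : ℝ => (σ, t)) (1, 0) s :=
    (hasDerivAt_id _).prodMk (hasDerivAt_const _ _)
  have h5 := HasFDerivAt.comp_hasDerivAt s h3 h4
  have h6 := h5.unique h2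
  simp only [Pi.add_apply, Pi.sub_apply, Pi.mul_apply]
  rw [← h6]
  rfl

end Solution

end LiouvilleCompletion
end RabinowitzFloer

/-! ### The radial profile and the first derivatives of the radius along a solution -/

namespace RabinowitzFloer

section Profile

variable {S : Set ℝ} {r₀ : ℝ} {h : ℝ → ℝ → ℝ}
  (hh : ContDiffOn ℝ ∞ (fun q : ℝ × ℝ => h q.1 q.2) (S ×ˢ Ici r₀))
include hh

theorem profile_contDiffOn : ContDiffOn ℝ ∞ (fun q : ℝ × ℝ => h q.1 q.2) (interior S ×ˢ Ioi r₀) :=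
  hh.mono (prod_mono interior_subset Ioi_subset_Ici_self)

theorem profile_fderiv_snd {q : ℝ × ℝ} (hq : q ∈ interior S ×ˢ Ioi r₀) :
    dRho r₀ h q.1 q.2 = fderiv ℝ (fun q : ℝ × ℝ => h q.1 q.2) q (0, 1) := by
  have h1 := (((profile_contDiffOn hh).contDiffAt
    ((isOpen_interior.prod isOpen_Ioi).mem_nhds hq)).differentiableAt (by simp)).hasFDerivAt
  have h2 : HasDerivAt (fun r : ℝ => (q.1, r)) (0, 1) q.2 :=
    (hasDerivAt_const _ _).prodMk (hasDerivAt_id _)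
  have h3 := HasFDerivAt.comp_hasDerivAt (f := fun r : ℝ => (q.1, r)) q.2 h1 h2
  rw [dRho, derivWithin_of_mem_nhds (Ici_mem_nhds hq.2)]
  exact h3.deriv

theorem hasDerivAt_profile {s r : ℝ} (hs : s ∈ interior S) (hr : r₀ < r) :
    HasDerivAt (h s) (dRho r₀ h s r) r := by
  have h1 := (((profile_contDiffOn hh).contDiffAt ((isOpen_interior.prod isOpen_Ioi).mem_nhds
    (⟨hs, hr⟩ : ((s, r) : ℝ × ℝ) ∈ interior S ×ˢ Ioi r₀))).differentiableAt (by simp)).hasFDerivAt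
  have h2 : HasDerivAt (fun r : ℝ => (s, r)) (0, 1) r :=
    (hasDerivAt_const _ _).prodMk (hasDerivAt_id _)
  rw [profile_fderiv_snd hh (q := (s, r)) ⟨hs, hr⟩]
  exact HasFDerivAt.comp_hasDerivAt r h1 h2

theorem dRho_contDiffOn : ContDiffOn ℝ ∞ (fun q : ℝ × ℝ => dRho r₀ h q.1 q.2) (interior S ×ˢ Ioi r₀) := by
  have h1 := (profile_contDiffOn hh).fderiv_of_isOpen (m := ∞) (isOpen_interior.prod isOpen_Ioi) (by simp)
  exact (h1.clm_apply contDiffOn_const).congr fun q hq => profile_fderiv_snd hh hq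

/-- Derivative of `∂h/∂ρ` along a curve. -/
theorem hasDerivAt_dRho_comp {r : ℝ → ℝ} {r' s : ℝ} (hs : s ∈ interior S) (hr : r₀ < r s)
    (hr' : HasDerivAt r r' s) :
    HasDerivAt (fun σ => dRho r₀ h σ (r σ)) (dSRho S r₀ h s (r s) + dRhoRho r₀ h s (r s) * r') s := by
  have h1 := (((dRho_contDiffOn hh).contDiffAt ((isOpen_interior.prod isOpen_Ioi).mem_nhds
    (⟨hs, hr⟩ : ((s, r s) : ℝ × ℝ) ∈ interior S ×ˢ Ioi r₀))).differentiableAt (by simp)).hasFDerivAt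
  have h2 : HasDerivAt (fun σ : ℝ => (σ, r s)) (1, 0) s :=
    (hasDerivAt_id _).prodMk (hasDerivAt_const _ _)
  have h3 : HasDerivAt (fun x : ℝ => (s, x)) (0, 1) (r s) :=
    (hasDerivAt_const _ _).prodMk (hasDerivAt_id _)
  set A := fderiv ℝ (fun q : ℝ × ℝ => dRho r₀ h q.1 q.2) (s, r s)
  have h4 : HasDerivAt (fun σ => dRho r₀ h σ (r s)) (A (1, 0)) s :=
    HasFDerivAt.comp_hasDerivAt (f := fun σ : ℝ => (σ, r s)) s h1 h2
  have h5 : HasDerivAt (dRho r₀ h s) (A (0, 1)) (r s) :=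
    HasFDerivAt.comp_hasDerivAt (f := fun x : ℝ => (s, x)) (r s) h1 h3
  have h6 : HasDerivAt (fun σ => dRho r₀ h σ (r σ)) (A (1, r')) s :=
    HasFDerivAt.comp_hasDerivAt (f := fun σ => (σ, r σ)) s h1 ((hasDerivAt_id s).prodMk hr')
  refine h6.congr_deriv ?_
  rw [dSRho, derivWithin_of_mem_nhds (mem_interior_iff_mem_nhds.1 hs), h4.deriv, dRhoRho,
    derivWithin_of_mem_nhds (Ici_mem_nhds hr), h5.deriv]
  have h7 : ((1, r') : ℝ × ℝ) = (1, 0) + r' • (0, 1) := by simp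
  rw [h7, map_add, map_smul, smul_eq_mul]
  ring

end Profile

namespace LiouvilleCompletion

variable {n : ℕ}
  {M : Type*} [TopologicalSpace M] [ChartedSpace (EuclideanSpace ℝ (Fin (2 * n))) M]
  [IsManifold (𝓡 (2 * n)) ∞ M]
  {N : Type*} [TopologicalSpace N] [ChartedSpace (EuclideanSpace ℝ (Fin (2 * n - 1))) N]
  [IsManifold (𝓡 (2 * n - 1)) ∞ N]
  (D : LiouvilleCompletion n M N)
  {J : ℝ → ∀ p : M, TangentSpace (𝓡 (2 * n)) p →L[ℝ] TangentSpace (𝓡 (2 * n)) p}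
  {S : Set ℝ} {H : ℝ → M → ℝ} {u : ℝ → ℝ → M} {η : ℝ → ℝ} {r₀ : ℝ} {h : ℝ → ℝ → ℝ}

/-- The points of `M` with `ρ > r₀`. -/
def openEnd (r₀ : ℝ) : Set M := {w | w ∈ D.cyl.target ∧ r₀ < D.radius w}

theorem isOpen_openEnd (r₀ : ℝ) : IsOpen (D.openEnd r₀) :=
  D.contMDiffOn_radius.continuousOn.isOpen_inter_preimage D.cyl.open_target isOpen_Ioi

theorem openEnd_subset (hr₀ : 0 < r₀) : D.openEnd r₀ ⊆ D.cylEnd r₀ := fun _ hw =>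
  (D.mem_cylEnd hr₀).2 ⟨hw.1, hw.2.le⟩

theorem IsHamiltonianFamily.eventuallyEq (hr₀ : 0 < r₀) (hH : D.IsHamiltonianFamily S H r₀ h) {s : ℝ} (hs : s ∈ S)
    {w : M} (hw : w ∈ D.openEnd r₀) : H s =ᶠ[𝓝 w] h s ∘ D.radius := by
  filter_upwards [(D.isOpen_openEnd r₀).mem_nhds hw] with q hq
  exact D.radial_of_mem hr₀ hH hs (D.openEnd_subset hr₀ hq)

section End

variable (hr₀ : 0 < r₀) (hJ : D.IsCompatibleLoop J) (hJr₀ : D.IsContactType J r₀)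
  (hH : D.IsHamiltonianFamily S H r₀ h) (sol : D.IsSolution J S H u η) {q : ℝ × ℝ}
  (hq : q.1 ∈ interior S) (hw : u q.1 q.2 ∈ D.openEnd r₀)
include hr₀ hJ hJr₀ hH sol hq hw

/-- `∂_s ρ(u) = -λ(∂_t u) + η ρ h'`. -/
theorem IsSolution.diff_radius_fst : D.diff D.radius (u q.1 q.2) (D.dmap u q (1, 0)) =
    -OneForm.pull D.lam (fun q : ℝ × ℝ => u q.1 q.2) q (0, 1) +
      η q.1 * (D.radius (u q.1 q.2) * dRho r₀ h q.1 (D.radius (u q.1 q.2))) := by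
  have h1 := hJr₀ q.2 _ (D.openEnd_subset hr₀ hw) (J q.2 (u q.1 q.2) (D.dmap u q (1, 0)))
  rw [hJ.sq_eq_neg, sol.J_dmap D hJ hq, defect, D.velocity_snd (sol.mdifferentiableAt D hq), map_sub,
    map_smul, D.lam_hamVF hw.1 (hasDerivAt_profile hH.profile_smooth hq hw.2)
      (hH.eventuallyEq D hr₀ (interior_subset hq) hw)] at h1
  have h2 : D.diff D.radius (u q.1 q.2) (-(D.dmap u q (1, 0))) = _ := h1
  rw [map_neg] at h2
  have h3 : OneForm.pull D.lam (fun q : ℝ × ℝ => u q.1 q.2) q (0, 1) =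
    D.lam (u q.1 q.2) (D.dmap u q (0, 1)) := rfl
  rw [h3]
  rw [smul_eq_mul] at h2
  linarith

/-- `∂_t ρ(u) = λ(∂_s u)`. -/
theorem IsSolution.diff_radius_snd : D.diff D.radius (u q.1 q.2) (D.dmap u q (0, 1)) =
    OneForm.pull D.lam (fun q : ℝ × ℝ => u q.1 q.2) q (1, 0) := by
  have h1 := hJr₀ q.2 _ (D.openEnd_subset hr₀ hw) (D.dmap u q (1, 0))
  rw [sol.J_dmap D hJ hq, defect, D.velocity_snd (sol.mdifferentiableAt D hq)] at h1
  have h2 : D.diff D.radius (u q.1 q.2) (D.dmap u q (0, 1) - η q.1 • D.hamVF (H q.1) (u q.1 q.2)) =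
    D.lam (u q.1 q.2) (D.dmap u q (1, 0)) := h1
  rw [map_sub, map_smul, D.diff_radius_hamVF hw.1 (hasDerivAt_profile hH.profile_smooth hq hw.2)
      (hH.eventuallyEq D hr₀ (interior_subset hq) hw), smul_zero, sub_zero] at h2
  exact h2

/-- `|∇ρ(u)|² ≤ ρ |∂_s u|²`. -/
theorem IsSolution.gradient_radius_le :
    D.diff D.radius (u q.1 q.2) (D.dmap u q (1, 0)) ^ 2 +
      D.diff D.radius (u q.1 q.2) (D.dmap u q (0, 1)) ^ 2 ≤
    D.radius (u q.1 q.2) * D.defectSq J (H q.1) (u q.1) (η q.1) q.2 := by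
  rw [sol.diff_radius_snd D hr₀ hJ hJr₀ hH hq hw, sol.defectSq_eq_omega D hJ hq]
  exact hJ.contact_inequality D hr₀ hJr₀ q.2 (D.openEnd_subset hr₀ hw) (D.dmap u q (1, 0))

end End

end LiouvilleCompletion
end RabinowitzFloer

/-! ### The Laplacian of the height -/

namespace RabinowitzFloer

theorem hasDerivAt_fst_line {g : ℝ × ℝ → ℝ} {q : ℝ × ℝ} (hg : DifferentiableAt ℝ g q) :
    HasDerivAt (fun s => g (s, q.2)) (fderiv ℝ g q (1, 0)) q.1 :=
  HasFDerivAt.comp_hasDerivAt (f := fun s : ℝ => (s, q.2)) (l := g) q.1 hg.hasFDerivAt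
    ((hasDerivAt_id _).prodMk (hasDerivAt_const _ _))

theorem hasDerivAt_snd_line {g : ℝ × ℝ → ℝ} {q : ℝ × ℝ} (hg : DifferentiableAt ℝ g q) :
    HasDerivAt (fun t => g (q.1, t)) (fderiv ℝ g q (0, 1)) q.2 :=
  HasFDerivAt.comp_hasDerivAt (f := fun t : ℝ => (q.1, t)) (l := g) q.2 hg.hasFDerivAt
    ((hasDerivAt_const _ _).prodMk (hasDerivAt_id _))

theorem tendsto_fst_line (q : ℝ × ℝ) : Tendsto (fun s : ℝ => (s, q.2)) (𝓝 q.1) (𝓝 q) :=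
  (show Continuous fun s : ℝ => (s, q.2) by fun_prop).tendsto q.1

theorem tendsto_snd_line (q : ℝ × ℝ) : Tendsto (fun t : ℝ => (q.1, t)) (𝓝 q.2) (𝓝 q) :=
  (show Continuous fun t : ℝ => (q.1, t) by fun_prop).tendsto q.2

/-- Here `r = ρ(u)`, `k = ∂_ρ h` with partial derivatives `ks`, `kr`, `p = ∂_s(λ(∂_t u))`, `q =
∂_t(λ(∂_s u))`, and `σ`, `σ'` are the derivatives of the ramp. The energy identity gives `Δr = e + r
k η' + η r (ks + kr rs)`. The term in `σ'` is non-negative because the ramp is convex, and `(r e -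
|∇r|²) / r²` is non-negative by contact type. What remains is estimated by `η' ≥ -m`, `k ≥ 0` and
`|η| ≤ C`. -/
theorem laplacian_ramp_log_ge {r σ σ' rs rt p q e η' η k ks kr m C : ℝ} (hr : 0 < r) (hσ0 : 0 ≤ σ)
    (hσ1 : σ ≤ 1) (hσ' : 0 ≤ σ') (hm : 0 ≤ m) (hη' : -m ≤ η') (hη : |η| ≤ C) (hk : 0 ≤ k)
    (hgrad : rs ^ 2 + rt ^ 2 ≤ r * e) (he : e = q - p + η * (k * rs)) :
    -(m * k + C * |ks| + C * (r * |kr|) * |σ * (rs / r)|) ≤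
      σ' * (rs / r) ^ 2 + σ * ((-p + (η' * (r * k) + η * (rs * k + r * (ks + kr * rs)))) / r -
        (rs / r) ^ 2) + (σ' * (rt / r) ^ 2 + σ * (q / r - (rt / r) ^ 2)) := by
  have h1 : σ' * (rs / r) ^ 2 + σ * ((-p + (η' * (r * k) + η * (rs * k + r * (ks + kr * rs)))) / r -
        (rs / r) ^ 2) + (σ' * (rt / r) ^ 2 + σ * (q / r - (rt / r) ^ 2)) =
      σ' * ((rs / r) ^ 2 + (rt / r) ^ 2) + σ * ((r * e - (rs ^ 2 + rt ^ 2)) / r ^ 2) +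
        σ * k * η' + σ * (η * ks) + η * (r * kr) * (σ * (rs / r)) := by
    rw [he]
    field_simp
    ring
  have h2 : 0 ≤ σ' * ((rs / r) ^ 2 + (rt / r) ^ 2) := by positivity
  have h3 : 0 ≤ σ * ((r * e - (rs ^ 2 + rt ^ 2)) / r ^ 2) :=
    mul_nonneg hσ0 (div_nonneg (by linarith) (by positivity))
  have h4 : -(m * k) ≤ σ * k * η' := by
    have a1 : σ * k * (-m) ≤ σ * k * η' := by gcongr
    have a2 : σ * (k * m) ≤ 1 * (k * m) := by gcongr
    linarith
  have h5 : -(C * |ks|) ≤ σ * (η * ks) := by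
    have a1 : |σ * (η * ks)| ≤ C * |ks| := by
      rw [abs_mul, abs_mul, abs_of_nonneg hσ0]
      calc σ * (|η| * |ks|) ≤ 1 * (C * |ks|) := by gcongr
        _ = _ := one_mul _
    linarith [neg_abs_le (σ * (η * ks))]
  have h6 : -(C * (r * |kr|) * |σ * (rs / r)|) ≤ η * (r * kr) * (σ * (rs / r)) := by
    have a1 : |η * (r * kr) * (σ * (rs / r))| ≤ C * (r * |kr|) * |σ * (rs / r)| := by
      rw [abs_mul, abs_mul, abs_mul r, abs_of_pos hr]
      gcongr
    linarith [neg_abs_le (η * (r * kr) * (σ * (rs / r)))]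
  rw [h1]
  linarith

namespace LiouvilleCompletion

variable {n : ℕ}
  {M : Type*} [TopologicalSpace M] [ChartedSpace (EuclideanSpace ℝ (Fin (2 * n))) M]
  [IsManifold (𝓡 (2 * n)) ∞ M]
  {N : Type*} [TopologicalSpace N] [ChartedSpace (EuclideanSpace ℝ (Fin (2 * n - 1))) N]
  [IsManifold (𝓡 (2 * n - 1)) ∞ N]
  (D : LiouvilleCompletion n M N)
  {J : ℝ → ∀ p : M, TangentSpace (𝓡 (2 * n)) p →L[ℝ] TangentSpace (𝓡 (2 * n)) p}
  {S : Set ℝ} {H : ℝ → M → ℝ} {u : ℝ → ℝ → M} {η : ℝ → ℝ} {r₀ : ℝ} {h : ℝ → ℝ → ℝ}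

/-- The exhausting function along a map `(s, t) ↦ u s t`. -/
noncomputable def height (a : ℝ) (u : ℝ → ℝ → M) (q : ℝ × ℝ) : ℝ := D.exhaustion a (u q.1 q.2)

theorem IsSolution.contDiffOn_height [T2Space M] (sol : D.IsSolution J S H u η) {a : ℝ} (ha : 0 ≤ a) :
    ContDiffOn ℝ ∞ (D.height a u) (S ×ˢ univ) := by
  rw [← contMDiffOn_iff_contDiffOn]
  exact (D.contMDiff_exhaustion ha).comp_contMDiffOn sol.u_smooth

theorem IsSolution.contDiffOn_height_interior [T2Space M] (sol : D.IsSolution J S H u η) {a : ℝ} (ha : 0 ≤ a) :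
    ContDiffOn ℝ ∞ (D.height a u) (interior S ×ˢ univ) :=
  (sol.contDiffOn_height D ha).mono (prod_mono interior_subset le_rfl)

theorem IsSolution.height_eventuallyEq_zero [T2Space M] (sol : D.IsSolution J S H u η) {a : ℝ} (ha : 0 ≤ a)
    (hra : Real.log r₀ < a) {q : ℝ × ℝ} (hq : q.1 ∈ interior S) (hw : u q.1 q.2 ∉ D.openEnd r₀) :
    D.height a u =ᶠ[𝓝 q] fun _ => 0 :=
  (sol.mdifferentiableAt D hq).continuousAt.eventually (D.exhaustion_eq_zero ha hra hw)

section End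

variable (hr₀ : 0 < r₀) (hJ : D.IsCompatibleLoop J) (hJr₀ : D.IsContactType J r₀)
  (hH : D.IsHamiltonianFamily S H r₀ h) (sol : D.IsSolution J S H u η)

/-- `∂_s ρ(u)` on the cylindrical end. -/
noncomputable def radiusFst (r₀ : ℝ) (h : ℝ → ℝ → ℝ) (u : ℝ → ℝ → M) (η : ℝ → ℝ) (q : ℝ × ℝ) : ℝ :=
  -OneForm.pull D.lam (fun q : ℝ × ℝ => u q.1 q.2) q (0, 1) +
      η q.1 * (D.radius (u q.1 q.2) * dRho r₀ h q.1 (D.radius (u q.1 q.2)))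

/-- `∂_t ρ(u)` on the cylindrical end. -/
noncomputable def radiusSnd (u : ℝ → ℝ → M) (q : ℝ × ℝ) : ℝ :=
  OneForm.pull D.lam (fun q : ℝ × ℝ => u q.1 q.2) q (1, 0)

include sol in
theorem IsSolution.isOpen_preimage_openEnd :
    IsOpen {q : ℝ × ℝ | q.1 ∈ interior S ∧ u q.1 q.2 ∈ D.openEnd r₀} := by
  have h1 := (sol.contMDiffOn_interior D).continuousOn.isOpen_inter_preimage isOpen_interior_prod
    (D.isOpen_openEnd r₀)
  refine (congrArg IsOpen ?_).mp h1
  ext q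
  simp

include hr₀ hJ hJr₀ hH sol

theorem IsSolution.hasFDerivAt_radius {q : ℝ × ℝ} (hq : q.1 ∈ interior S) (hw : u q.1 q.2 ∈ D.openEnd r₀) :
    ∃ A : ℝ × ℝ →L[ℝ] ℝ, HasFDerivAt (fun q : ℝ × ℝ => D.radius (u q.1 q.2)) A q ∧
      A (1, 0) = D.radiusFst r₀ h u η q ∧ A (0, 1) = D.radiusSnd u q :=
  ⟨_, D.hasFDerivAt_comp_map (sol.mdifferentiableAt D hq) (D.mdifferentiableAt_radius hw.1),
    sol.diff_radius_fst D hr₀ hJ hJr₀ hH hq hw, sol.diff_radius_snd D hr₀ hJ hJr₀ hH hq hw⟩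

theorem IsSolution.hasDerivAt_radius_fst {q : ℝ × ℝ} (hq : q.1 ∈ interior S) (hw : u q.1 q.2 ∈ D.openEnd r₀) :
    HasDerivAt (fun s => D.radius (u s q.2)) (D.radiusFst r₀ h u η q) q.1 := by
  obtain ⟨A, hA, h1, -⟩ := sol.hasFDerivAt_radius D hr₀ hJ hJr₀ hH hq hw
  have := hasDerivAt_fst_line hA.differentiableAt
  rwa [hA.fderiv, h1] at this

theorem IsSolution.hasDerivAt_radius_snd {q : ℝ × ℝ} (hq : q.1 ∈ interior S) (hw : u q.1 q.2 ∈ D.openEnd r₀) :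
    HasDerivAt (fun t => D.radius (u q.1 t)) (D.radiusSnd u q) q.2 := by
  obtain ⟨A, hA, -, h1⟩ := sol.hasFDerivAt_radius D hr₀ hJ hJr₀ hH hq hw
  have := hasDerivAt_snd_line hA.differentiableAt
  rwa [hA.fderiv, h1] at this

theorem IsSolution.fderiv_height [T2Space M] {a : ℝ} (ha : 0 ≤ a) {q : ℝ × ℝ} (hq : q.1 ∈ interior S)
    (hw : u q.1 q.2 ∈ D.openEnd r₀) :
    fderiv ℝ (D.height a u) q (1, 0) = Real.smoothTransition (Real.log (D.radius (u q.1 q.2)) - a) *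
        (D.radiusFst r₀ h u η q / D.radius (u q.1 q.2)) ∧
    fderiv ℝ (D.height a u) q (0, 1) = Real.smoothTransition (Real.log (D.radius (u q.1 q.2)) - a) *
        (D.radiusSnd u q / D.radius (u q.1 q.2)) := by
  have hd : DifferentiableAt ℝ (D.height a u) q :=
    ((sol.contDiffOn_height_interior D ha).contDiffAt
      (isOpen_interior_prod.mem_nhds ⟨hq, mem_univ _⟩)).differentiableAt (by simp)
  have he : D.height a u =ᶠ[𝓝 q] fun q => ramp (Real.log (D.radius (u q.1 q.2)) - a) :=
    (sol.mdifferentiableAt D hq).continuousAt.eventually (D.exhaustion_eventuallyEq (a := a) hw.1)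
  have hp := D.radius_pos hw.1
  constructor
  · refine (hasDerivAt_fst_line hd).unique ?_
    exact (hasDerivAt_ramp_log (sol.hasDerivAt_radius_fst D hr₀ hJ hJr₀ hH hq hw)
      hp).congr_of_eventuallyEq ((tendsto_fst_line q).eventually he)
  · refine (hasDerivAt_snd_line hd).unique ?_
    exact (hasDerivAt_ramp_log (sol.hasDerivAt_radius_snd D hr₀ hJ hJr₀ hH hq hw)
      hp).congr_of_eventuallyEq ((tendsto_snd_line q).eventually he)

/-- The energy density controls the gradient of the height with an exponential weight. -/
theorem IsSolution.exp_height_mul_le [T2Space M] {a : ℝ} (ha : 0 ≤ a) (hra : Real.log r₀ < a) {q : ℝ × ℝ}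
    (hq : q.1 ∈ interior S) :
    Real.exp (D.height a u q) * (fderiv ℝ (D.height a u) q (1, 0) ^ 2 +
      fderiv ℝ (D.height a u) q (0, 1) ^ 2) ≤ D.defectSq J (H q.1) (u q.1) (η q.1) q.2 := by
  have hE : 0 ≤ D.defectSq J (H q.1) (u q.1) (η q.1) q.2 := by
    rw [sol.defectSq_eq_omega D hJ hq]
    exact hJ.nonneg D _ _ _
  by_cases hw : u q.1 q.2 ∈ D.openEnd r₀
  · obtain ⟨h1, h2⟩ := sol.fderiv_height D hr₀ hJ hJr₀ hH ha hq hw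
    have hp := D.radius_pos hw.1
    have h3 := sol.gradient_radius_le D hr₀ hJ hJr₀ hH hq hw
    rw [sol.diff_radius_fst D hr₀ hJ hJr₀ hH hq hw, sol.diff_radius_snd D hr₀ hJ hJr₀ hH hq hw] at h3
    change D.radiusFst r₀ h u η q ^ 2 + D.radiusSnd u q ^ 2 ≤ _ at h3
    rw [h1, h2]
    have h4 : D.height a u q = ramp (Real.log (D.radius (u q.1 q.2)) - a) := D.exhaustion_of_mem hw.1
    rw [h4]
    set r := D.radius (u q.1 q.2) with hr
    set e := D.defectSq J (H q.1) (u q.1) (η q.1) q.2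
    rcases le_total (Real.log r - a) 0 with hx | hx
    · rw [Real.smoothTransition.zero_of_nonpos hx]
      simpa using hE
    -- As `ramp x ≤ x` for `x ≥ 0` and `a ≥ 0`, the weight is at most `ρ`. This is the factor left
    -- over when `|∇ρ|² ≤ ρ |∂_s u|²` is divided by `ρ²`.
    · have h5 : Real.exp (ramp (Real.log r - a)) ≤ r := by
        rw [← Real.le_log_iff_exp_le hp]
        linarith [ramp_le hx]
      set σ := Real.smoothTransition (Real.log r - a) with hσ
      have hσ0 : 0 ≤ σ := Real.smoothTransition.nonneg _
      have hσ1 : σ ≤ 1 := Real.smoothTransition.le_one _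
      have h6 : σ ^ 2 ≤ 1 := pow_le_one₀ hσ0 hσ1
      have h7 : (σ * (D.radiusFst r₀ h u η q / r)) ^ 2 + (σ * (D.radiusSnd u q / r)) ^ 2 ≤ e / r := by
        have : (σ * (D.radiusFst r₀ h u η q / r)) ^ 2 + (σ * (D.radiusSnd u q / r)) ^ 2 =
          σ ^ 2 * ((D.radiusFst r₀ h u η q ^ 2 + D.radiusSnd u q ^ 2) / r ^ 2) := by ring
        rw [this]
        calc _ ≤ 1 * (r * e / r ^ 2) := by gcongr
          _ = e / r := by field_simp
      calc _ ≤ r * (e / r) := by gcongr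
        _ = e := by field_simp
  · have h0 := sol.height_eventuallyEq_zero D ha hra hq hw
    rw [h0.fderiv_eq]
    simpa using hE

/-- The Laplacian of the height on the cylindrical end. -/
theorem IsSolution.laplacian_height [T2Space M] {a : ℝ} (ha : 0 ≤ a) {q : ℝ × ℝ} (hq : q.1 ∈ interior S)
    (hw : u q.1 q.2 ∈ D.openEnd r₀) {m C : ℝ} (hm : 0 ≤ m)
    (hηm : -m ≤ ∫ t in (0 : ℝ)..1, H q.1 (u q.1 t)) (hηC : |η q.1| ≤ C)
    (hh : 0 ≤ dRho r₀ h q.1 (D.radius (u q.1 q.2))) :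
    -(m * dRho r₀ h q.1 (D.radius (u q.1 q.2)) + C * |dSRho S r₀ h q.1 (D.radius (u q.1 q.2))| +
      C * (D.radius (u q.1 q.2) * |dRhoRho r₀ h q.1 (D.radius (u q.1 q.2))|) *
        |fderiv ℝ (D.height a u) q (1, 0)|) ≤
    fderiv ℝ (fun x => fderiv ℝ (D.height a u) x (1, 0)) q (1, 0) +
      fderiv ℝ (fun x => fderiv ℝ (D.height a u) x (0, 1)) q (0, 1) := by
  obtain ⟨s, t⟩ := q
  have hΩ := isOpen_interior_prod (S := S)
  have hqΩ : (s, t) ∈ interior S ×ˢ (univ : Set ℝ) := ⟨hq, mem_univ _⟩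
  have hev : ∀ᶠ x in 𝓝 (s, t), x.1 ∈ interior S ∧ u x.1 x.2 ∈ D.openEnd r₀ :=
    (sol.isOpen_preimage_openEnd D).mem_nhds ⟨hq, hw⟩
  have hF1 := (sol.contDiffOn_height_interior D ha).fderiv_of_isOpen (m := ∞) hΩ (by simp)
  have hFd : ∀ v : ℝ × ℝ, DifferentiableAt ℝ (fun x => fderiv ℝ (D.height a u) x v) (s, t) :=
    fun v => ((hF1.clm_apply contDiffOn_const).contDiffAt (hΩ.mem_nhds hqΩ)).differentiableAt (by simp)
  have hpd : ∀ v : ℝ × ℝ, DifferentiableAt ℝ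
      (fun x => OneForm.pull D.lam (fun q : ℝ × ℝ => u q.1 q.2) x v) (s, t) := fun v =>
    ((D.lam_smooth.pull_contDiffOn hΩ (sol.contMDiffOn_interior D) v).contDiffAt
      (hΩ.mem_nhds hqΩ)).differentiableAt (by simp)
  have hp := D.radius_pos hw.1
  -- second derivative in `s`
  have hrs := sol.hasDerivAt_radius_fst D hr₀ hJ hJr₀ hH (q := (s, t)) hq hw
  have hη : HasDerivAt η (∫ t in (0 : ℝ)..1, H s (u s t)) s :=
    (sol.η_eq s (interior_subset hq)).hasDerivAt (mem_interior_iff_mem_nhds.1 hq)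
  have hdR := hasDerivAt_dRho_comp hH.profile_smooth hq (r := fun σ => D.radius (u σ t)) hw.2 hrs
  -- Differentiation of `∂_s ρ = -λ(∂_t u) + η ρ ∂_ρ h`; the equation for the multiplier enters
  -- here, through `η'`.
  have hrss : HasDerivAt (fun σ => D.radiusFst r₀ h u η (σ, t)) _ s :=
    (hasDerivAt_fst_line (hpd (0, 1))).neg.add (hη.mul (hrs.mul hdR))
  have hrs' : HasDerivAt (fun σ => D.radius (u σ t)) ((fun σ => D.radiusFst r₀ h u η (σ, t)) s) s := hrs
  have hFss := hasDerivAt_ramp_log_deriv (a := a) hrs' hrss hp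
  have e1 : (fun σ => fderiv ℝ (D.height a u) (σ, t) (1, 0)) =ᶠ[𝓝 s] fun σ =>
      Real.smoothTransition (Real.log (D.radius (u σ t)) - a) *
        (D.radiusFst r₀ h u η (σ, t) / D.radius (u σ t)) := by
    filter_upwards [(tendsto_fst_line (s, t)).eventually hev] with σ hσ
    exact (sol.fderiv_height D hr₀ hJ hJr₀ hH ha hσ.1 hσ.2).1
  have h1 := (hasDerivAt_fst_line (hFd (1, 0))).unique (hFss.congr_of_eventuallyEq e1)
  -- second derivative in `t`
  have hrt' : HasDerivAt (fun τ => D.radius (u s τ)) ((fun τ => D.radiusSnd u (s, τ)) t) t :=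
    sol.hasDerivAt_radius_snd D hr₀ hJ hJr₀ hH (q := (s, t)) hq hw
  have hrtt : HasDerivAt (fun τ => D.radiusSnd u (s, τ)) _ t := hasDerivAt_snd_line (hpd (1, 0))
  have hFtt := hasDerivAt_ramp_log_deriv (a := a) hrt' hrtt hp
  have e2 : (fun τ => fderiv ℝ (D.height a u) (s, τ) (0, 1)) =ᶠ[𝓝 t] fun τ =>
      Real.smoothTransition (Real.log (D.radius (u s τ)) - a) *
        (D.radiusSnd u (s, τ) / D.radius (u s τ)) := by
    filter_upwards [(tendsto_snd_line (s, t)).eventually hev] with σ hσ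
    exact (sol.fderiv_height D hr₀ hJ hJr₀ hH ha hσ.1 hσ.2).2
  have h2 := (hasDerivAt_snd_line (hFd (0, 1))).unique (hFtt.congr_of_eventuallyEq e2)
  -- the energy identity
  have h3 := sol.defectSq_eq D hJ (q := (s, t)) hq
  rw [D.diff_radial hw.1 (hasDerivAt_profile hH.profile_smooth hq hw.2)
    (hH.eventuallyEq D hr₀ (interior_subset hq) hw)] at h3
  have h4 := sol.gradient_radius_le D hr₀ hJ hJr₀ hH (q := (s, t)) hq hw
  rw [sol.diff_radius_fst D hr₀ hJ hJr₀ hH hq hw, sol.diff_radius_snd D hr₀ hJ hJr₀ hH hq hw] at h4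
  change D.radiusFst r₀ h u η (s, t) ^ 2 + D.radiusSnd u (s, t) ^ 2 ≤ _ at h4
  have h3' : D.defectSq J (H s) (u s) (η s) t =
      fderiv ℝ (fun x => OneForm.pull D.lam (fun q : ℝ × ℝ => u q.1 q.2) x (1, 0)) (s, t) (0, 1) -
      fderiv ℝ (fun x => OneForm.pull D.lam (fun q : ℝ × ℝ => u q.1 q.2) x (0, 1)) (s, t) (1, 0) +
      η s * (dRho r₀ h s (D.radius (u s t)) * D.radiusFst r₀ h u η (s, t)) := by
    refine h3.trans ?_
    rw [sol.diff_radius_fst D hr₀ hJ hJr₀ hH hq hw]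
    rfl
  rw [h1, h2, (sol.fderiv_height D hr₀ hJ hJr₀ hH ha (q := (s, t)) hq hw).1]
  exact laplacian_ramp_log_ge hp (Real.smoothTransition.nonneg _) (Real.smoothTransition.le_one _)
    (deriv_smoothTransition_nonneg _) hm hηm hηC hh h4 h3'

end End
end LiouvilleCompletion
end RabinowitzFloer

/-! ### Derivative of the height at the boundary of the half-cylinder -/

namespace RabinowitzFloer

/-- A one-sided bound for the first derivative of a smooth function persists near the boundary. -/
theorem exists_fst_derivative_bound {S : Set ℝ} (hS : S = Ici 0 ∨ S = Iic 0) {F : ℝ × ℝ → ℝ}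
    (hF : ContDiffOn ℝ ∞ F (S ×ˢ univ)) {g : ℝ → ℝ} {c ν : ℝ}
    (hg : ∀ t, HasDerivWithinAt (fun s => F (s, t)) (g t) S 0) (hν : ∀ t, -ν ≤ c * g t) :
    ∃ δ > 0, ∀ s ∈ interior S, |s| < δ → ∀ t ∈ Icc (0 : ℝ) 1,
      -(ν + 1) ≤ c * fderiv ℝ F (s, t) (1, 0) := by
  have h0 : (0 : ℝ) ∈ S := by rcases hS with rfl | rfl <;> simp
  have hU : UniqueDiffOn ℝ (S ×ˢ (univ : Set ℝ)) :=
    (halfLine_uniqueDiffOn hS).prod uniqueDiffOn_univ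
  have hc : ContinuousOn (fun q => c * fderivWithin ℝ F (S ×ˢ univ) q (1, 0)) (S ×ˢ univ) :=
    continuousOn_const.mul ((hF.continuousOn_fderivWithin hU (by simp)).clm_apply continuousOn_const)
  have h1 : ∀ t, -(ν + 1) < c * fderivWithin ℝ F (S ×ˢ univ) (0, t) (1, 0) := by
    intro t
    have h2 : HasFDerivWithinAt F (fderivWithin ℝ F (S ×ˢ univ) (0, t)) (S ×ˢ univ) (0, t) :=
      ((hF.differentiableOn (by simp)) (0, t) ⟨h0, mem_univ _⟩).hasFDerivWithinAt
    have h3 : HasDerivWithinAt (fun s : ℝ => (s, t)) (1, 0) S 0 :=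
      ((hasDerivAt_id _).prodMk (hasDerivAt_const _ _)).hasDerivWithinAt
    have h4 : HasDerivWithinAt (fun s => F (s, t)) (fderivWithin ℝ F (S ×ˢ univ) (0, t) (1, 0)) S 0 :=
      HasFDerivWithinAt.comp_hasDerivWithinAt (f := fun s : ℝ => (s, t)) (l := F) 0 h2 h3
        fun s hs => ⟨hs, mem_univ _⟩
    have h5 := UniqueDiffWithinAt.eq_deriv S (halfLine_uniqueDiffOn hS 0 h0) h4 (hg t)
    rw [h5]
    linarith [hν t]
  -- The extra `1` makes the inequality strict, hence open. The tube lemma over `[0, 1]` then gives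
  -- one `δ` for all `t`.
  obtain ⟨O, hO, hOeq⟩ := (continuousOn_iff'.1 hc) _ (isOpen_Ioi (a := -(ν + 1)))
  have h2 : ({0} : Set ℝ) ×ˢ Icc (0 : ℝ) 1 ⊆ O := by
    rintro ⟨s, t⟩ ⟨hs, -⟩
    have hs' : s = 0 := hs
    subst hs'
    have : ((0 : ℝ), t) ∈ (fun q => c * fderivWithin ℝ F (S ×ˢ univ) q (1, 0)) ⁻¹' Ioi (-(ν + 1)) ∩
      S ×ˢ univ := ⟨h1 t, h0, mem_univ _⟩
    rw [hOeq] at this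
    exact this.1
  obtain ⟨U, V, hU', -, hUs, hVs, hUV⟩ := generalized_tube_lemma isCompact_singleton isCompact_Icc hO h2
  obtain ⟨δ, hδ, hδU⟩ := Metric.isOpen_iff.1 hU' 0 (hUs rfl)
  refine ⟨δ, hδ, fun s hs hsδ t ht => ?_⟩
  have h3 : (s, t) ∈ O := hUV ⟨hδU (by simpa using hsδ), hVs ht⟩
  have h4 : (s, t) ∈ O ∩ S ×ˢ univ := ⟨h3, interior_subset hs, mem_univ _⟩
  rw [← hOeq] at h4
  have h5 : -(ν + 1) < c * fderivWithin ℝ F (S ×ˢ univ) (s, t) (1, 0) := h4.1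
  rw [fderivWithin_of_mem_nhds (prod_mem_nhds (mem_interior_iff_mem_nhds.1 hs) univ_mem)] at h5
  exact h5.le

namespace LiouvilleCompletion

variable {n : ℕ}
  {M : Type*} [TopologicalSpace M] [ChartedSpace (EuclideanSpace ℝ (Fin (2 * n))) M]
  [IsManifold (𝓡 (2 * n)) ∞ M]
  {N : Type*} [TopologicalSpace N] [ChartedSpace (EuclideanSpace ℝ (Fin (2 * n - 1))) N]
  [IsManifold (𝓡 (2 * n - 1)) ∞ N]
  (D : LiouvilleCompletion n M N)
  {J : ℝ → ∀ p : M, TangentSpace (𝓡 (2 * n)) p →L[ℝ] TangentSpace (𝓡 (2 * n)) p}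
  {S : Set ℝ} {H : ℝ → M → ℝ} {u : ℝ → ℝ → M} {η : ℝ → ℝ} {r₀ : ℝ} {h : ℝ → ℝ → ℝ}

/-- On the end `∂_s ρ = -dρ(J(∂_t u - ηX_H)) = -ρ α(∂_t u - ηX_H)`, so for `log ρ` the factor `ρ`
disappears; `p` is the slope of the ramp. The derivative is one-sided at the end point of `S`, which
is where the boundary condition is given. -/
theorem IsSolution.hasDerivWithinAt_height [T2Space M] (hr₀ : 0 < r₀) (hJr₀ : D.IsContactType J r₀) (sol : D.IsSolution J S H u η) {a : ℝ} (ha : 0 ≤ a)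
    (hra : Real.log r₀ < a) {s : ℝ} (hs : s ∈ S) (t : ℝ) :
    ∃ p : ℝ, 0 ≤ p ∧ p ≤ 1 ∧ (u s t ∉ D.cylEnd r₀ → p = 0) ∧
      HasDerivWithinAt (fun σ => D.height a u (σ, t))
        (-(p * D.alphaCyl (u s t) (velocity (2 * n) (u s) t - η s • D.hamVF (H s) (u s t)))) S s := by
  have hu : MDifferentiableWithinAt 𝓘(ℝ, ℝ) (𝓡 (2 * n)) (fun σ => u σ t) S s := by
    have h1 : ContMDiffOn 𝓘(ℝ, ℝ) (𝓡 (2 * n)) ∞ (fun σ => u σ t) S :=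
      sol.u_smooth.comp (f := fun σ : ℝ => (σ, t))
        (contDiff_id.prodMk contDiff_const).contMDiff.contMDiffOn fun σ hσ => ⟨hσ, mem_univ _⟩
    exact (h1 s hs).mdifferentiableWithinAt (by simp)
  by_cases hw : u s t ∈ D.openEnd r₀
  · refine ⟨Real.smoothTransition (Real.log (D.radius (u s t)) - a), Real.smoothTransition.nonneg _,
      Real.smoothTransition.le_one _, fun hcon => (hcon (D.openEnd_subset hr₀ hw)).elim, ?_⟩
    have hp := D.radius_pos hw.1
    set δ : TangentSpace (𝓡 (2 * n)) (u s t) :=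
      velocity (2 * n) (u s) t - η s • D.hamVF (H s) (u s t) with hδ
    have h1 := HasMFDerivAt.comp_hasMFDerivWithinAt s (D.mdifferentiableAt_radius hw.1).hasMFDerivAt
      hu.hasMFDerivWithinAt
    let V : ℝ →L[ℝ] TangentSpace (𝓡 (2 * n)) (u s t) :=
      mfderivWithin 𝓘(ℝ, ℝ) (𝓡 (2 * n)) (fun σ => u σ t) S s
    have h1' : HasFDerivWithinAt (fun σ => D.radius (u σ t)) ((D.diff D.radius (u s t)).comp V) S s :=
      hasMFDerivWithinAt_iff_hasFDerivWithinAt.1 h1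
    have h2 : HasDerivWithinAt (fun σ => D.radius (u σ t))
        (D.diff D.radius (u s t) (velocityWithin (2 * n) (fun σ => u σ t) S s)) S s :=
      h1'.hasDerivWithinAt
    have h3 : velocityWithin (2 * n) (fun σ => u σ t) S s = -(J t (u s t) δ) :=
      eq_neg_of_add_eq_zero_left (sol.u_eq s hs t)
    have h4 : D.diff D.radius (u s t) (J t (u s t) δ) = D.lam (u s t) δ :=
      hJr₀ t _ (D.openEnd_subset hr₀ hw) δ
    rw [h3, map_neg, h4, D.lam_eq_radius_mul_alphaCyl hw.1] at h2
    have h5 := (hasDerivAt_ramp (Real.log (D.radius (u s t)) - a)).comp_hasDerivWithinAt s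
      ((h2.log hp.ne').sub_const a)
    have h6 : HasDerivWithinAt (fun σ => D.height a u (σ, t)) _ S s := h5.congr_of_eventuallyEq
      (hu.continuousWithinAt.eventually (D.exhaustion_eventuallyEq (a := a) hw.1))
      (D.exhaustion_of_mem hw.1)
    refine h6.congr_deriv ?_
    field_simp
  · refine ⟨0, le_rfl, zero_le_one, fun _ => rfl, ?_⟩
    rw [zero_mul, neg_zero]
    have h1 := D.exhaustion_eq_zero ha hra hw
    exact (hasDerivWithinAt_const s S (0 : ℝ)).congr_of_eventuallyEq
      (hu.continuousWithinAt.eventually h1) h1.self_of_nhds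

end LiouvilleCompletion
end RabinowitzFloer

/-! ### Integration on a cylinder and Green's identity -/

namespace RabinowitzFloer

section Parametric

variable {a b : ℝ} {f : ℝ → ℝ → ℝ}

/-- Clamping `s` to `[a, b]` makes results on globally continuous integrands available. -/
theorem exists_continuous_extension (hab : a ≤ b)
    (hf : ContinuousOn (fun q : ℝ × ℝ => f q.1 q.2) (Icc a b ×ˢ univ)) :
    ∃ g : ℝ → ℝ → ℝ, Continuous (Function.uncurry g) ∧ ∀ s ∈ Icc a b, g s = f s := by
  refine ⟨fun s t => f (projIcc a b hab s) t, ?_, fun s hs => ?_⟩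
  · rw [← continuousOn_univ]
    refine hf.comp (f := fun q : ℝ × ℝ => ((projIcc a b hab q.1 : ℝ), q.2)) ?_ ?_
    · exact ((continuous_subtype_val.comp (continuous_projIcc.comp continuous_fst)).prodMk
        continuous_snd).continuousOn
    · exact fun q _ => ⟨(projIcc a b hab q.1).2, mem_univ _⟩
  · simp only [projIcc_of_mem hab hs]

theorem continuousOn_parametric_integral
    (hf : ContinuousOn (fun q : ℝ × ℝ => f q.1 q.2) (Icc a b ×ˢ univ)) (c d : ℝ) :
    ContinuousOn (fun s => ∫ t in c..d, f s t) (Icc a b) := by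
  intro s hs
  obtain ⟨g, hg, hgf⟩ := exists_continuous_extension (hs.1.trans hs.2) hf
  have h1 := intervalIntegral.continuous_parametric_intervalIntegral_of_continuous' (μ := volume) hg c d
  exact h1.continuousOn.congr (fun x hx => by simp only [hgf x hx]) s hs

theorem continuousOn_snd_slice
    (hf : ContinuousOn (fun q : ℝ × ℝ => f q.1 q.2) (Icc a b ×ˢ univ)) {s : ℝ} (hs : s ∈ Icc a b) :
    Continuous (f s) := by
  rw [← continuousOn_univ]
  exact hf.comp (f := fun t : ℝ => (s, t)) (by fun_prop) fun t _ => ⟨hs, mem_univ _⟩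

theorem continuousOn_fst_slice
    (hf : ContinuousOn (fun q : ℝ × ℝ => f q.1 q.2) (Icc a b ×ˢ univ)) (t : ℝ) :
    ContinuousOn (fun s => f s t) (Icc a b) :=
  hf.comp (f := fun s : ℝ => (s, t)) (by fun_prop) fun _ hs => ⟨hs, mem_univ _⟩

theorem intervalIntegral_swap (hab : a ≤ b)
    (hf : ContinuousOn (fun q : ℝ × ℝ => f q.1 q.2) (Icc a b ×ˢ univ)) {c d : ℝ} (hcd : c ≤ d) :
    ∫ s in a..b, ∫ t in c..d, f s t = ∫ t in c..d, ∫ s in a..b, f s t := by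
  simp only [intervalIntegral.integral_of_le hab, intervalIntegral.integral_of_le hcd]
  refine MeasureTheory.integral_integral_swap ?_
  rw [Measure.prod_restrict]
  have h1 : IntegrableOn (Function.uncurry f) (Icc a b ×ˢ Icc c d) :=
    (hf.mono (prod_mono le_rfl (subset_univ _))).integrableOn_compact (isCompact_Icc.prod isCompact_Icc)
  exact h1.mono_set (prod_mono Ioc_subset_Icc_self Ioc_subset_Icc_self)

/-- Integration over `[a, b]` of a function on a strip gives a continuous function. -/
theorem continuous_integral_fst (hab : a ≤ b)
    (hf : ContinuousOn (fun q : ℝ × ℝ => f q.1 q.2) (Icc a b ×ˢ univ)) :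
    Continuous fun t => ∫ s in a..b, f s t := by
  obtain ⟨g, hg, hgf⟩ := exists_continuous_extension hab hf
  have h1 := intervalIntegral.continuous_parametric_intervalIntegral_of_continuous' (μ := volume)
    (f := fun t s => g s t) (hg.comp continuous_swap) a b
  refine h1.congr fun t => intervalIntegral.integral_congr fun s hs => ?_
  rw [uIcc_of_le hab] at hs
  simp only [hgf s hs]

end Parametric

/-- A function on the strip `I × ℝ`, `1`-periodic in the second variable, with its pure partial
derivatives up to order two. -/
structure CylJet (I : Set ℝ) (F Fs Ft Fss Ftt : ℝ → ℝ → ℝ) : Prop where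
  isOpen : IsOpen I
  fst : ∀ s ∈ I, ∀ t, HasDerivAt (fun σ => F σ t) (Fs s t) s
  snd : ∀ s ∈ I, ∀ t, HasDerivAt (F s) (Ft s t) t
  fst_fst : ∀ s ∈ I, ∀ t, HasDerivAt (fun σ => Fs σ t) (Fss s t) s
  snd_snd : ∀ s ∈ I, ∀ t, HasDerivAt (Ft s) (Ftt s t) t
  cont : ContinuousOn (fun q : ℝ × ℝ => F q.1 q.2) (I ×ˢ univ)
  cont_fst : ContinuousOn (fun q : ℝ × ℝ => Fs q.1 q.2) (I ×ˢ univ)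
  cont_snd : ContinuousOn (fun q : ℝ × ℝ => Ft q.1 q.2) (I ×ˢ univ)
  cont_fst_fst : ContinuousOn (fun q : ℝ × ℝ => Fss q.1 q.2) (I ×ˢ univ)
  cont_snd_snd : ContinuousOn (fun q : ℝ × ℝ => Ftt q.1 q.2) (I ×ˢ univ)
  periodic : ∀ s ∈ I, ∀ t, F s (t + 1) = F s t

namespace CylJet

variable {I : Set ℝ} {F Fs Ft Fss Ftt G Gs Gt Gss Gtt : ℝ → ℝ → ℝ} {a b : ℝ}

theorem periodic_snd (jF : CylJet I F Fs Ft Fss Ftt) {s : ℝ} (hs : s ∈ I) (t : ℝ) :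
    Ft s (t + 1) = Ft s t := by
  have h1 := (jF.snd s hs (t + 1)).comp_add_const t 1
  have h2 : (fun x => F s (x + 1)) = F s := funext fun x => jF.periodic s hs x
  rw [h2] at h1
  exact h1.unique (jF.snd s hs t)

theorem periodic_fst (jF : CylJet I F Fs Ft Fss Ftt) {s : ℝ} (hs : s ∈ I) (t : ℝ) :
    Fs s (t + 1) = Fs s t := by
  refine (jF.fst s hs (t + 1)).unique ((jF.fst s hs t).congr_of_eventuallyEq ?_)
  filter_upwards [jF.isOpen.mem_nhds hs] with σ hσ
  exact jF.periodic σ hσ t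

/-- Green's identity on a cylinder. -/
theorem green (jF : CylJet I F Fs Ft Fss Ftt) (jG : CylJet I G Gs Gt Gss Gtt) (hab : a ≤ b)
    (hI : Icc a b ⊆ I) :
    ∫ s in a..b, ∫ t in (0 : ℝ)..1, (F s t * (Gss s t + Gtt s t) - G s t * (Fss s t + Ftt s t)) =
      (∫ t in (0 : ℝ)..1, (F b t * Gs b t - G b t * Fs b t)) -
        ∫ t in (0 : ℝ)..1, (F a t * Gs a t - G a t * Fs a t) := by
  have hm : Icc a b ×ˢ (univ : Set ℝ) ⊆ I ×ˢ univ := prod_mono hI le_rfl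
  have c1 : ContinuousOn (fun q : ℝ × ℝ => F q.1 q.2 * Gss q.1 q.2 - G q.1 q.2 * Fss q.1 q.2)
      (Icc a b ×ˢ univ) :=
    ((jF.cont.mul jG.cont_fst_fst).sub (jG.cont.mul jF.cont_fst_fst)).mono hm
  have c2 : ContinuousOn (fun q : ℝ × ℝ => F q.1 q.2 * Gtt q.1 q.2 - G q.1 q.2 * Ftt q.1 q.2)
      (Icc a b ×ˢ univ) :=
    ((jF.cont.mul jG.cont_snd_snd).sub (jG.cont.mul jF.cont_snd_snd)).mono hm
  have c3 : ContinuousOn (fun q : ℝ × ℝ => F q.1 q.2 * Gs q.1 q.2 - G q.1 q.2 * Fs q.1 q.2)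
      (Icc a b ×ˢ univ) :=
    ((jF.cont.mul jG.cont_fst).sub (jG.cont.mul jF.cont_fst)).mono hm
  -- The integrand is a `t`-derivative, and its boundary terms cancel by periodicity.
  have h1 : ∀ s ∈ Icc a b, ∫ t in (0 : ℝ)..1, (F s t * Gtt s t - G s t * Ftt s t) = 0 := by
    intro s hs
    rw [intervalIntegral.integral_eq_sub_of_hasDerivAt (f := fun t => F s t * Gt s t - G s t * Ft s t)]
    · have e1 := jF.periodic s (hI hs) 0
      have e2 := jG.periodic s (hI hs) 0
      have e3 := jF.periodic_snd (hI hs) 0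
      have e4 := jG.periodic_snd (hI hs) 0
      rw [zero_add] at e1 e2 e3 e4
      rw [e1, e2, e3, e4, sub_self]
    · intro t _
      refine (((jF.snd s (hI hs) t).mul (jG.snd_snd s (hI hs) t)).sub
        ((jG.snd s (hI hs) t).mul (jF.snd_snd s (hI hs) t))).congr_deriv ?_
      ring
    · exact (continuousOn_snd_slice (f := fun s t => F s t * Gtt s t - G s t * Ftt s t) c2
        hs).intervalIntegrable _ _
  have h2 : ∫ s in a..b, ∫ t in (0 : ℝ)..1, (F s t * (Gss s t + Gtt s t) - G s t * (Fss s t + Ftt s t)) =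
      ∫ s in a..b, ∫ t in (0 : ℝ)..1, (F s t * Gss s t - G s t * Fss s t) := by
    refine intervalIntegral.integral_congr fun s hs => ?_
    rw [uIcc_of_le hab] at hs
    have e1 := (continuousOn_snd_slice (f := fun s t => F s t * Gss s t - G s t * Fss s t) c1
        hs).intervalIntegrable (μ := volume) 0 1
    have e2 := (continuousOn_snd_slice (f := fun s t => F s t * Gtt s t - G s t * Ftt s t) c2
        hs).intervalIntegrable (μ := volume) 0 1
    have e3 := intervalIntegral.integral_add e1 e2
    rw [h1 s hs, add_zero] at e3
    rw [← e3]
    refine intervalIntegral.integral_congr fun t _ => ?_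
    ring
  rw [h2, intervalIntegral_swap (f := fun s t => F s t * Gss s t - G s t * Fss s t) hab c1 zero_le_one,
    ← intervalIntegral.integral_sub]
  · refine intervalIntegral.integral_congr fun t _ => ?_
    refine intervalIntegral.integral_eq_sub_of_hasDerivAt
      (f := fun s => F s t * Gs s t - G s t * Fs s t) ?_ ?_
    · intro s hs
      rw [uIcc_of_le hab] at hs
      refine (((jF.fst s (hI hs) t).mul (jG.fst_fst s (hI hs) t)).sub
        ((jG.fst s (hI hs) t).mul (jF.fst_fst s (hI hs) t))).congr_deriv ?_
      ring
    · refine ContinuousOn.intervalIntegrable ?_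
      rw [uIcc_of_le hab]
      exact continuousOn_fst_slice (f := fun s t => F s t * Gss s t - G s t * Fss s t) c1 t
  · exact (continuousOn_snd_slice (f := fun s t => F s t * Gs s t - G s t * Fs s t) c3
      (right_mem_Icc.2 hab)).intervalIntegrable _ _
  · exact (continuousOn_snd_slice (f := fun s t => F s t * Gs s t - G s t * Fs s t) c3
      (left_mem_Icc.2 hab)).intervalIntegrable _ _

end CylJet
end RabinowitzFloer

/-! ### Exponential integrability -/

namespace RabinowitzFloer
namespace CylJet

variable {I : Set ℝ} {F Fs Ft Fss Ftt : ℝ → ℝ → ℝ} {a b : ℝ}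

/-- One step of the exponential integrability: the embedding of `W^{1,1}` into `L²`. -/
theorem integral_exp_succ_le (jF : CylJet I F Fs Ft Fss Ftt) (hab : a ≤ b) (hI : Icc a b ⊆ I)
    (hb : ∀ t, F b t = 0) {ℓ E C : ℝ} (hℓ : b - a ≤ ℓ)
    (hE : ∫ s in a..b, ∫ t in (0 : ℝ)..1, Real.exp (F s t) * (Fs s t ^ 2 + Ft s t ^ 2) ≤ E) {k : ℕ}
    (hC : ∫ s in a..b, ∫ t in (0 : ℝ)..1, Real.exp (k * F s t) ≤ C) :
    ∫ s in a..b, ∫ t in (0 : ℝ)..1, Real.exp ((k + 1 : ℕ) * F s t) ≤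
      (1 + (k + 1) / 4 * (C + E)) *
        (ℓ * (1 + (k + 1) / 4 * (C + E)) + (k + 1) / 4 * (C + E)) := by
  have hm : Icc a b ×ˢ (univ : Set ℝ) ⊆ I ×ˢ univ := prod_mono hI le_rfl
  have cF := jF.cont.mono hm
  have cFs := jF.cont_fst.mono hm
  have cFt := jF.cont_snd.mono hm
  -- With this exponent `g = e^{cF}` satisfies `g² = e^{(k+1)F}`, the integrand to be bounded.
  set c : ℝ := (k + 1) / 2 with hc
  have hc0 : 0 ≤ c := by positivity
  set g : ℝ → ℝ → ℝ := fun s t => Real.exp (c * F s t) with hg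
  set m : ℝ → ℝ → ℝ := fun s t => (k + 1) / 4 * (Real.exp (k * F s t) +
    Real.exp (F s t) * (Fs s t ^ 2 + Ft s t ^ 2)) with hmdef
  have cexp : ∀ x : ℝ, ContinuousOn (fun q : ℝ × ℝ => Real.exp (x * F q.1 q.2)) (Icc a b ×ˢ univ) :=
    fun x => (continuousOn_const.mul cF).rexp
  have cg : ContinuousOn (fun q : ℝ × ℝ => g q.1 q.2) (Icc a b ×ˢ univ) := cexp c
  have c1 : ContinuousOn (fun q : ℝ × ℝ => Real.exp (F q.1 q.2) * (Fs q.1 q.2 ^ 2 + Ft q.1 q.2 ^ 2))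
    (Icc a b ×ˢ univ) := cF.rexp.mul ((cFs.pow 2).add (cFt.pow 2))
  have cm : ContinuousOn (fun q : ℝ × ℝ => m q.1 q.2) (Icc a b ×ˢ univ) :=
    continuousOn_const.mul ((cexp k).add c1)
  have hm0 : ∀ s t, 0 ≤ m s t := fun s t => by positivity
  -- Write `e^{cF} = e^{kF/2} e^{F/2}` and use `2xy ≤ x² + y²`: both partial derivatives of `g` are
  -- dominated by the integrand of the preceding step plus the weighted energy density.
  have hbound : ∀ s t (x : ℝ), x ^ 2 ≤ Fs s t ^ 2 + Ft s t ^ 2 → |Real.exp (c * F s t) * (c * x)| ≤ m s t := by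
    intro s t x hx
    have e1 : Real.exp (c * F s t) = Real.exp (F s t / 2) * Real.exp (k * F s t / 2) := by
      rw [← Real.exp_add, hc]; ring_nf
    have e2 : Real.exp (F s t / 2) ^ 2 = Real.exp (F s t) := by rw [← Real.exp_nat_mul]; ring_nf
    have e3 : Real.exp (k * F s t / 2) ^ 2 = Real.exp (k * F s t) := by rw [← Real.exp_nat_mul]; ring_nf
    have e4 : 2 * (Real.exp (F s t / 2) * Real.exp (k * F s t / 2) * |x|) ≤
        Real.exp (k * F s t) + Real.exp (F s t) * (Fs s t ^ 2 + Ft s t ^ 2) := by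
      have h1 := two_mul_le_add_sq (Real.exp (k * F s t / 2)) (Real.exp (F s t / 2) * |x|)
      rw [e3, mul_pow, e2, sq_abs] at h1
      have h2 : Real.exp (F s t) * x ^ 2 ≤ Real.exp (F s t) * (Fs s t ^ 2 + Ft s t ^ 2) := by gcongr
      linarith
    rw [abs_mul, abs_mul, Real.abs_exp, abs_of_nonneg hc0, e1, hmdef]
    calc _ = (k + 1) / 4 * (2 * (Real.exp (F s t / 2) * Real.exp (k * F s t / 2) * |x|)) := by
          rw [hc]; ring
      _ ≤ _ := mul_le_mul_of_nonneg_left e4 (by positivity)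
  set α : ℝ → ℝ := fun t => ∫ s in a..b, m s t with hα
  set β : ℝ → ℝ := fun s => ∫ t in (0 : ℝ)..1, m s t with hβ
  set G : ℝ → ℝ := fun s => ∫ t in (0 : ℝ)..1, g s t with hG
  have cα : Continuous α := continuous_integral_fst hab cm
  have cβ : ContinuousOn β (Icc a b) := continuousOn_parametric_integral cm 0 1
  have hα0 : ∀ t, 0 ≤ α t := fun t => intervalIntegral.integral_nonneg hab fun s _ => hm0 s t
  have hβ0 : ∀ s, 0 ≤ β s := fun s => intervalIntegral.integral_nonneg zero_le_one fun t _ => hm0 s t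
  set D : ℝ := (k + 1) / 4 * (C + E) with hD
  have hβD : ∫ s in a..b, β s ≤ D := by
    have e1 : ∀ s ∈ Icc a b, β s = (k + 1) / 4 * ((∫ t in (0 : ℝ)..1, Real.exp (k * F s t)) +
        ∫ t in (0 : ℝ)..1, Real.exp (F s t) * (Fs s t ^ 2 + Ft s t ^ 2)) := by
      intro s hs
      rw [hβ, ← intervalIntegral.integral_add, ← intervalIntegral.integral_const_mul]
      · exact (continuousOn_snd_slice (f := fun s t => Real.exp (k * F s t)) (cexp k)
          hs).intervalIntegrable _ _
      · exact (continuousOn_snd_slice (f := fun s t => Real.exp (F s t) * (Fs s t ^ 2 + Ft s t ^ 2)) c1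
          hs).intervalIntegrable _ _
    have i1 : IntervalIntegrable (fun s => ∫ t in (0 : ℝ)..1, Real.exp (k * F s t)) volume a b := by
      refine ContinuousOn.intervalIntegrable ?_
      rw [uIcc_of_le hab]
      exact continuousOn_parametric_integral (f := fun s t => Real.exp (k * F s t)) (cexp k) 0 1
    have i2 : IntervalIntegrable (fun s => ∫ t in (0 : ℝ)..1,
        Real.exp (F s t) * (Fs s t ^ 2 + Ft s t ^ 2)) volume a b := by
      refine ContinuousOn.intervalIntegrable ?_
      rw [uIcc_of_le hab]
      exact continuousOn_parametric_integral
        (f := fun s t => Real.exp (F s t) * (Fs s t ^ 2 + Ft s t ^ 2)) c1 0 1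
    rw [intervalIntegral.integral_congr fun s hs => e1 s (by rwa [uIcc_of_le hab] at hs),
      intervalIntegral.integral_const_mul, intervalIntegral.integral_add i1 i2, hD]
    gcongr
  have hαD : ∫ t in (0 : ℝ)..1, α t ≤ D := by
    rw [hα, ← intervalIntegral_swap (f := m) hab cm zero_le_one]
    exact hβD
  -- Integration in `s` from the slice `s = b`, where `g = 1`, bounds `g` by a function of `t`
  -- alone.
  have hgα : ∀ s ∈ Icc a b, ∀ t, g s t ≤ 1 + α t := by
    intro s hs t
    have h1 := abs_sub_le_integral (g := fun s => g s t) (g' := fun s => Real.exp (c * F s t) * (c * Fs s t))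
      (B := fun s => m s t) (a := a) (b := b) (fun x hx => ((jF.fst x (hI hx) t).const_mul c).exp)
      ((continuousOn_fst_slice (f := fun s t => Real.exp (c * F s t)) (cexp c) t).mul
        (continuousOn_const.mul (continuousOn_fst_slice (f := Fs) cFs t)))
      (fun x _ => hbound x t _ (by nlinarith [sq_nonneg (Ft x t)]))
      (by
        refine ContinuousOn.intervalIntegrable ?_
        rw [uIcc_of_le hab]
        exact continuousOn_fst_slice (f := m) cm t) hs (right_mem_Icc.2 hab)
    have h2 : g b t = 1 := by simp [hg, hb t]
    rw [h2] at h1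
    linarith [le_abs_self (g s t - 1)]
  -- Comparison with the mean over the circle bounds `g` by a function of `s` alone. The product of
  -- the two bounds dominates `g²` and separates the variables.
  have hgβ : ∀ s ∈ Icc a b, ∀ t ∈ Icc (0 : ℝ) 1, g s t ≤ G s + β s := by
    intro s hs t ht
    have h1 : ∀ t' ∈ Icc (0 : ℝ) 1, g s t - β s ≤ g s t' := by
      intro t' ht'
      have h1 := abs_sub_le_integral (g := fun t => g s t)
        (g' := fun t => Real.exp (c * F s t) * (c * Ft s t))
        (B := fun t => m s t) (a := 0) (b := 1) (fun x _ => ((jF.snd s (hI hs) x).const_mul c).exp)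
        (((continuousOn_snd_slice (f := fun s t => Real.exp (c * F s t)) (cexp c) hs).mul
          (continuous_const.mul (continuousOn_snd_slice (f := Ft) cFt hs))).continuousOn)
        (fun x _ => hbound s x _ (by nlinarith [sq_nonneg (Fs s x)]))
        ((continuousOn_snd_slice (f := m) cm hs).intervalIntegrable _ _) ht ht'
      linarith [le_abs_self (g s t - g s t')]
    have h2 := intervalIntegral.integral_mono_on (μ := volume) zero_le_one (intervalIntegrable_const)
      ((continuousOn_snd_slice (f := g) cg hs).intervalIntegrable _ _) h1
    simp only [intervalIntegral.integral_const, sub_zero, one_smul] at h2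
    change g s t - β s ≤ G s at h2
    linarith
  have hG1 : ∀ s ∈ Icc a b, G s ≤ 1 + D := by
    intro s hs
    have h1 := intervalIntegral.integral_mono_on (μ := volume) zero_le_one
      ((continuousOn_snd_slice (f := g) cg hs).intervalIntegrable _ _)
      ((continuous_const.add cα).intervalIntegrable _ _) (g := fun t => 1 + α t) fun t _ => hgα s hs t
    rw [intervalIntegral.integral_add intervalIntegrable_const (cα.intervalIntegrable _ _)] at h1
    simp only [intervalIntegral.integral_const, sub_zero, one_smul] at h1
    change G s ≤ _ at h1
    linarith
  have hD0 : 0 ≤ D := (intervalIntegral.integral_nonneg zero_le_one fun t _ => hα0 t).trans hαD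
  have hinner : ∀ s ∈ Icc a b, ∫ t in (0 : ℝ)..1, Real.exp ((k + 1 : ℕ) * F s t) ≤
      (1 + D) * (1 + D + β s) := by
    intro s hs
    have hGβ : 0 ≤ 1 + D + β s := by linarith [hβ0 s]
    have h1 := intervalIntegral.integral_mono_on (μ := volume) zero_le_one
      ((continuousOn_snd_slice (f := fun s t => Real.exp ((k + 1 : ℕ) * F s t)) (cexp _)
        hs).intervalIntegrable _ _)
      (((continuous_const.add cα).mul continuous_const).intervalIntegrable _ _)
      (g := fun t => (1 + α t) * (1 + D + β s)) fun t ht => by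
        have e1 : Real.exp ((k + 1 : ℕ) * F s t) = g s t * g s t := by
          rw [hg, ← Real.exp_add, hc]
          push_cast
          ring_nf
        rw [e1]
        have e2 := hgα s hs t
        have e3 := (hgβ s hs t ht).trans (by linarith [hG1 s hs] : G s + β s ≤ 1 + D + β s)
        exact mul_le_mul e2 e3 (Real.exp_pos _).le (by linarith [hα0 t])
    rw [intervalIntegral.integral_mul_const, intervalIntegral.integral_add intervalIntegrable_const
      (cα.intervalIntegrable _ _)] at h1
    simp only [intervalIntegral.integral_const, sub_zero, one_smul] at h1
    refine h1.trans ?_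
    gcongr
  have iβ : IntervalIntegrable β volume a b := by
    refine ContinuousOn.intervalIntegrable ?_
    rwa [uIcc_of_le hab]
  have h1 := intervalIntegral.integral_mono_on (μ := volume) hab (by
      refine ContinuousOn.intervalIntegrable ?_
      rw [uIcc_of_le hab]
      exact continuousOn_parametric_integral (f := fun s t => Real.exp ((k + 1 : ℕ) * F s t)) (cexp _) 0 1)
    ((intervalIntegrable_const.add iβ).const_mul (1 + D)) hinner
  rw [intervalIntegral.integral_const_mul, intervalIntegral.integral_add intervalIntegrable_const iβ] at h1
  simp only [intervalIntegral.integral_const, smul_eq_mul] at h1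
  refine h1.trans ?_
  gcongr

/-- Exponential integrability of a function with a weighted energy bound. -/
theorem exists_integral_exp_le (ℓ E : ℝ) (k : ℕ) :
    ∃ C : ℝ, ∀ {I : Set ℝ} {F Fs Ft Fss Ftt : ℝ → ℝ → ℝ} {a b : ℝ} (_ : CylJet I F Fs Ft Fss Ftt)
      (_ : a ≤ b) (_ : Icc a b ⊆ I) (_ : ∀ t, F b t = 0) (_ : b - a ≤ ℓ)
      (_ : ∫ s in a..b, ∫ t in (0 : ℝ)..1, Real.exp (F s t) * (Fs s t ^ 2 + Ft s t ^ 2) ≤ E),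
      ∫ s in a..b, ∫ t in (0 : ℝ)..1, Real.exp (k * F s t) ≤ C := by
  induction k with
  | zero => exact ⟨ℓ, fun _ _ _ _ hℓ _ => by simpa using hℓ⟩
  | succ k ih =>
    obtain ⟨C, hC⟩ := ih
    exact ⟨_, fun jF hab hI hb hℓ hE =>
      jF.integral_exp_succ_le hab hI hb hℓ hE (hC jF hab hI hb hℓ hE)⟩

end CylJet
end RabinowitzFloer

/-! ### The regularized Green kernel of the cylinder -/

namespace RabinowitzFloer

section Elementary

theorem one_add_sq_div_two_le_cosh (x : ℝ) : 1 + x ^ 2 / 2 ≤ Real.cosh x := by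
  have h1 := Real.cosh_sq (x / 2)
  have h2 : Real.cosh x = Real.cosh (x / 2) ^ 2 + Real.sinh (x / 2) ^ 2 := by
    rw [← Real.cosh_two_mul]; ring_nf
  have h3 : (x / 2) ^ 2 ≤ Real.sinh (x / 2) ^ 2 := by
    rw [sq_le_sq]
    rcases le_total 0 (x / 2) with h | h
    · rw [abs_of_nonneg h, abs_of_nonneg (Real.sinh_nonneg_iff.2 h)]
      exact Real.self_le_sinh_iff.2 h
    · rw [abs_of_nonpos h, abs_of_nonpos (Real.sinh_nonpos_iff.2 h)]
      linarith [Real.sinh_le_self_iff.2 h]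
  rw [h2, h1]
  nlinarith

theorem cosh_le_one_add_sq {x : ℝ} (hx : |x| ≤ 1) : Real.cosh x ≤ 1 + x ^ 2 := by
  have h0 : x ^ 2 ≤ 1 := by
    rw [← sq_abs]
    exact pow_le_one₀ (abs_nonneg _) hx
  have h1 := Real.abs_exp_sub_one_le (x := x ^ 2 / 2) (by rw [abs_of_nonneg (by positivity)]; linarith)
  rw [abs_of_nonneg (by positivity : (0 : ℝ) ≤ x ^ 2 / 2)] at h1
  linarith [Real.cosh_le_exp_half_sq x, le_abs_self (Real.exp (x ^ 2 / 2) - 1)]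

/-- The exponent is chosen so that the fourth power of the right-hand side, of order `|y|^(-1/2)`,
is integrable near zero. -/
theorem neg_log_sq_le {y : ℝ} (hy : y ≠ 0) : -Real.log (y ^ 2) ≤ 16 * |y| ^ (-(1 / 8) : ℝ) := by
  have h0 : 0 < |y| := abs_pos.2 hy
  have h1 := Real.log_le_rpow_div (inv_nonneg.2 h0.le) (by norm_num : (0 : ℝ) < 1 / 8)
  rw [Real.log_inv, Real.log_abs, Real.inv_rpow h0.le, ← Real.rpow_neg h0.le] at h1
  rw [Real.log_pow]
  push_cast
  linarith

end Elementary

/-- The argument of the logarithm in the regularized Green kernel of the cylinder. -/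
noncomputable def kernelArg (ε s t : ℝ) : ℝ :=
  Real.cosh (2 * Real.pi * s) - Real.cos (2 * Real.pi * t) + ε

theorem kernelArg_pos {ε : ℝ} (hε : 0 < ε) (s t : ℝ) : 0 < kernelArg ε s t := by
  have := Real.one_le_cosh (2 * Real.pi * s)
  have := Real.cos_le_one (2 * Real.pi * t)
  rw [kernelArg]
  linarith

/-- This bound and the next do not involve `ε`. This one controls the logarithm on slices away from
the pole; the next one does so on the boundary slice, even if the pole lies on it. -/
theorem sq_le_kernelArg {ε : ℝ} (hε : 0 < ε) (s t : ℝ) : s ^ 2 ≤ kernelArg ε s t := by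
  have h1 := one_add_sq_div_two_le_cosh (2 * Real.pi * s)
  have h2 := Real.cos_le_one (2 * Real.pi * t)
  have h3 : s ^ 2 ≤ (2 * Real.pi * s) ^ 2 / 2 := by
    have : (2 * Real.pi * s) ^ 2 / 2 = 2 * Real.pi ^ 2 * s ^ 2 := by ring
    rw [this]
    exact le_mul_of_one_le_left (sq_nonneg s) (by nlinarith [Real.pi_gt_three])
  rw [kernelArg]
  linarith

theorem sin_sq_le_kernelArg {ε : ℝ} (hε : 0 < ε) (s t : ℝ) :
    Real.sin (Real.pi * t) ^ 2 ≤ kernelArg ε s t := by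
  have h1 := Real.one_le_cosh (2 * Real.pi * s)
  have h2 : Real.cos (2 * Real.pi * t) = 1 - 2 * Real.sin (Real.pi * t) ^ 2 := by
    rw [show 2 * Real.pi * t = 2 * (Real.pi * t) by ring, Real.cos_two_mul, Real.cos_sq']
    ring
  rw [kernelArg, h2]
  nlinarith [sq_nonneg (Real.sin (Real.pi * t))]

theorem kernelArg_le {ε s ℓ : ℝ} (hε : ε ≤ 1) (hs : |s| ≤ 2 * ℓ) (t : ℝ) :
    kernelArg ε s t ≤ Real.cosh (4 * Real.pi * ℓ) + 2 := by
  have h1 : Real.cosh (2 * Real.pi * s) ≤ Real.cosh (4 * Real.pi * ℓ) := by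
    rw [Real.cosh_le_cosh, abs_mul, abs_of_pos Real.two_pi_pos]
    refine le_trans ?_ (le_abs_self _)
    nlinarith [Real.pi_pos]
  have h2 := Real.neg_one_le_cos (2 * Real.pi * t)
  rw [kernelArg]
  linarith

theorem kernelArg_neg (ε s t : ℝ) : kernelArg ε (-s) t = kernelArg ε s t := by
  rw [kernelArg, kernelArg, mul_neg, Real.cosh_neg]

/-- For `ε = δ²` the argument is of order `δ²` on a square of side `δ`. The Laplacian of the kernel
is then at least of order `δ⁻²` there, the inverse of the area. -/
theorem kernelArg_le_of_mem {δ s t : ℝ} (hδ : δ ≤ 1 / 8) (hs : s ∈ Icc 0 δ) (ht : t ∈ Icc 0 δ) :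
    kernelArg (δ ^ 2) s t ≤ 100 * δ ^ 2 ∧ 1 ≤ Real.cosh (2 * Real.pi * s) + Real.cos (2 * Real.pi * t) := by
  have hp3 := Real.pi_gt_three
  have hp4 := Real.pi_lt_d2
  have hpp : Real.pi ^ 2 ≤ 10 := by nlinarith
  have h0 : ∀ x ∈ Icc 0 δ, |2 * Real.pi * x| ≤ 1 ∧ (2 * Real.pi * x) ^ 2 ≤ 40 * δ ^ 2 := by
    intro x hx
    constructor
    · rw [abs_of_nonneg (by have := hx.1; positivity)]
      nlinarith [hx.1, hx.2]
    · have h1 : x ^ 2 ≤ δ ^ 2 := pow_le_pow_left₀ hx.1 hx.2 2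
      have h2 : (2 * Real.pi * x) ^ 2 = 4 * Real.pi ^ 2 * x ^ 2 := by ring
      rw [h2]
      nlinarith [sq_nonneg x]
  have h1 := cosh_le_one_add_sq (h0 s hs).1
  have h2 := Real.one_sub_sq_div_two_le_cos (x := 2 * Real.pi * t)
  have h3 := (h0 s hs).2
  have h4 := (h0 t ht).2
  have h5 : (2 * Real.pi * t) ^ 2 ≤ 1 := by
    rw [← sq_abs]
    exact pow_le_one₀ (abs_nonneg _) (h0 t ht).1
  refine ⟨?_, ?_⟩
  · rw [kernelArg]
    nlinarith
  · linarith [Real.one_le_cosh (2 * Real.pi * s)]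

theorem continuous_kernelArg (ε : ℝ) : Continuous fun q : ℝ × ℝ => kernelArg ε q.1 q.2 := by
  unfold kernelArg
  fun_prop

theorem hasDerivAt_kernelArg_fst (ε s t : ℝ) :
    HasDerivAt (fun σ => kernelArg ε σ t) (2 * Real.pi * Real.sinh (2 * Real.pi * s)) s := by
  have h1 := ((((hasDerivAt_id s).const_mul (2 * Real.pi)).cosh).sub_const
    (Real.cos (2 * Real.pi * t))).add_const ε
  exact h1.congr_deriv (by simp only [id]; ring)

theorem hasDerivAt_kernelArg_snd (ε s t : ℝ) :
    HasDerivAt (kernelArg ε s) (2 * Real.pi * Real.sin (2 * Real.pi * t)) t := by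
  have h1 := ((((hasDerivAt_id t).const_mul (2 * Real.pi)).cos).const_sub
    (Real.cosh (2 * Real.pi * s))).add_const ε
  exact h1.congr_deriv (by simp only [id]; ring)

/-- The regularized Green kernel of the cylinder. -/
theorem cylJet_kernel {ε : ℝ} (hε : 0 < ε) (c : ℝ) :
    CylJet univ (fun s t => Real.log (kernelArg ε s t) - c)
      (fun s t => 2 * Real.pi * Real.sinh (2 * Real.pi * s) / kernelArg ε s t)
      (fun s t => 2 * Real.pi * Real.sin (2 * Real.pi * t) / kernelArg ε s t)
      (fun s t => 4 * Real.pi ^ 2 * (Real.cosh (2 * Real.pi * s) * kernelArg ε s t -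
        Real.sinh (2 * Real.pi * s) ^ 2) / kernelArg ε s t ^ 2)
      (fun s t => 4 * Real.pi ^ 2 * (Real.cos (2 * Real.pi * t) * kernelArg ε s t -
        Real.sin (2 * Real.pi * t) ^ 2) / kernelArg ε s t ^ 2) := by
  have hc := continuous_kernelArg ε
  have h0 : ∀ s t, kernelArg ε s t ≠ 0 := fun s t => (kernelArg_pos hε s t).ne'
  have h0' : ∀ q : ℝ × ℝ, kernelArg ε q.1 q.2 ≠ 0 := fun q => h0 _ _
  refine ⟨isOpen_univ, fun s _ t => ?_, fun s _ t => ?_, fun s _ t => ?_, fun s _ t => ?_, ?_, ?_, ?_,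
    ?_, ?_, fun s _ t => ?_⟩
  · exact ((hasDerivAt_kernelArg_fst ε s t).log (h0 s t)).sub_const c
  · exact ((hasDerivAt_kernelArg_snd ε s t).log (h0 s t)).sub_const c
  · have h1 := (((hasDerivAt_id s).const_mul (2 * Real.pi)).sinh).const_mul (2 * Real.pi)
    refine (h1.div (hasDerivAt_kernelArg_fst ε s t) (h0 s t)).congr_deriv ?_
    simp only [id]
    ring
  · have h1 := (((hasDerivAt_id t).const_mul (2 * Real.pi)).sin).const_mul (2 * Real.pi)
    refine (h1.div (hasDerivAt_kernelArg_snd ε s t) (h0 s t)).congr_deriv ?_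
    simp only [id]
    ring
  · exact ((hc.log h0').sub continuous_const).continuousOn
  · exact (Continuous.div (by fun_prop) hc h0').continuousOn
  · exact (Continuous.div (by fun_prop) hc h0').continuousOn
  · exact (Continuous.div (by fun_prop) (hc.pow 2) fun q => pow_ne_zero 2 (h0' q)).continuousOn
  · exact (Continuous.div (by fun_prop) (hc.pow 2) fun q => pow_ne_zero 2 (h0' q)).continuousOn
  · have : kernelArg ε s (t + 1) = kernelArg ε s t := by
      rw [kernelArg, kernelArg, mul_add, mul_one, Real.cos_add_two_pi]
    simp only [this]

/-- By `cosh² - sinh² = cos² + sin²` everything without the factor `ε` cancels: `log(cosh - cos)` is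
harmonic off its pole, and the regularization leaves a non-negative Laplacian. -/
theorem laplacian_kernel (ε s t : ℝ) :
    4 * Real.pi ^ 2 * (Real.cosh (2 * Real.pi * s) * kernelArg ε s t -
        Real.sinh (2 * Real.pi * s) ^ 2) / kernelArg ε s t ^ 2 +
      4 * Real.pi ^ 2 * (Real.cos (2 * Real.pi * t) * kernelArg ε s t -
        Real.sin (2 * Real.pi * t) ^ 2) / kernelArg ε s t ^ 2 =
    4 * Real.pi ^ 2 * (ε * (Real.cosh (2 * Real.pi * s) + Real.cos (2 * Real.pi * t))) /
      kernelArg ε s t ^ 2 := by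
  rw [← add_div, ← mul_add]
  congr 2
  rw [Real.sinh_sq, Real.sin_sq, kernelArg]
  ring

namespace CylJet

variable {I : Set ℝ} {F Fs Ft Fss Ftt G Gs Gt Gss Gtt : ℝ → ℝ → ℝ}

theorem add (jF : CylJet I F Fs Ft Fss Ftt) (jG : CylJet I G Gs Gt Gss Gtt) :
    CylJet I (fun s t => F s t + G s t) (fun s t => Fs s t + Gs s t) (fun s t => Ft s t + Gt s t)
      (fun s t => Fss s t + Gss s t) (fun s t => Ftt s t + Gtt s t) where
  isOpen := jF.isOpen
  fst s hs t := (jF.fst s hs t).add (jG.fst s hs t)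
  snd s hs t := (jF.snd s hs t).add (jG.snd s hs t)
  fst_fst s hs t := (jF.fst_fst s hs t).add (jG.fst_fst s hs t)
  snd_snd s hs t := (jF.snd_snd s hs t).add (jG.snd_snd s hs t)
  cont := jF.cont.add jG.cont
  cont_fst := jF.cont_fst.add jG.cont_fst
  cont_snd := jF.cont_snd.add jG.cont_snd
  cont_fst_fst := jF.cont_fst_fst.add jG.cont_fst_fst
  cont_snd_snd := jF.cont_snd_snd.add jG.cont_snd_snd
  periodic s hs t := by simp only [jF.periodic s hs t, jG.periodic s hs t]

/-- Translation of a function on a cylinder. -/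
theorem translate (jF : CylJet I F Fs Ft Fss Ftt) (c d : ℝ) :
    CylJet ((· + c) ⁻¹' I) (fun s t => F (s + c) (t + d)) (fun s t => Fs (s + c) (t + d))
      (fun s t => Ft (s + c) (t + d)) (fun s t => Fss (s + c) (t + d))
      (fun s t => Ftt (s + c) (t + d)) := by
  have hc : ContinuousOn (fun q : ℝ × ℝ => (q.1 + c, q.2 + d)) (((· + c) ⁻¹' I) ×ˢ univ) := by
    fun_prop
  have hm : MapsTo (fun q : ℝ × ℝ => (q.1 + c, q.2 + d)) (((· + c) ⁻¹' I) ×ˢ univ) (I ×ˢ univ) :=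
    fun q hq => ⟨hq.1, mem_univ _⟩
  exact
  { isOpen := jF.isOpen.preimage (by fun_prop)
    fst := fun s hs t => (jF.fst (s + c) hs (t + d)).comp_add_const s c
    snd := fun s hs t => (jF.snd (s + c) hs (t + d)).comp_add_const t d
    fst_fst := fun s hs t => (jF.fst_fst (s + c) hs (t + d)).comp_add_const s c
    snd_snd := fun s hs t => (jF.snd_snd (s + c) hs (t + d)).comp_add_const t d
    cont := jF.cont.comp hc hm
    cont_fst := jF.cont_fst.comp hc hm
    cont_snd := jF.cont_snd.comp hc hm
    cont_fst_fst := jF.cont_fst_fst.comp hc hm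
    cont_snd_snd := jF.cont_snd_snd.comp hc hm
    periodic := fun s hs t => by rw [add_right_comm, jF.periodic (s + c) hs (t + d)] }

/-- Rescaling of the first variable. -/
theorem rescale (jF : CylJet I F Fs Ft Fss Ftt) (c : ℝ) :
    CylJet ((c * ·) ⁻¹' I) (fun s t => F (c * s) t) (fun s t => c * Fs (c * s) t)
      (fun s t => Ft (c * s) t) (fun s t => c ^ 2 * Fss (c * s) t) (fun s t => Ftt (c * s) t) := by
  have hc : ContinuousOn (fun q : ℝ × ℝ => (c * q.1, q.2)) (((c * ·) ⁻¹' I) ×ˢ univ) := by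
    fun_prop
  have hm : MapsTo (fun q : ℝ × ℝ => (c * q.1, q.2)) (((c * ·) ⁻¹' I) ×ˢ univ) (I ×ˢ univ) :=
    fun q hq => ⟨hq.1, mem_univ _⟩
  have hmul : ∀ {f : ℝ → ℝ} {f' x : ℝ}, HasDerivAt f f' (c * x) →
      HasDerivAt (fun y => f (c * y)) (c * f') x := by
    intro f f' x hf
    have h1 : HasDerivAt (fun y => c * y) c x := by simpa using (hasDerivAt_id x).const_mul c
    exact (hf.comp x h1).congr_deriv (mul_comm _ _)
  exact
  { isOpen := jF.isOpen.preimage (by fun_prop)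
    fst := fun s hs t => hmul (jF.fst (c * s) hs t)
    snd := fun s hs t => jF.snd (c * s) hs t
    fst_fst := fun s hs t => ((hmul (jF.fst_fst (c * s) hs t)).const_mul c).congr_deriv (by ring)
    snd_snd := fun s hs t => jF.snd_snd (c * s) hs t
    cont := jF.cont.comp hc hm
    cont_fst := continuousOn_const.mul (jF.cont_fst.comp hc hm)
    cont_snd := jF.cont_snd.comp hc hm
    cont_fst_fst := continuousOn_const.mul (jF.cont_fst_fst.comp hc hm)
    cont_snd_snd := jF.cont_snd_snd.comp hc hm
    periodic := fun s hs t => jF.periodic (c * s) hs t }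

end CylJet
end RabinowitzFloer

/-! ### Integrability of the kernel and the Neumann reflection -/

namespace RabinowitzFloer

/-- An integrable function which dominates the fourth power of the Green kernel. -/
noncomputable def kernelWeight (c y : ℝ) : ℝ := 8 * ((2 * c) ^ 4 + 32 ^ 4 * |y| ^ (-(1 / 2) : ℝ))

theorem kernelWeight_nonneg (c y : ℝ) : 0 ≤ kernelWeight c y := by
  unfold kernelWeight
  positivity

theorem intervalIntegrable_kernelWeight (c a b : ℝ) :
    IntervalIntegrable (kernelWeight c) volume a b := by
  have h1 : IntervalIntegrable (fun y : ℝ => |y| ^ (-(1 / 2) : ℝ)) volume a b := by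
    refine intervalIntegrable_of_even (fun x => by rw [abs_neg]) fun x hx => ?_
    refine (intervalIntegral.intervalIntegrable_rpow' (r := -(1 / 2)) (a := 0) (b := x)
      (by norm_num)).congr ?_
    rw [uIoc_of_le hx.le]
    intro y hy
    simp only [abs_of_pos hy.1]
  exact (intervalIntegrable_const.add (h1.const_mul _)).const_mul _

/-- The inequality `(x + y)⁴ ≤ 8 (x⁴ + y⁴)`. -/
theorem pow_four_le_kernelWeight (c : ℝ) {y : ℝ} (hy : y ≠ 0) :
    (2 * c + 32 * |y| ^ (-(1 / 8) : ℝ)) ^ 4 ≤ kernelWeight c y := by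
  have h0 : 0 < |y| := abs_pos.2 hy
  have h1 : (|y| ^ (-(1 / 8) : ℝ)) ^ 4 = |y| ^ (-(1 / 2) : ℝ) := by
    rw [← Real.rpow_natCast, ← Real.rpow_mul h0.le]
    norm_num
  rw [kernelWeight, ← h1]
  set x := |y| ^ (-(1 / 8) : ℝ)
  nlinarith [sq_nonneg (2 * c - 32 * x), sq_nonneg ((2 * c) ^ 2 - (32 * x) ^ 2),
    sq_nonneg (2 * c + 32 * x), sq_nonneg ((2 * c) * (32 * x)),
    mul_nonneg (sq_nonneg (2 * c - 32 * x)) (sq_nonneg (2 * c + 32 * x)),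
    mul_nonneg (sq_nonneg (2 * c - 32 * x)) (sq_nonneg (2 * c)),
    mul_nonneg (sq_nonneg (2 * c - 32 * x)) (sq_nonneg (32 * x)),
    pow_nonneg (sq_nonneg (2 * c - 32 * x)) 2]

theorem integral_kernelWeight_translate_le {c ℓ a b s₀ : ℝ} (hs₀ : s₀ ∈ Icc a b) (hℓ : b - a ≤ ℓ) :
    ∫ s in a..b, kernelWeight c (s - s₀) ≤ ∫ y in (-ℓ)..ℓ, kernelWeight c y := by
  rw [intervalIntegral.integral_comp_sub_right (kernelWeight c) s₀]
  exact intervalIntegral.integral_mono_interval (by linarith [hs₀.2, hs₀.1]) (by linarith [hs₀.1, hs₀.2])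
    (by linarith [hs₀.1]) (ae_of_all _ fun y => kernelWeight_nonneg c y)
    (intervalIntegrable_kernelWeight c _ _)

theorem intervalIntegrable_log_sin_pi (a b : ℝ) :
    IntervalIntegrable (fun t => Real.log (Real.sin (Real.pi * t))) volume a b := by
  have h1 := (intervalIntegrable_log_sin (a := Real.pi * a) (b := Real.pi * b)).comp_mul_left
    (c := Real.pi)
  simpa [Real.pi_ne_zero] using h1

namespace CylJet

variable {I : Set ℝ} {F Fs Ft Fss Ftt P : ℝ → ℝ → ℝ} {a b : ℝ}

/-- A zero of a non-negative function is a minimum. Slices on which `F` vanishes thus contribute no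
boundary term to Green's identity and are also admissible as left ends. -/
theorem fst_eq_zero (jF : CylJet I F Fs Ft Fss Ftt) (hF : ∀ s ∈ I, ∀ t, 0 ≤ F s t) {s t : ℝ}
    (hs : s ∈ I) (h : F s t = 0) : Fs s t = 0 := by
  have h1 : IsLocalMin (fun σ => F σ t) s := by
    filter_upwards [jF.isOpen.mem_nhds hs] with σ hσ
    rw [h]
    exact hF σ hσ t
  exact h1.hasDerivAt_eq_zero (jF.fst s hs t)

end CylJet

/-- The symmetrized Green kernel with pole at `(s₀, 0)`, satisfying a Neumann condition at `s = a`. -/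
theorem exists_neumann_kernel {a b s₀ ℓ ε : ℝ} (hs₀ : s₀ ∈ Icc a b) (hℓ : b - a ≤ ℓ) (hε : 0 < ε)
    (hε1 : ε ≤ 1) :
    ∃ G Gs Gt Gss Gtt : ℝ → ℝ → ℝ, CylJet univ G Gs Gt Gss Gtt ∧ (∀ s ∈ Icc a b, ∀ t, G s t ≤ 0) ∧
      (∀ t, Gs a t = 0) ∧ (∀ s t, 0 ≤ Gss s t + Gtt s t) ∧
      (∀ s ∈ Icc a b, s ≠ s₀ → ∀ t, -G s t ≤ 2 * Real.log (Real.cosh (4 * Real.pi * ℓ) + 2) +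
        32 * |s - s₀| ^ (-(1 / 8) : ℝ)) ∧
      (∀ t ∈ Ioo (0 : ℝ) 1, -G a t ≤ 2 * Real.log (Real.cosh (4 * Real.pi * ℓ) + 2) -
        4 * Real.log (Real.sin (Real.pi * t))) ∧
      (∀ δ, 0 < δ → δ ≤ 1 / 8 → ε = δ ^ 2 → ∀ s ∈ Icc s₀ (s₀ + δ), ∀ t ∈ Icc 0 δ,
        1 / (1000 * δ ^ 2) ≤ Gss s t + Gtt s t) := by
  -- An upper bound for the logarithm of the kernel argument over the range needed; subtracting it
  -- makes the kernel non-positive.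
  set c := Real.log (Real.cosh (4 * Real.pi * ℓ) + 2) with hc
  have hBc : 0 < Real.cosh (4 * Real.pi * ℓ) + 2 := by positivity
  have jL := cylJet_kernel hε c
  have j1 := jL.translate (-s₀) 0
  -- The mirror pole at `2a - s₀`. The kernel is even in `s`, so the `s`-derivatives of the two
  -- copies cancel at `s = a`.
  have j2 := jL.translate (s₀ - 2 * a) 0
  rw [preimage_univ] at j1 j2
  have hlap : ∀ s t, 0 ≤ 4 * Real.pi ^ 2 * (Real.cosh (2 * Real.pi * s) * kernelArg ε s t -
        Real.sinh (2 * Real.pi * s) ^ 2) / kernelArg ε s t ^ 2 +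
      4 * Real.pi ^ 2 * (Real.cos (2 * Real.pi * t) * kernelArg ε s t -
        Real.sin (2 * Real.pi * t) ^ 2) / kernelArg ε s t ^ 2 := by
    intro s t
    rw [laplacian_kernel]
    have h1 := Real.one_le_cosh (2 * Real.pi * s)
    have h2 := Real.neg_one_le_cos (2 * Real.pi * t)
    have h3 : 0 ≤ Real.cosh (2 * Real.pi * s) + Real.cos (2 * Real.pi * t) := by linarith
    positivity
  have habs1 : ∀ s ∈ Icc a b, |s + -s₀| ≤ 2 * ℓ := fun s hs => by
    rw [abs_le]; constructor <;> linarith [hs.1, hs.2, hs₀.1, hs₀.2]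
  have habs2 : ∀ s ∈ Icc a b, |s + (s₀ - 2 * a)| ≤ 2 * ℓ := fun s hs => by
    rw [abs_le]; constructor <;> linarith [hs.1, hs.2, hs₀.1, hs₀.2]
  have hpos := fun s t => kernelArg_pos hε s t
  refine ⟨_, _, _, _, _, j1.add j2, ?_, ?_, ?_, ?_, ?_, ?_⟩
  · intro s hs t
    have h1 := Real.log_le_log (hpos (s + -s₀) (t + 0)) (kernelArg_le hε1 (habs1 s hs) (t + 0))
    have h2 := Real.log_le_log (hpos (s + (s₀ - 2 * a)) (t + 0))
      (kernelArg_le hε1 (habs2 s hs) (t + 0))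
    linarith
  · intro t
    simp only [add_zero]
    have h1 : a + (s₀ - 2 * a) = -(a + -s₀) := by ring
    rw [h1, kernelArg_neg, mul_neg, Real.sinh_neg]
    ring
  · intro s t
    linarith [hlap (s + -s₀) (t + 0), hlap (s + (s₀ - 2 * a)) (t + 0)]
  · intro s hs hss t
    have hy : s - s₀ ≠ 0 := sub_ne_zero.2 hss
    have h0 : 0 < (s - s₀) ^ 2 := by positivity
    have h1 := Real.log_le_log h0 (sq_le_kernelArg hε (s - s₀) (t + 0))
    -- As `s` and `s₀` both lie to the right of `a`, the mirror pole is at least as far from `s` as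
    -- `s₀` is.
    have h2 : (s - s₀) ^ 2 ≤ (s + (s₀ - 2 * a)) ^ 2 := by
      nlinarith [hs.1, hs₀.1]
    have h3 := Real.log_le_log h0 (h2.trans (sq_le_kernelArg hε (s + (s₀ - 2 * a)) (t + 0)))
    have h4 := neg_log_sq_le hy
    simp only [← sub_eq_add_neg]
    linarith
  · intro t ht
    have hs : 0 < Real.sin (Real.pi * t) := Real.sin_pos_of_pos_of_lt_pi (by have := ht.1; positivity)
      (by nlinarith [Real.pi_pos, ht.2])
    have h0 : 0 < Real.sin (Real.pi * t) ^ 2 := by positivity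
    have h1 := Real.log_le_log h0 (sin_sq_le_kernelArg hε (a + -s₀) t)
    have h2 := Real.log_le_log h0 (sin_sq_le_kernelArg hε (a + (s₀ - 2 * a)) t)
    rw [Real.log_pow] at h1 h2
    push_cast at h1 h2
    simp only [add_zero]
    linarith
  · intro δ hδ hδ8 hεδ s hs t ht
    have h1 := hlap (s + (s₀ - 2 * a)) (t + 0)
    have h2 := laplacian_kernel ε (s + -s₀) t
    simp only [add_zero] at h1 ⊢
    obtain ⟨h3, h4⟩ := kernelArg_le_of_mem hδ8 (s := s + -s₀) (t := t)
      ⟨by linarith [hs.1], by linarith [hs.2]⟩ ht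
    rw [← hεδ] at h3
    have h5 : 1 / (1000 * δ ^ 2) ≤ 4 * Real.pi ^ 2 * (ε * (Real.cosh (2 * Real.pi * (s + -s₀)) +
        Real.cos (2 * Real.pi * t))) / kernelArg ε (s + -s₀) t ^ 2 := by
      have hA := hpos (s + -s₀) t
      have h6 : kernelArg ε (s + -s₀) t ^ 2 ≤ (100 * δ ^ 2) ^ 2 := by
        rw [← hεδ]; exact pow_le_pow_left₀ hA.le h3 2
      rw [div_le_div_iff₀ (by positivity) (by positivity), one_mul]
      refine h6.trans ?_
      have h7 : (9 : ℝ) ≤ Real.pi ^ 2 := by nlinarith [Real.pi_gt_three]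
      calc (100 * δ ^ 2) ^ 2 ≤ 4 * 9 * (δ ^ 2 * 1) * (1000 * δ ^ 2) := by
            have : 0 ≤ δ ^ 2 * δ ^ 2 := by positivity
            nlinarith
        _ ≤ _ := by
            rw [hεδ]
            gcongr
    linarith

end RabinowitzFloer

/-! ### The mean value inequality -/

namespace RabinowitzFloer
namespace CylJet

variable {I : Set ℝ} {F Fs Ft Fss Ftt P : ℝ → ℝ → ℝ} {a b : ℝ}

/-- The right-hand side of the mean value inequality. -/
theorem integral_kernel_mul_le (jF : CylJet I F Fs Ft Fss Ftt) (hab : a ≤ b) (hI : Icc a b ⊆ I)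
    (hPc : ContinuousOn (fun q : ℝ × ℝ => P q.1 q.2) (Icc a b ×ˢ univ))
    (hP0 : ∀ s ∈ Icc a b, ∀ t, 0 ≤ P s t) {ℓ c C s₀ : ℝ} (hℓ : b - a ≤ ℓ) (hs₀ : s₀ ∈ Icc a b)
    (hPC : ∫ s in a..b, (∫ t in (0 : ℝ)..1, P s t ^ 2) ^ 2 ≤ C)
    (hFC : ∫ s in a..b, ∫ t in (0 : ℝ)..1, Fs s t ^ 2 ≤ C) {G : ℝ → ℝ → ℝ}
    (hGc : ContinuousOn (fun q : ℝ × ℝ => G q.1 q.2) (Icc a b ×ˢ univ))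
    (hG : ∀ s ∈ Icc a b, s ≠ s₀ → ∀ t, G s t ≤ 2 * c + 32 * |s - s₀| ^ (-(1 / 8) : ℝ))
    (hc : 0 ≤ c) :
    ∫ s in a..b, ∫ t in (0 : ℝ)..1, G s t * (P s t * (1 + |Fs s t|)) ≤
      (∫ y in (-ℓ)..ℓ, kernelWeight c y) + ℓ + 2 * C := by
  have hm : Icc a b ×ˢ (univ : Set ℝ) ⊆ I ×ˢ univ := prod_mono hI le_rfl
  have cFs := jF.cont_fst.mono hm
  have cI : ContinuousOn (fun q : ℝ × ℝ => G q.1 q.2 * (P q.1 q.2 * (1 + |Fs q.1 q.2|)))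
      (Icc a b ×ˢ univ) := hGc.mul (hPc.mul (continuousOn_const.add cFs.abs))
  have cP2 : ContinuousOn (fun q : ℝ × ℝ => P q.1 q.2 ^ 2) (Icc a b ×ˢ univ) := hPc.pow 2
  have cF2 : ContinuousOn (fun q : ℝ × ℝ => Fs q.1 q.2 ^ 2) (Icc a b ×ˢ univ) := cFs.pow 2
  set p : ℝ → ℝ := fun s => ∫ t in (0 : ℝ)..1, P s t ^ 2 with hp
  set f : ℝ → ℝ := fun s => ∫ t in (0 : ℝ)..1, Fs s t ^ 2 with hf
  have ip : IntervalIntegrable (fun s => p s ^ 2) volume a b := by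
    refine ContinuousOn.intervalIntegrable ?_
    rw [uIcc_of_le hab]
    exact (continuousOn_parametric_integral (f := fun s t => P s t ^ 2) cP2 0 1).pow 2
  have jf : IntervalIntegrable f volume a b := by
    refine ContinuousOn.intervalIntegrable ?_
    rw [uIcc_of_le hab]
    exact continuousOn_parametric_integral (f := fun s t => Fs s t ^ 2) cF2 0 1
  have iw : IntervalIntegrable (fun s => kernelWeight c (s - s₀)) volume a b := by
    have h1 := (intervalIntegrable_kernelWeight c (a - s₀) (b - s₀)).comp_sub_right s₀
    simpa using h1
  -- Young's inequality twice: in `t`, `Λ P (1 + |Fs|) ≤ Λ² P² / 2 + 1 + Fs²`, and after integration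
  -- `Λ² p / 2 ≤ (Λ⁴ + p²) / 4`. The slice `s = s₀`, on which `G` has no such bound, is negligible.
  have h1 : ∀ s ∈ Icc a b, s ≠ s₀ → ∫ t in (0 : ℝ)..1, G s t * (P s t * (1 + |Fs s t|)) ≤
      kernelWeight c (s - s₀) + p s ^ 2 + 1 + f s := by
    intro s hs hss
    set Λ : ℝ := 2 * c + 32 * |s - s₀| ^ (-(1 / 8) : ℝ) with hΛ
    have hΛ0 : 0 ≤ Λ := by positivity
    have cp := continuousOn_snd_slice (f := fun s t => P s t ^ 2) cP2 hs
    have cf := continuousOn_snd_slice (f := fun s t => Fs s t ^ 2) cF2 hs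
    have h2 : ∫ t in (0 : ℝ)..1, G s t * (P s t * (1 + |Fs s t|)) ≤
        ∫ t in (0 : ℝ)..1, (Λ ^ 2 / 2 * P s t ^ 2 + (1 + Fs s t ^ 2)) := by
      refine intervalIntegral.integral_mono_on zero_le_one
        ((continuousOn_snd_slice (f := fun s t => G s t * (P s t * (1 + |Fs s t|))) cI
          hs).intervalIntegrable _ _)
        (((continuous_const.mul cp).add (continuous_const.add cf)).intervalIntegrable _ _) fun t _ => ?_
      have e1 : G s t * (P s t * (1 + |Fs s t|)) ≤ Λ * (P s t * (1 + |Fs s t|)) := by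
        have := hP0 s hs t
        exact mul_le_mul_of_nonneg_right (hG s hs hss t) (by positivity)
      nlinarith [sq_nonneg (Λ * P s t - (1 + |Fs s t|)), sq_nonneg (1 - |Fs s t|), sq_abs (Fs s t)]
    have h3 : ∫ t in (0 : ℝ)..1, (Λ ^ 2 / 2 * P s t ^ 2 + (1 + Fs s t ^ 2)) =
        Λ ^ 2 / 2 * p s + (1 + f s) := by
      have i1 := cp.intervalIntegrable (μ := volume) 0 1
      have i2 := cf.intervalIntegrable (μ := volume) 0 1
      rw [intervalIntegral.integral_add (i1.const_mul _) (intervalIntegrable_const.add i2),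
        intervalIntegral.integral_const_mul, intervalIntegral.integral_add intervalIntegrable_const i2]
      simp [hp, hf]
    have h4 := pow_four_le_kernelWeight c (sub_ne_zero.2 hss)
    rw [← hΛ] at h4
    have h5 : 0 ≤ kernelWeight c (s - s₀) := kernelWeight_nonneg _ _
    rw [h3] at h2
    nlinarith [sq_nonneg (Λ ^ 2 - p s)]
  have iI : IntervalIntegrable (fun s => ∫ t in (0 : ℝ)..1, G s t * (P s t * (1 + |Fs s t|))) volume a b := by
    refine ContinuousOn.intervalIntegrable ?_
    rw [uIcc_of_le hab]
    exact continuousOn_parametric_integral (f := fun s t => G s t * (P s t * (1 + |Fs s t|))) cI 0 1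
  have h2 : ∫ s in a..b, ∫ t in (0 : ℝ)..1, G s t * (P s t * (1 + |Fs s t|)) ≤
      ∫ s in a..b, (kernelWeight c (s - s₀) + p s ^ 2 + 1 + f s) := by
    refine intervalIntegral.integral_mono_ae_restrict hab iI
      (((iw.add ip).add intervalIntegrable_const).add jf) ?_
    rw [EventuallyLE, ae_restrict_iff' measurableSet_Icc]
    filter_upwards [compl_mem_ae_iff.2 (measure_singleton (μ := volume) s₀)] with s hss hs
    exact h1 s hs hss
  refine h2.trans ?_
  rw [intervalIntegral.integral_add ((iw.add ip).add intervalIntegrable_const) jf,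
    intervalIntegral.integral_add (iw.add ip) intervalIntegrable_const,
    intervalIntegral.integral_add iw ip]
  have h6 := integral_kernelWeight_translate_le (c := c) hs₀ hℓ
  simp only [intervalIntegral.integral_const, smul_eq_mul, mul_one]
  linarith

/-- The left-hand side of the mean value inequality. -/
theorem le_integral_mul_laplacian (jF : CylJet I F Fs Ft Fss Ftt) (hI : Icc a b ⊆ I)
    (hF0 : ∀ s ∈ I, ∀ t, 0 ≤ F s t) {s₀ δ : ℝ} (hs₀ : a ≤ s₀) (hδ : 0 < δ) (hδ1 : δ ≤ 1)
    (hδb : s₀ + δ ≤ b) {f₀ : ℝ} (hf₀ : 0 ≤ f₀)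
    (hF : ∀ s ∈ Icc s₀ (s₀ + δ), ∀ t ∈ Icc 0 δ, f₀ ≤ F s t) {L : ℝ → ℝ → ℝ}
    (hLc : ContinuousOn (fun q : ℝ × ℝ => L q.1 q.2) (Icc a b ×ˢ univ)) (hL0 : ∀ s t, 0 ≤ L s t)
    (hL : ∀ s ∈ Icc s₀ (s₀ + δ), ∀ t ∈ Icc 0 δ, 1 / (1000 * δ ^ 2) ≤ L s t) :
    f₀ / 1000 ≤ ∫ s in a..b, ∫ t in (0 : ℝ)..1, F s t * L s t := by
  have hm : Icc a b ×ˢ (univ : Set ℝ) ⊆ I ×ˢ univ := prod_mono hI le_rfl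
  have hab : a ≤ b := by linarith
  have cI : ContinuousOn (fun q : ℝ × ℝ => F q.1 q.2 * L q.1 q.2) (Icc a b ×ˢ univ) :=
    (jF.cont.mono hm).mul hLc
  have hsub : Icc s₀ (s₀ + δ) ⊆ Icc a b := Icc_subset_Icc hs₀ hδb
  have h0 : ∀ s ∈ Icc a b, ∀ t, 0 ≤ F s t * L s t := fun s hs t =>
    mul_nonneg (hF0 s (hI hs) t) (hL0 s t)
  -- The square has area `δ²` and `L ≥ 1 / (1000 δ²)` on it, so the final bound does not depend on
  -- `δ`.
  have h1 : ∀ s ∈ Icc s₀ (s₀ + δ), f₀ / (1000 * δ) ≤ ∫ t in (0 : ℝ)..1, F s t * L s t := by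
    intro s hs
    have ci := continuousOn_snd_slice (f := fun s t => F s t * L s t) cI (hsub hs)
    have e1 : ∫ t in (0 : ℝ)..δ, F s t * L s t ≤ ∫ t in (0 : ℝ)..1, F s t * L s t :=
      intervalIntegral.integral_mono_interval le_rfl hδ.le hδ1 (ae_of_all _ fun t => h0 s (hsub hs) t)
        (ci.intervalIntegrable _ _)
    have e2 : ∫ _ in (0 : ℝ)..δ, f₀ * (1 / (1000 * δ ^ 2)) ≤ ∫ t in (0 : ℝ)..δ, F s t * L s t :=
      intervalIntegral.integral_mono_on hδ.le intervalIntegrable_const (ci.intervalIntegrable _ _)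
        fun t ht => mul_le_mul (hF s hs t ht) (hL s hs t ht) (by positivity) (hf₀.trans (hF s hs t ht))
    rw [intervalIntegral.integral_const, smul_eq_mul] at e2
    refine le_trans (le_of_eq ?_) (e2.trans e1)
    field_simp
    ring
  have ii : IntervalIntegrable (fun s => ∫ t in (0 : ℝ)..1, F s t * L s t) volume a b := by
    refine ContinuousOn.intervalIntegrable ?_
    rw [uIcc_of_le hab]
    exact continuousOn_parametric_integral (f := fun s t => F s t * L s t) cI 0 1
  have e1 : ∫ s in s₀..(s₀ + δ), (∫ t in (0 : ℝ)..1, F s t * L s t) ≤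
      ∫ s in a..b, ∫ t in (0 : ℝ)..1, F s t * L s t := by
    refine intervalIntegral.integral_mono_interval hs₀ (by linarith) hδb ?_ ii
    rw [EventuallyLE, ae_restrict_iff' measurableSet_Ioc]
    exact ae_of_all _ fun s hs => intervalIntegral.integral_nonneg zero_le_one
      fun t _ => h0 s (Ioc_subset_Icc_self hs) t
  have e2 := intervalIntegral.integral_mono_on (a := s₀) (b := s₀ + δ) (μ := volume) (by linarith)
    intervalIntegrable_const (ii.mono_set (by
      rw [uIcc_of_le (by linarith), uIcc_of_le hab]; exact hsub)) h1
  rw [intervalIntegral.integral_const, smul_eq_mul] at e2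
  refine le_trans (le_of_eq ?_) (e2.trans e1)
  field_simp
  ring

/-- A mean value inequality for functions whose Laplacian is bounded below. -/
theorem exists_pole_bound (ℓ ν C : ℝ) (hν : 0 ≤ ν) :
    ∃ B : ℝ, ∀ {I : Set ℝ} {F Fs Ft Fss Ftt P : ℝ → ℝ → ℝ} {a b : ℝ}, CylJet I F Fs Ft Fss Ftt →
      Icc a b ⊆ I → (∀ s ∈ I, ∀ t, 0 ≤ F s t) → (∀ t, F b t = 0) → (∀ t, -ν ≤ Fs a t) →
      ContinuousOn (fun q : ℝ × ℝ => P q.1 q.2) (Icc a b ×ˢ univ) →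
      (∀ s ∈ Icc a b, ∀ t, 0 ≤ P s t) →
      (∀ s ∈ Icc a b, ∀ t, -(P s t * (1 + |Fs s t|)) ≤ Fss s t + Ftt s t) →
      ∫ s in a..b, (∫ t in (0 : ℝ)..1, P s t ^ 2) ^ 2 ≤ C →
      ∫ s in a..b, ∫ t in (0 : ℝ)..1, Fs s t ^ 2 ≤ C → b - a ≤ ℓ →
      ∀ s₀ ∈ Ico a b, F s₀ 0 ≤ B := by
  set c := Real.log (Real.cosh (4 * Real.pi * ℓ) + 2) with hc
  have hc0 : 0 ≤ c := Real.log_nonneg (by linarith [Real.one_le_cosh (4 * Real.pi * ℓ)])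
  set K := ∫ t in (0 : ℝ)..1, (2 * c - 4 * Real.log (Real.sin (Real.pi * t))) with hK
  -- The factor is `2 · 1000`: half of the value at the pole persists on the small square, where the
  -- Laplacian of the kernel has mass at least `1 / 1000`.
  refine ⟨2000 * (ν * K + ((∫ y in (-ℓ)..ℓ, kernelWeight c y) + ℓ + 2 * C)), ?_⟩
  intro I F Fs Ft Fss Ftt P a b jF hI hF0 hFb hFa hPc hP0 hlap hPC hFC hℓ s₀ hs₀
  have hab : a < b := hs₀.1.trans_lt hs₀.2
  have hs₀' : s₀ ∈ Icc a b := ⟨hs₀.1, hs₀.2.le⟩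
  have hm : Icc a b ×ˢ (univ : Set ℝ) ⊆ I ×ˢ univ := prod_mono hI le_rfl
  -- a small square on which `F` is large
  obtain ⟨δ, hδ, hδ8, hδb, hδF⟩ : ∃ δ, 0 < δ ∧ δ ≤ 1 / 8 ∧ s₀ + δ ≤ b ∧
      ∀ s ∈ Icc s₀ (s₀ + δ), ∀ t ∈ Icc 0 δ, F s₀ 0 / 2 ≤ F s t := by
    rcases (hF0 s₀ (hI hs₀') 0).eq_or_lt with h0 | h0
    · refine ⟨min (1 / 8) (b - s₀), by have := hs₀.2; simp [this], min_le_left _ _,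
        by linarith [min_le_right (1 / 8) (b - s₀)], fun s hs t _ => ?_⟩
      rw [← h0, zero_div]
      exact hF0 s (hI ⟨hs₀.1.trans hs.1, by linarith [hs.2, min_le_right (1 / 8) (b - s₀)]⟩) t
    · have h1 : ContinuousAt (fun q : ℝ × ℝ => F q.1 q.2) (s₀, 0) :=
        jF.cont.continuousAt (prod_mem_nhds (jF.isOpen.mem_nhds (hI hs₀')) univ_mem)
      have h2 : ∀ᶠ q : ℝ × ℝ in 𝓝 (s₀, 0), F s₀ 0 / 2 < F q.1 q.2 :=
        h1.eventually (lt_mem_nhds (by simpa using h0))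
      obtain ⟨r, hr, hrF⟩ := Metric.eventually_nhds_iff.1 h2
      refine ⟨min (r / 2) (min (1 / 8) (b - s₀)), by have := hs₀.2; simp [this, hr],
        (min_le_right _ _).trans (min_le_left _ _),
        by linarith [(min_le_right (r / 2) (min (1 / 8) (b - s₀))).trans (min_le_right _ _)],
        fun s hs t ht => (hrF (y := (s, t)) ?_).le⟩
      have h3 := min_le_left (r / 2) (min (1 / 8) (b - s₀))
      rw [Prod.dist_eq, max_lt_iff, Real.dist_eq, Real.dist_eq, abs_lt, abs_lt]
      refine ⟨⟨?_, ?_⟩, ?_, ?_⟩ <;> simp only <;> linarith [hs.1, hs.2, ht.1, ht.2]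
  -- The regularization `ε = δ²` depends on `F` through `δ`, but the upper bounds for `-G` do not
  -- depend on `ε`, so the final constant does not see it.
  obtain ⟨G, Gs, Gt, Gss, Gtt, jG, hG0, hGa, hGlap, hGu, hGua, hGl⟩ :=
    exists_neumann_kernel (ε := δ ^ 2) hs₀' hℓ (by positivity) (by nlinarith)
  have jG' : CylJet I G Gs Gt Gss Gtt :=
    { isOpen := jF.isOpen
      fst := fun s _ => jG.fst s (mem_univ _)
      snd := fun s _ => jG.snd s (mem_univ _)
      fst_fst := fun s _ => jG.fst_fst s (mem_univ _)
      snd_snd := fun s _ => jG.snd_snd s (mem_univ _)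
      cont := jG.cont.mono (prod_mono (subset_univ _) le_rfl)
      cont_fst := jG.cont_fst.mono (prod_mono (subset_univ _) le_rfl)
      cont_snd := jG.cont_snd.mono (prod_mono (subset_univ _) le_rfl)
      cont_fst_fst := jG.cont_fst_fst.mono (prod_mono (subset_univ _) le_rfl)
      cont_snd_snd := jG.cont_snd_snd.mono (prod_mono (subset_univ _) le_rfl)
      periodic := fun s _ => jG.periodic s (mem_univ _) }
  have cGl : ContinuousOn (fun q : ℝ × ℝ => Gss q.1 q.2 + Gtt q.1 q.2) (Icc a b ×ˢ univ) :=
    (jG'.cont_fst_fst.add jG'.cont_snd_snd).mono hm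
  have cFl : ContinuousOn (fun q : ℝ × ℝ => Fss q.1 q.2 + Ftt q.1 q.2) (Icc a b ×ˢ univ) :=
    (jF.cont_fst_fst.add jF.cont_snd_snd).mono hm
  have cG := jG'.cont.mono hm
  have cF := jF.cont.mono hm
  have hgreen := jF.green jG' hab.le hI
  -- the boundary terms
  have hb : ∫ t in (0 : ℝ)..1, (F b t * Gs b t - G b t * Fs b t) = 0 := by
    rw [intervalIntegral.integral_congr (g := fun _ => 0) fun t _ => ?_]
    · simp
    · simp only [hFb t, jF.fst_eq_zero hF0 (hI (right_mem_Icc.2 hab.le)) (hFb t)]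
      ring
  have haS := left_mem_Icc.2 hab.le
  -- The Neumann condition removes the term containing `F` itself, for which there is no bound at `s
  -- = a`. The other term is estimated by `G ≤ 0` and `Fs ≥ -ν`.
  have ha : -(∫ t in (0 : ℝ)..1, (F a t * Gs a t - G a t * Fs a t)) ≤ ν * K := by
    rw [← intervalIntegral.integral_neg, hK, ← intervalIntegral.integral_const_mul]
    refine intervalIntegral.integral_mono_on_of_le_Ioo zero_le_one ?_ ?_ fun t ht => ?_
    · have c1 : ContinuousOn (fun q : ℝ × ℝ => F q.1 q.2 * Gs q.1 q.2 - G q.1 q.2 * Fs q.1 q.2)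
        (Icc a b ×ˢ univ) := (cF.mul (jG'.cont_fst.mono hm)).sub (cG.mul (jF.cont_fst.mono hm))
      exact ((continuousOn_snd_slice (f := fun s t => F s t * Gs s t - G s t * Fs s t) c1
        haS).neg).intervalIntegrable _ _
    · exact ((intervalIntegrable_const.sub ((intervalIntegrable_log_sin_pi 0 1).const_mul 4))).const_mul ν
    · rw [hGa t, mul_zero, zero_sub, neg_neg]
      have e1 := hG0 a haS t
      have e2 := hGua t ht
      have e3 := hFa t
      calc G a t * Fs a t ≤ ν * -G a t := by nlinarith
        _ ≤ _ := mul_le_mul_of_nonneg_left e2 hν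
  -- splitting the left-hand side of Green's identity
  have cFG : ContinuousOn (fun q : ℝ × ℝ => F q.1 q.2 * (Gss q.1 q.2 + Gtt q.1 q.2)) (Icc a b ×ˢ univ) :=
    cF.mul cGl
  have cGF : ContinuousOn (fun q : ℝ × ℝ => G q.1 q.2 * (Fss q.1 q.2 + Ftt q.1 q.2)) (Icc a b ×ˢ univ) :=
    cG.mul cFl
  have cGP : ContinuousOn (fun q : ℝ × ℝ => -G q.1 q.2 * (P q.1 q.2 * (1 + |Fs q.1 q.2|)))
      (Icc a b ×ˢ univ) := cG.neg.mul (hPc.mul (continuousOn_const.add (jF.cont_fst.mono hm).abs))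
  have i1 : IntervalIntegrable (fun s => ∫ t in (0 : ℝ)..1, F s t * (Gss s t + Gtt s t)) volume a b := by
    refine ContinuousOn.intervalIntegrable ?_
    rw [uIcc_of_le hab.le]
    exact continuousOn_parametric_integral (f := fun s t => F s t * (Gss s t + Gtt s t)) cFG 0 1
  have i2 : IntervalIntegrable (fun s => ∫ t in (0 : ℝ)..1, G s t * (Fss s t + Ftt s t)) volume a b := by
    refine ContinuousOn.intervalIntegrable ?_
    rw [uIcc_of_le hab.le]
    exact continuousOn_parametric_integral (f := fun s t => G s t * (Fss s t + Ftt s t)) cGF 0 1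
  have i3 : IntervalIntegrable (fun s => ∫ t in (0 : ℝ)..1, -G s t * (P s t * (1 + |Fs s t|)))
      volume a b := by
    refine ContinuousOn.intervalIntegrable ?_
    rw [uIcc_of_le hab.le]
    exact continuousOn_parametric_integral (f := fun s t => -G s t * (P s t * (1 + |Fs s t|))) cGP 0 1
  have hsplit : ∫ s in a..b, ∫ t in (0 : ℝ)..1,
        (F s t * (Gss s t + Gtt s t) - G s t * (Fss s t + Ftt s t)) =
      (∫ s in a..b, ∫ t in (0 : ℝ)..1, F s t * (Gss s t + Gtt s t)) -
        ∫ s in a..b, ∫ t in (0 : ℝ)..1, G s t * (Fss s t + Ftt s t) := by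
    rw [← intervalIntegral.integral_sub i1 i2]
    refine intervalIntegral.integral_congr fun s hs => ?_
    rw [uIcc_of_le hab.le] at hs
    exact intervalIntegral.integral_sub
      ((continuousOn_snd_slice (f := fun s t => F s t * (Gss s t + Gtt s t)) cFG hs).intervalIntegrable _ _)
      ((continuousOn_snd_slice (f := fun s t => G s t * (Fss s t + Ftt s t)) cGF hs).intervalIntegrable _ _)
  have hGF : ∫ s in a..b, ∫ t in (0 : ℝ)..1, G s t * (Fss s t + Ftt s t) ≤
      ∫ s in a..b, ∫ t in (0 : ℝ)..1, -G s t * (P s t * (1 + |Fs s t|)) := by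
    refine intervalIntegral.integral_mono_on hab.le i2 i3 fun s hs => ?_
    refine intervalIntegral.integral_mono_on zero_le_one
      ((continuousOn_snd_slice (f := fun s t => G s t * (Fss s t + Ftt s t)) cGF hs).intervalIntegrable _ _)
      ((continuousOn_snd_slice (f := fun s t => -G s t * (P s t * (1 + |Fs s t|))) cGP
        hs).intervalIntegrable _ _) fun t _ => ?_
    nlinarith [hG0 s hs t, hlap s hs t]
  have hup := jF.integral_kernel_mul_le hab.le hI hPc hP0 (c := c) hℓ hs₀' hPC hFC (G := fun s t => -G s t)
    cG.neg hGu hc0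
  have hlow := jF.le_integral_mul_laplacian hI hF0 hs₀.1 hδ (by linarith) hδb
    (div_nonneg (hF0 s₀ (hI hs₀') 0) zero_le_two) hδF (L := fun s t => Gss s t + Gtt s t) cGl hGlap
    (hGl δ hδ hδ8 rfl)
  rw [hsplit, hb] at hgreen
  linarith

/-- A uniform bound for functions whose Laplacian is bounded below. -/
theorem exists_uniform_bound (ℓ ν C : ℝ) (hν : 0 ≤ ν) :
    ∃ B : ℝ, ∀ {I : Set ℝ} {F Fs Ft Fss Ftt P : ℝ → ℝ → ℝ} {a b : ℝ}, CylJet I F Fs Ft Fss Ftt →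
      Icc a b ⊆ I → (∀ s ∈ I, ∀ t, 0 ≤ F s t) → (∀ t, F b t = 0) → (∀ t, -ν ≤ Fs a t) →
      ContinuousOn (fun q : ℝ × ℝ => P q.1 q.2) (Icc a b ×ˢ univ) →
      (∀ s ∈ Icc a b, ∀ t, 0 ≤ P s t) → (∀ s ∈ Icc a b, ∀ t, P s (t + 1) = P s t) →
      (∀ s ∈ Icc a b, ∀ t, -(P s t * (1 + |Fs s t|)) ≤ Fss s t + Ftt s t) →
      ∫ s in a..b, (∫ t in (0 : ℝ)..1, P s t ^ 2) ^ 2 ≤ C →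
      ∫ s in a..b, ∫ t in (0 : ℝ)..1, Fs s t ^ 2 ≤ C → b - a ≤ ℓ →
      ∀ s₀ ∈ Ico a b, ∀ t₀, F s₀ t₀ ≤ B := by
  obtain ⟨B, hB⟩ := exists_pole_bound ℓ ν C hν
  refine ⟨B, ?_⟩
  intro I F Fs Ft Fss Ftt P a b jF hI hF0 hFb hFa hPc hP0 hPp hlap hPC hFC hℓ s₀ hs₀ t₀
  have hab : a < b := hs₀.1.trans_lt hs₀.2
  -- A rotation moves the pole to `t = 0`; periodicity leaves the integral hypotheses unchanged.
  have j := jF.translate 0 t₀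
  simp only [add_zero] at j
  have hper : ∀ f : ℝ → ℝ, (∀ t, f (t + 1) = f t) →
      ∫ t in (0 : ℝ)..1, f (t + t₀) = ∫ t in (0 : ℝ)..1, f t := by
    intro f hf
    have h1 : Function.Periodic f 1 := hf
    rw [intervalIntegral.integral_comp_add_right]
    have h2 := h1.intervalIntegral_add_eq t₀ 0
    simp only [zero_add] at h2 ⊢
    rwa [add_comm 1 t₀]
  have h1 := hB (P := fun s t => P s (t + t₀)) j hI (fun s hs t => hF0 s hs _) (fun t => hFb _)
    (fun t => hFa _)
    (hPc.comp (f := fun q : ℝ × ℝ => (q.1, q.2 + t₀)) (by fun_prop) fun q hq => ⟨hq.1, mem_univ _⟩)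
    (fun s hs t => hP0 s hs _) (fun s hs t => hlap s hs _) ?_ ?_ hℓ s₀ hs₀
  · rwa [zero_add] at h1
  · refine le_trans (le_of_eq ?_) hPC
    refine intervalIntegral.integral_congr fun s hs => ?_
    rw [uIcc_of_le hab.le] at hs
    rw [hper (fun t => P s t ^ 2) fun t => by simp only [hPp s hs t]]
  · refine le_trans (le_of_eq ?_) hFC
    refine intervalIntegral.integral_congr fun s hs => ?_
    rw [uIcc_of_le hab.le] at hs
    exact hper (fun t => Fs s t ^ 2) fun t => by simp only [jF.periodic_fst (hI hs) t]

end CylJet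
end RabinowitzFloer

/-! ### Bounds on a half-cylinder -/

namespace RabinowitzFloer
/-- Monotonicity of integrals over a rectangle. -/
theorem integral_integral_mono {f g : ℝ → ℝ → ℝ} {a b : ℝ} (hab : a ≤ b)
    (hf : ContinuousOn (fun q : ℝ × ℝ => f q.1 q.2) (Icc a b ×ˢ univ))
    (hg : ContinuousOn (fun q : ℝ × ℝ => g q.1 q.2) (Icc a b ×ˢ univ))
    (hfg : ∀ s ∈ Icc a b, ∀ t, f s t ≤ g s t) :
    ∫ s in a..b, ∫ t in (0 : ℝ)..1, f s t ≤ ∫ s in a..b, ∫ t in (0 : ℝ)..1, g s t := by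
  have hi : ∀ {k : ℝ → ℝ → ℝ}, ContinuousOn (fun q : ℝ × ℝ => k q.1 q.2) (Icc a b ×ˢ univ) →
      IntervalIntegrable (fun s => ∫ t in (0 : ℝ)..1, k s t) volume a b := by
    intro k hk
    refine ContinuousOn.intervalIntegrable ?_
    rw [uIcc_of_le hab]
    exact continuousOn_parametric_integral hk 0 1
  exact intervalIntegral.integral_mono_on hab (hi hf) (hi hg) fun s hs =>
    intervalIntegral.integral_mono_on zero_le_one ((continuousOn_snd_slice hf hs).intervalIntegrable _ _)
      ((continuousOn_snd_slice hg hs).intervalIntegrable _ _) fun t _ => hfg s hs t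

namespace CylJet

/-- A uniform bound on a half-cylinder, for a function which vanishes frequently. -/
theorem exists_halfLine_bound {L ν : ℝ} (hν : 0 ≤ ν) (E C : ℝ) :
    ∃ B : ℝ, 0 ≤ B ∧ ∀ {F Fs Ft Fss Ftt P : ℝ → ℝ → ℝ}, CylJet (Ioi 0) F Fs Ft Fss Ftt →
      (∀ s, 0 < s → ∀ t, 0 ≤ F s t) →
      (∀ a b, 0 < a → a ≤ b →
        ∫ s in a..b, ∫ t in (0 : ℝ)..1, Real.exp (F s t) * (Fs s t ^ 2 + Ft s t ^ 2) ≤ E) →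
      ContinuousOn (fun q : ℝ × ℝ => P q.1 q.2) (Ioi 0 ×ˢ univ) →
      (∀ s, 0 < s → ∀ t, 0 ≤ P s t) → (∀ s, 0 < s → ∀ t, P s (t + 1) = P s t) →
      (∀ s, 0 < s → ∀ t, -(P s t * (1 + |Fs s t|)) ≤ Fss s t + Ftt s t) →
      (∀ a b, 0 < a → a ≤ b → b - a ≤ 2 * L → (∀ t, F b t = 0) →
        ∫ s in a..b, (∫ t in (0 : ℝ)..1, P s t ^ 2) ^ 2 ≤ C) →
      (∀ s, 0 < s → ∃ b ∈ Icc s (s + L), ∀ t, F b t = 0) →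
      (∃ δ, 0 < δ ∧ ∀ s, 0 < s → s < δ → ∀ t, -ν ≤ Fs s t) →
      ∀ s, 0 < s → ∀ t, F s t ≤ B := by
  obtain ⟨B, hB⟩ := exists_uniform_bound (2 * L) ν (max C E) hν
  refine ⟨max B 0, le_max_right _ _, ?_⟩
  rintro F Fs Ft Fss Ftt P jF hF0 hE hPc hP0 hPp hlap hPC hgood ⟨δ, hδ, hδF⟩ s hs t
  obtain ⟨b, hb, hFb⟩ := hgood s hs
  rcases hb.1.eq_or_lt with rfl | hsb
  · rw [hFb t]
    exact le_max_right _ _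
  -- The left end is an earlier slice on which `F` vanishes, where also `Fs = 0`. If `s ≤ L` no such
  -- slice need exist, and a slice close to the boundary is taken instead; it cannot be `s = 0`,
  -- since the derivatives are given on the open half-line.
  obtain ⟨a, ha0, has, hba, hFa⟩ : ∃ a, 0 < a ∧ a ≤ s ∧ b - a ≤ 2 * L ∧ ∀ t, -ν ≤ Fs a t := by
    rcases lt_or_ge L s with h | h
    · obtain ⟨a, ha, hFa⟩ := hgood (s - L) (by linarith)
      have ha0 : 0 < a := by linarith [ha.1]
      refine ⟨a, ha0, by linarith [ha.2], by linarith [ha.1, hb.2], fun t => ?_⟩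
      rw [jF.fst_eq_zero (fun s hs => hF0 s hs) ha0 (hFa t)]
      linarith
    · refine ⟨min s (δ / 2), by positivity, min_le_left _ _, ?_, fun t => ?_⟩
      · have : 0 < min s (δ / 2) := by positivity
        linarith [hb.2]
      · exact hδF _ (by positivity) ((min_le_right _ _).trans_lt (by linarith)) t
  have hab : a ≤ b := has.trans hsb.le
  have hI : Icc a b ⊆ Ioi 0 := fun x hx => ha0.trans_le hx.1
  have hm : Icc a b ×ˢ (univ : Set ℝ) ⊆ Ioi 0 ×ˢ univ := prod_mono hI le_rfl
  have hFs : ∫ s in a..b, ∫ t in (0 : ℝ)..1, Fs s t ^ 2 ≤ E := by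
    refine (integral_integral_mono hab ((jF.cont_fst.mono hm).pow 2)
      ((jF.cont.mono hm).rexp.mul (((jF.cont_fst.mono hm).pow 2).add ((jF.cont_snd.mono hm).pow 2)))
      (g := fun s t => Real.exp (F s t) * (Fs s t ^ 2 + Ft s t ^ 2)) fun s hs t => ?_).trans (hE a b ha0 hab)
    have h1 : 1 ≤ Real.exp (F s t) := Real.one_le_exp (hF0 s (hI hs) t)
    nlinarith [sq_nonneg (Fs s t), sq_nonneg (Ft s t)]
  exact (hB jF hI (fun s hs => hF0 s hs) hFb hFa (hPc.mono hm) (fun s hs => hP0 s (hI hs))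
    (fun s hs => hPp s (hI hs)) (fun s hs => hlap s (hI hs))
    ((hPC a b ha0 hab hba hFb).trans (le_max_left _ _)) (hFs.trans (le_max_right _ _)) hba s ⟨has, hsb⟩
    t).trans (le_max_left _ _)

theorem sq_integral_le {f : ℝ → ℝ} (hf : Continuous f) :
    (∫ t in (0 : ℝ)..1, f t) ^ 2 ≤ ∫ t in (0 : ℝ)..1, f t ^ 2 := by
  set c := ∫ t in (0 : ℝ)..1, f t with hc
  have h1 : ∫ t in (0 : ℝ)..1, (2 * c * f t - c ^ 2) ≤ ∫ t in (0 : ℝ)..1, f t ^ 2 :=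
    intervalIntegral.integral_mono_on zero_le_one
      (((continuous_const.mul hf).sub continuous_const).intervalIntegrable _ _)
      ((hf.pow 2).intervalIntegrable _ _) fun t _ => by nlinarith [sq_nonneg (f t - c)]
  rw [intervalIntegral.integral_sub ((hf.intervalIntegrable _ _).const_mul _) intervalIntegrable_const,
    intervalIntegral.integral_const_mul, ← hc, intervalIntegral.integral_const] at h1
  simp only [sub_zero, one_smul] at h1
  nlinarith

/-- The weight in the case of polynomial growth. -/
theorem exists_exp_weight_bound (ℓ E c : ℝ) (k : ℕ) :
    ∃ C : ℝ, ∀ {I : Set ℝ} {F Fs Ft Fss Ftt : ℝ → ℝ → ℝ} {a b : ℝ}, CylJet I F Fs Ft Fss Ftt →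
      a ≤ b → Icc a b ⊆ I → (∀ t, F b t = 0) → b - a ≤ ℓ →
      ∫ s in a..b, ∫ t in (0 : ℝ)..1, Real.exp (F s t) * (Fs s t ^ 2 + Ft s t ^ 2) ≤ E →
      ∫ s in a..b, (∫ t in (0 : ℝ)..1, (c * Real.exp (k * F s t)) ^ 2) ^ 2 ≤ C := by
  -- The exponent `4k` comes from `(∫ P²)² ≤ ∫ P⁴` for `P = c e^{kF}`.
  obtain ⟨C, hC⟩ := exists_integral_exp_le ℓ E (4 * k)
  refine ⟨c ^ 4 * C, ?_⟩
  intro I F Fs Ft Fss Ftt a b jF hab hI hb hℓ hE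
  have hm : Icc a b ×ˢ (univ : Set ℝ) ⊆ I ×ˢ univ := prod_mono hI le_rfl
  have cF := jF.cont.mono hm
  have cexp : ContinuousOn (fun q : ℝ × ℝ => Real.exp ((4 * k : ℕ) * F q.1 q.2)) (Icc a b ×ˢ univ) :=
    (continuousOn_const.mul cF).rexp
  have cP : ContinuousOn (fun q : ℝ × ℝ => (c * Real.exp (k * F q.1 q.2)) ^ 2) (Icc a b ×ˢ univ) :=
    (continuousOn_const.mul (continuousOn_const.mul cF).rexp).pow 2
  have i1 : IntervalIntegrable (fun s => (∫ t in (0 : ℝ)..1, (c * Real.exp (k * F s t)) ^ 2) ^ 2)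
      volume a b := by
    refine ContinuousOn.intervalIntegrable ?_
    rw [uIcc_of_le hab]
    exact (continuousOn_parametric_integral (f := fun s t => (c * Real.exp (k * F s t)) ^ 2) cP 0 1).pow 2
  have i2 : IntervalIntegrable (fun s => ∫ t in (0 : ℝ)..1, Real.exp ((4 * k : ℕ) * F s t))
      volume a b := by
    refine ContinuousOn.intervalIntegrable ?_
    rw [uIcc_of_le hab]
    exact continuousOn_parametric_integral (f := fun s t => Real.exp ((4 * k : ℕ) * F s t)) cexp 0 1
  have h1 := intervalIntegral.integral_mono_on hab i1 (i2.const_mul (c ^ 4)) fun s hs => by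
    refine (sq_integral_le (continuousOn_snd_slice (f := fun s t => (c * Real.exp (k * F s t)) ^ 2) cP
      hs)).trans (le_of_eq ?_)
    rw [← intervalIntegral.integral_const_mul]
    refine intervalIntegral.integral_congr fun t _ => ?_
    rw [mul_pow, mul_pow, ← Real.exp_nat_mul, ← Real.exp_nat_mul, ← pow_mul]
    congr 2
    push_cast
    ring
  rw [intervalIntegral.integral_const_mul] at h1
  exact h1.trans (mul_le_mul_of_nonneg_left (hC jF hab hI hb hℓ hE) (by positivity))

end CylJet
end RabinowitzFloer

/-! ### Consequences of the energy bound along a solution -/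

namespace RabinowitzFloer
namespace LiouvilleCompletion

variable {n : ℕ}
  {M : Type*} [TopologicalSpace M] [ChartedSpace (EuclideanSpace ℝ (Fin (2 * n))) M]
  [IsManifold (𝓡 (2 * n)) ∞ M]
  {N : Type*} [TopologicalSpace N] [ChartedSpace (EuclideanSpace ℝ (Fin (2 * n - 1))) N]
  [IsManifold (𝓡 (2 * n - 1)) ∞ N]
  (D : LiouvilleCompletion n M N)
  {J : ℝ → ∀ p : M, TangentSpace (𝓡 (2 * n)) p →L[ℝ] TangentSpace (𝓡 (2 * n)) p}
  {S : Set ℝ} {H : ℝ → M → ℝ} {u : ℝ → ℝ → M} {η : ℝ → ℝ} {r₀ : ℝ} {h : ℝ → ℝ → ℝ}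

theorem IsSolution.contMDiff_slice (sol : D.IsSolution J S H u η) {s : ℝ} (hs : s ∈ S) :
    ContMDiff 𝓘(ℝ, ℝ) (𝓡 (2 * n)) ∞ (u s) := by
  rw [← contMDiffOn_univ]
  exact sol.u_smooth.comp (f := fun t : ℝ => (s, t))
    (contDiff_const.prodMk contDiff_id).contMDiff.contMDiffOn fun t _ => ⟨hs, mem_univ _⟩

theorem IsSolution.continuousOn_hamiltonian (hH : D.IsHamiltonianFamily S H r₀ h)
    (sol : D.IsSolution J S H u η) :
    ContinuousOn (fun q : ℝ × ℝ => H q.1 (u q.1 q.2)) (S ×ˢ univ) :=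
  hH.smooth.continuousOn.comp (f := fun q : ℝ × ℝ => (q.1, u q.1 q.2))
    (continuousOn_fst.prodMk sol.u_smooth.continuousOn) fun _ hq => ⟨hq.1, mem_univ _⟩

section Energy

variable (hJ : D.IsCompatibleLoop J) (hH : D.IsHamiltonianFamily S H r₀ h)
  (sol : D.IsSolution J S H u η) {c d : ℝ} (hcd : c ≤ d) (hI : Icc c d ⊆ interior S)
include hJ hH sol hcd hI

omit hcd in
theorem IsSolution.continuousOn_gradNormSq :
    ContinuousOn (fun s => ∫ t in (0 : ℝ)..1, D.defectSq J (H s) (u s) (η s) t) (Icc c d) ∧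
    ContinuousOn (fun s => ∫ t in (0 : ℝ)..1, H s (u s t)) (Icc c d) :=
  ⟨continuousOn_parametric_integral (f := fun s t => D.defectSq J (H s) (u s) (η s) t)
      ((sol.continuousOn_defectSq D hJ hH).mono (prod_mono hI le_rfl)) 0 1,
    continuousOn_parametric_integral (f := fun s t => H s (u s t))
      ((sol.continuousOn_hamiltonian D hH).mono (prod_mono (hI.trans interior_subset) le_rfl)) 0 1⟩

/-- The energy of a solution over a finite interval. -/
theorem IsSolution.energy_le {E : ℝ} (hE0 : 0 ≤ E) (hE : D.EnergyBound J S H u η E) :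
    (∫ s in c..d, ∫ t in (0 : ℝ)..1, D.defectSq J (H s) (u s) (η s) t) ≤ E ∧
      ∫ s in c..d, (∫ t in (0 : ℝ)..1, H s (u s t)) ^ 2 ≤ E ∧
      ∫ s in c..d, D.gradNormSq J (H s) (u s) (η s) ≤ E := by
  obtain ⟨c1, c2⟩ := sol.continuousOn_gradNormSq D hJ hH hI
  have c3 : ContinuousOn (fun s => D.gradNormSq J (H s) (u s) (η s)) (Icc c d) :=
    (c1.add (c2.pow 2)).congr fun s _ => hJ.gradNormSq_eq D (H s) (u s) (η s)
  have hpos : ∀ s ∈ Icc c d, 0 ≤ ∫ t in (0 : ℝ)..1, D.defectSq J (H s) (u s) (η s) t := fun s _ =>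
    intervalIntegral.integral_nonneg zero_le_one fun t _ => hJ.nonneg D t (u s t) _
  have i1 : IntervalIntegrable (fun s => ∫ t in (0 : ℝ)..1, D.defectSq J (H s) (u s) (η s) t)
      volume c d := by
    refine ContinuousOn.intervalIntegrable ?_
    rwa [uIcc_of_le hcd]
  have i2 : IntervalIntegrable (fun s => (∫ t in (0 : ℝ)..1, H s (u s t)) ^ 2) volume c d := by
    refine ContinuousOn.intervalIntegrable ?_
    rw [uIcc_of_le hcd]
    exact c2.pow 2
  have h1 : ∫ s in c..d, D.gradNormSq J (H s) (u s) (η s) ≤ E := by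
    rw [intervalIntegral.integral_of_le hcd]
    have h2 : IntegrableOn (fun s => D.gradNormSq J (H s) (u s) (η s)) (Ioc c d) :=
      (c3.integrableOn_Icc).mono_set Ioc_subset_Icc_self
    rw [← ENNReal.ofReal_le_ofReal_iff hE0, ofReal_integral_eq_lintegral_ofReal h2]
    · exact (lintegral_mono_set (Ioc_subset_Icc_self.trans (hI.trans interior_subset))).trans hE
    · rw [EventuallyLE, ae_restrict_iff' measurableSet_Ioc]
      refine ae_of_all _ fun s hs => ?_
      rw [hJ.gradNormSq_eq D (H s) (u s) (η s)]
      exact add_nonneg (hpos s (Ioc_subset_Icc_self hs)) (sq_nonneg _)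
  have h2 : ∫ s in c..d, D.gradNormSq J (H s) (u s) (η s) =
      (∫ s in c..d, ∫ t in (0 : ℝ)..1, D.defectSq J (H s) (u s) (η s) t) +
        ∫ s in c..d, (∫ t in (0 : ℝ)..1, H s (u s t)) ^ 2 := by
    rw [← intervalIntegral.integral_add i1 i2]
    exact intervalIntegral.integral_congr fun s _ => hJ.gradNormSq_eq D (H s) (u s) (η s)
  have h3 := intervalIntegral.integral_nonneg (μ := volume) hcd hpos
  have h4 : 0 ≤ ∫ s in c..d, (∫ t in (0 : ℝ)..1, H s (u s t)) ^ 2 :=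
    intervalIntegral.integral_nonneg hcd fun s _ => sq_nonneg _
  exact ⟨by linarith, by linarith, h1⟩

/-- On a long interval the gradient is small somewhere. -/
theorem IsSolution.exists_small_gradient {E ε : ℝ} (hE0 : 0 ≤ E) (hE : D.EnergyBound J S H u η E)
    (hε : 0 < ε) (hlen : E / ε ^ 2 < d - c) :
    ∃ s ∈ Icc c d, D.gradNormSq J (H s) (u s) (η s) < ε ^ 2 := by
  by_contra! hcon
  obtain ⟨c1, c2⟩ := sol.continuousOn_gradNormSq D hJ hH hI
  have c3 : ContinuousOn (fun s => D.gradNormSq J (H s) (u s) (η s)) (Icc c d) :=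
    (c1.add (c2.pow 2)).congr fun s _ => hJ.gradNormSq_eq D (H s) (u s) (η s)
  have h1 := intervalIntegral.integral_mono_on (μ := volume) hcd intervalIntegrable_const
    (ContinuousOn.intervalIntegrable (by rwa [uIcc_of_le hcd])) hcon
  rw [intervalIntegral.integral_const, smul_eq_mul] at h1
  have h2 := (sol.energy_le D hJ hH hcd hI hE0 hE).2.2
  rw [div_lt_iff₀ (by positivity)] at hlen
  linarith

/-- Oscillation of the multiplier. -/
theorem IsSolution.abs_sub_le {E : ℝ} (hE0 : 0 ≤ E) (hE : D.EnergyBound J S H u η E) {x y : ℝ}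
    (hx : x ∈ Icc c d) (hy : y ∈ Icc c d) : |η x - η y| ≤ (d - c + E) / 2 := by
  obtain ⟨-, c2⟩ := sol.continuousOn_gradNormSq D hJ hH hI
  have i2 : IntervalIntegrable (fun s => (∫ t in (0 : ℝ)..1, H s (u s t)) ^ 2) volume c d := by
    refine ContinuousOn.intervalIntegrable ?_
    rw [uIcc_of_le hcd]
    exact c2.pow 2
  -- `|η'| ≤ (1 + η'²) / 2`, and `η'²` is part of the square norm of the gradient.
  have h1 := abs_sub_le_integral (g := η) (g' := fun s => ∫ t in (0 : ℝ)..1, H s (u s t))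
    (B := fun s => (1 + (∫ t in (0 : ℝ)..1, H s (u s t)) ^ 2) / 2)
    (fun s hs => (sol.η_eq s (interior_subset (hI hs))).hasDerivAt
      (mem_interior_iff_mem_nhds.1 (hI hs))) c2
    (fun s _ => by
      nlinarith [sq_nonneg (|∫ t in (0 : ℝ)..1, H s (u s t)| - 1), sq_abs (∫ t in (0 : ℝ)..1, H s (u s t))])
    ((intervalIntegrable_const.add i2).div_const 2) hx hy
  rw [intervalIntegral.integral_div, intervalIntegral.integral_add intervalIntegrable_const i2,
    intervalIntegral.integral_const, smul_eq_mul, mul_one] at h1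
  have h2 := (sol.energy_le D hJ hH hcd hI hE0 hE).2.1
  linarith

end Energy

section Good

variable [T2Space M]

/-- Every sufficiently long interval contains a point at which the loop avoids the end; the
multiplier is uniformly bounded. -/
theorem IsHamiltonianFamily.exists_good (hJ : D.IsCompatibleLoop J) (hr₀ : 0 < r₀)
    (hS : S = Ici 0 ∨ S = Iic 0) (hH : D.IsHamiltonianFamily S H r₀ h) {μ : ℝ} (hμ : 0 < μ)
    (hhμ : ∀ s ∈ S, ∀ r, r₀ ≤ r → μ ≤ h s r) (A E : ℝ) (hE0 : 0 ≤ E) :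
    ∃ L C : ℝ, 0 < L ∧ 0 ≤ C ∧ ∀ (u : ℝ → ℝ → M) (η : ℝ → ℝ), D.IsSolution J S H u η →
      D.ActionBound S H u η A → D.EnergyBound J S H u η E →
      (∀ c, Icc c (c + L) ⊆ interior S → ∃ s ∈ Icc c (c + L), ∀ t, u s t ∉ D.cylEnd r₀) ∧
      ∀ s ∈ interior S, |η s| ≤ C := by
  obtain ⟨ε, C, hε, hgap⟩ := hH.exists_gradient_gap D hJ hr₀ hS hμ hhμ A
  -- The summand `1` makes the inequality required by `exists_small_gradient` strict.
  set L := E / ε ^ 2 + 1 with hL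
  have hL0 : 0 < L := by positivity
  refine ⟨L, |C| + (L + E) / 2, hL0, by positivity, fun u η sol hA hE => ?_⟩
  have hgood : ∀ c, Icc c (c + L) ⊆ interior S →
      ∃ s ∈ Icc c (c + L), |η s| ≤ C ∧ ∀ t, u s t ∉ D.cylEnd r₀ := by
    intro c hc
    obtain ⟨s, hs, hgs⟩ := sol.exists_small_gradient D hJ hH (by linarith) hc hE0 hE hε
      (by rw [hL]; linarith)
    have hcont : Continuous (D.defectSq J (H s) (u s) (η s)) :=
      continuousOn_snd_slice (f := fun s t => D.defectSq J (H s) (u s) (η s) t)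
        ((sol.continuousOn_defectSq D hJ hH).mono (prod_mono hc le_rfl)) hs
    obtain ⟨h1, h2⟩ := hgap s (interior_subset (hc hs)) (u s)
      (sol.contMDiff_slice D (interior_subset (hc hs))) (η s) (hcont.intervalIntegrable _ _)
      (hA s (interior_subset (hc hs))) hgs
    refine ⟨s, hs, h1, fun t => ?_⟩
    have hper : Function.Periodic (u s) 1 := sol.u_periodic s (interior_subset (hc hs))
    have h3 : u s t = u s (Int.fract t) := by
      have := hper.sub_int_mul_eq (x := t) ⌊t⌋
      rw [mul_one] at this
      rw [Int.fract, this]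
    rw [h3]
    exact h2 _ ⟨Int.fract_nonneg t, (Int.fract_lt_one t).le⟩
  refine ⟨fun c hc => ?_, fun s hs => ?_⟩
  · obtain ⟨s, hs, -, h⟩ := hgood c hc
    exact ⟨s, hs, h⟩
  -- The window extends from `s` away from zero, so that it stays in the interior of `S`.
  · obtain ⟨c, hsc, hc⟩ : ∃ c, s ∈ Icc c (c + L) ∧ Icc c (c + L) ⊆ interior S := by
      rcases hS with rfl | rfl
      · rw [interior_Ici] at hs ⊢
        exact ⟨s, ⟨le_rfl, by linarith⟩, fun x hx => lt_of_lt_of_le (mem_Ioi.1 hs) hx.1⟩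
      · rw [interior_Iic] at hs ⊢
        exact ⟨s - L, ⟨by linarith, by linarith⟩, fun x hx => lt_of_le_of_lt
          (by linarith [hx.2] : x ≤ s) (mem_Iio.1 hs)⟩
    obtain ⟨s', hs', h1, -⟩ := hgood c hc
    have h2 := sol.abs_sub_le D hJ hH (by linarith) hc hE0 hE hsc hs'
    have h3 : |η s| ≤ |η s - η s'| + |η s'| := by
      have := abs_add_le (η s - η s') (η s')
      rwa [sub_add_cancel] at this
    have h4 := le_abs_self C
    have h5 : c + L - c = L := by ring
    rw [h5] at h2
    linarith

end Good

end LiouvilleCompletion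
end RabinowitzFloer

/-! ### The weights provided by the growth conditions -/

namespace RabinowitzFloer

/-- `∂h/∂ρ` is smooth up to the boundary. -/
theorem contDiffOn_dRho_slice {S : Set ℝ} {r₀ : ℝ} {h : ℝ → ℝ → ℝ}
    (hh : ContDiffOn ℝ ∞ (fun q : ℝ × ℝ => h q.1 q.2) (S ×ˢ Ici r₀)) {s : ℝ} (hs : s ∈ S) :
    ContDiffOn ℝ ∞ (dRho r₀ h s) (Ici r₀) := by
  have h1 : ContDiffOn ℝ ∞ (h s) (Ici r₀) :=
    hh.comp (f := fun r : ℝ => (s, r)) (contDiff_const.prodMk contDiff_id).contDiffOn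
      fun r hr => ⟨hs, hr⟩
  exact h1.derivWithin (uniqueDiffOn_Ici r₀) (by simp)

/-- `∂h/∂ρ` is continuous up to the boundary. -/
theorem continuousOn_dRho {S : Set ℝ} (hS : S = Ici 0 ∨ S = Iic 0) {r₀ : ℝ} {h : ℝ → ℝ → ℝ}
    (hh : ContDiffOn ℝ ∞ (fun q : ℝ × ℝ => h q.1 q.2) (S ×ˢ Ici r₀)) :
    ContinuousOn (fun q : ℝ × ℝ => dRho r₀ h q.1 q.2) (S ×ˢ Ici r₀) := by
  have hU := (halfLine_uniqueDiffOn hS).prod (uniqueDiffOn_Ici r₀)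
  refine ((hh.continuousOn_fderivWithin hU (by simp)).clm_apply
    (continuousOn_const (c := ((0, 1) : ℝ × ℝ)))).congr fun q hq => ?_
  have h2 : HasFDerivWithinAt (fun q : ℝ × ℝ => h q.1 q.2) _ (S ×ˢ Ici r₀) (q.1, q.2) :=
    ((hh.differentiableOn (by simp)) q hq).hasFDerivWithinAt
  have h3 : HasDerivWithinAt (fun r : ℝ => (q.1, r)) (0, 1) (Ici r₀) q.2 :=
    ((hasDerivAt_const _ _).prodMk (hasDerivAt_id _)).hasDerivWithinAt
  have h4 := HasFDerivWithinAt.comp_hasDerivWithinAt (f := fun r : ℝ => (q.1, r)) q.2 h2 h3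
    fun r hr => ⟨hq.1, hr⟩
  exact HasDerivWithinAt.derivWithin h4 (uniqueDiffOn_Ici r₀ q.2 hq.2)

namespace LiouvilleCompletion

variable {n : ℕ}
  {M : Type*} [TopologicalSpace M] [ChartedSpace (EuclideanSpace ℝ (Fin (2 * n))) M]
  [IsManifold (𝓡 (2 * n)) ∞ M]
  {N : Type*} [TopologicalSpace N] [ChartedSpace (EuclideanSpace ℝ (Fin (2 * n - 1))) N]
  [IsManifold (𝓡 (2 * n - 1)) ∞ N]
  (D : LiouvilleCompletion n M N)
  {S : Set ℝ} {H : ℝ → M → ℝ} {r₀ : ℝ} {h : ℝ → ℝ → ℝ}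

/-- Stationarity for `|s| ≥ 1` is assumed of `H`, not of the profile `h`. It passes to `h` by
evaluation at a point of `N`, whence the non-emptiness. -/
theorem IsHamiltonianFamily.exists_dRho_le (hS : S = Ici 0 ∨ S = Iic 0)
    (hH : D.IsHamiltonianFamily S H r₀ h) :
    ∃ C : ℝ, 0 ≤ C ∧ (Nonempty N → ∀ s ∈ S, dRho r₀ h s r₀ ≤ C) := by
  obtain ⟨S₁, hS₁, hS₁c, hS₁e⟩ := hH.exists_compact D hS
  have h1 : ContinuousOn (fun s => dRho r₀ h s r₀) S₁ :=
    (continuousOn_dRho hS hH.profile_smooth).comp (f := fun s : ℝ => (s, r₀)) (by fun_prop)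
      fun s hs => ⟨hS₁ hs, self_mem_Ici⟩
  obtain ⟨C, hC⟩ := hS₁c.exists_bound_of_continuousOn h1
  refine ⟨|C|, abs_nonneg _, ?_⟩
  rintro ⟨x⟩ s hs
  obtain ⟨s', hs', he⟩ := hS₁e s hs
  have h2 : dRho r₀ h s r₀ = dRho r₀ h s' r₀ := by
    have h3 : EqOn (h s) (h s') (Ici r₀) := fun r hr => by
      rw [← hH.radial s hs x r hr, ← hH.radial s' (hS₁ hs') x r hr, he]
    exact derivWithin_congr h3 (h3 self_mem_Ici)
  rw [h2]
  exact (le_abs_self _).trans ((hC s' hs').trans (le_abs_self C))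

/-- The coefficients in the differential inequality for the height grow at most exponentially. -/
theorem IsHamiltonianFamily.exists_exp_weight (hS : S = Ici 0 ∨ S = Iic 0) (hr₀ : 0 < r₀)
    (hH : D.IsHamiltonianFamily S H r₀ h) (hg : PolynomialGrowth S r₀ h) {m C a : ℝ} (hm : 0 ≤ m)
    (hC : 0 ≤ C) (ha : 0 ≤ a) :
    ∃ (c : ℝ) (k : ℕ), 0 ≤ c ∧ ∀ s ∈ S, ∀ w ∈ D.openEnd r₀,
      m * dRho r₀ h s (D.radius w) + C * |dSRho S r₀ h s (D.radius w)| ≤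
        c * Real.exp (k * D.exhaustion a w) ∧
      C * (D.radius w * |dRhoRho r₀ h s (D.radius w)|) ≤ c * Real.exp (k * D.exhaustion a w) := by
  obtain ⟨κ, γ, hκ, hγ, hg⟩ := hg
  obtain ⟨C₀, hC₀, hdC₀⟩ := hH.exists_dRho_le D hS
  obtain ⟨k, hk⟩ := exists_nat_ge (γ + 1)
  refine ⟨(m * (C₀ + κ) + C * κ) * Real.exp ((γ + 1) * (a + 1)), k, by positivity, fun s hs w hw => ?_⟩
  set r := D.radius w with hr
  set x := D.exhaustion a w with hx
  have hr0 : 0 < r := D.radius_pos hw.1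
  have hx0 : 0 ≤ x := D.exhaustion_nonneg a w
  have hlog : Real.log r ≤ x + a + 1 := D.log_radius_le hw.1
  have hrr : r₀ ≤ r := hw.2.le
  obtain ⟨h1, -, h3, h4⟩ := hg s hs r hrr
  set Q := Real.exp ((γ + 1) * (a + 1)) * Real.exp (k * x) with hQ
  -- Since `ρ ≤ e^{F + a + 1}`, powers of `ρ` with exponent up to `γ + 1` become exponentials of the
  -- height, and `k ≥ γ + 1`.
  have hpow : ∀ δ, 0 ≤ δ → δ ≤ γ + 1 → r ^ δ ≤ Q := by
    intro δ hδ0 hδ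
    rw [Real.rpow_def_of_pos hr0, hQ, ← Real.exp_add, Real.exp_le_exp]
    calc Real.log r * δ ≤ (x + a + 1) * δ := by gcongr
      _ ≤ (x + a + 1) * (γ + 1) := by gcongr
      _ = (γ + 1) * (a + 1) + (γ + 1) * x := by ring
      _ ≤ _ := by gcongr
  have hQ1 : 1 ≤ Q := by
    have := hpow 0 le_rfl (by linarith)
    rwa [Real.rpow_zero] at this
  have hQγ : r ^ γ ≤ Q := hpow γ hγ.le (by linarith)
  have hQγ1 : r * r ^ γ ≤ Q := by
    have := hpow (γ + 1) (by linarith) le_rfl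
    rwa [Real.rpow_add hr0, Real.rpow_one, mul_comm] at this
  -- Polynomial growth includes no upper bound on `∂_ρ h`; one is obtained from its value at `r₀`
  -- and the bound on `∂²_ρ h`, at the cost of one more power of `ρ`.
  have hd : dRho r₀ h s r ≤ C₀ + κ * Q := by
    have hdiff := contDiffOn_dRho_slice hH.profile_smooth hs
    have h5 := Convex.norm_image_sub_le_of_norm_hasDerivWithin_le (f := dRho r₀ h s)
      (f' := dRhoRho r₀ h s) (s := Icc r₀ r) (C := κ * r ^ γ) (x := r₀) (y := r)
      (fun y hy => (((hdiff.differentiableOn (by simp)) y hy.1).hasDerivWithinAt).mono Icc_subset_Ici_self)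
      (fun y hy => by
        rw [Real.norm_eq_abs]
        refine ((hg s hs y hy.1).2.2.1).trans ?_
        have : 0 < y := hr₀.trans_le hy.1
        gcongr
        exact hy.2) (convex_Icc _ _) (left_mem_Icc.2 hrr) (right_mem_Icc.2 hrr)
    rw [Real.norm_eq_abs, Real.norm_eq_abs, abs_of_nonneg (sub_nonneg.2 hrr)] at h5
    have h6 := hdC₀ ⟨(D.cyl.symm w).1⟩ s hs
    have h7 : κ * r ^ γ * (r - r₀) ≤ κ * Q := by
      calc κ * r ^ γ * (r - r₀) ≤ κ * r ^ γ * r := by gcongr; linarith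
        _ = κ * (r * r ^ γ) := by ring
        _ ≤ κ * Q := by gcongr
    linarith [le_abs_self (dRho r₀ h s r - dRho r₀ h s r₀)]
  have e1 : m * dRho r₀ h s r ≤ m * (C₀ + κ) * Q := by
    calc m * dRho r₀ h s r ≤ m * (C₀ * Q + κ * Q) := by
          gcongr
          refine hd.trans ?_
          gcongr
          exact le_mul_of_one_le_right hC₀ hQ1
      _ = _ := by ring
  have e2 : C * |dSRho S r₀ h s r| ≤ C * κ * Q := by
    rw [mul_assoc]
    gcongr
    exact h4.trans (by gcongr)
  have e3 : C * (r * |dRhoRho r₀ h s r|) ≤ C * κ * Q := by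
    rw [mul_assoc C κ]
    refine mul_le_mul_of_nonneg_left ?_ hC
    calc r * |dRhoRho r₀ h s r| ≤ r * (κ * r ^ γ) := by gcongr
      _ = κ * (r * r ^ γ) := by ring
      _ ≤ κ * Q := by gcongr
  have e4 : 0 ≤ m * (C₀ + κ) * Q := by positivity
  have e5 : (m * (C₀ + κ) + C * κ) * Real.exp ((γ + 1) * (a + 1)) * Real.exp (k * x) =
    m * (C₀ + κ) * Q + C * κ * Q := by rw [hQ]; ring
  rw [e5]
  exact ⟨by linarith, by linarith⟩

/-- The coefficients in the differential inequality for the height are controlled by the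
Hamiltonian. -/
theorem IsHamiltonianFamily.exists_sqrt_weight (hr₀ : 0 < r₀)
    (hH : D.IsHamiltonianFamily S H r₀ h) (hg : QuadraticGrowth S r₀ h) {m C : ℝ} (hm : 0 ≤ m)
    (hC : 0 ≤ C) :
    ∃ κ : ℝ, 0 ≤ κ ∧ ∀ s ∈ S, ∀ w ∈ D.openEnd r₀,
      m * dRho r₀ h s (D.radius w) + C * |dSRho S r₀ h s (D.radius w)| ≤
        κ * √(H s w + m + 1) ∧
      C * (D.radius w * |dRhoRho r₀ h s (D.radius w)|) ≤ κ * √(H s w + m + 1) := by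
  obtain ⟨-, κ, hκ, hg⟩ := hg
  refine ⟨(m + C) * √κ, by positivity, fun s hs w hw => ?_⟩
  have hr0 : 0 < D.radius w := D.radius_pos hw.1
  obtain ⟨h1, h2, h3, h4⟩ := hg s hs _ hw.2.le
  rw [← D.radial_of_mem hr₀ hH hs (D.openEnd_subset hr₀ hw)] at h2 h3 h4
  have h5 : κ * (H s w + 1) ≤ κ * (H s w + m + 1) := by gcongr; linarith
  have h6 : ∀ x : ℝ, 0 ≤ x → x ^ 2 ≤ κ * (H s w + 1) → x ≤ √κ * √(H s w + m + 1) := by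
    intro x hx hxx
    rw [← Real.sqrt_mul hκ.le]
    exact Real.le_sqrt_of_sq_le (hxx.trans h5)
  have e1 := h6 _ (abs_nonneg _) h2
  have e2 := h6 _ (abs_nonneg _) h4
  have e3 := h6 (D.radius w * |dRhoRho r₀ h s (D.radius w)|) (by positivity) (by rwa [mul_pow])
  rw [abs_of_nonneg h1] at e1
  set q := √κ * √(H s w + m + 1)
  have e4 : (m + C) * √κ * √(H s w + m + 1) = m * q + C * q := by simp only [q]; ring
  rw [e4]
  have hq : 0 ≤ q := by positivity
  refine ⟨by gcongr, ?_⟩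
  calc _ ≤ C * q := by gcongr
    _ ≤ _ := le_add_of_nonneg_left (by positivity)

end LiouvilleCompletion
end RabinowitzFloer

/-! ### Both half-lines at once, in the variable `τ = |s|` -/

namespace RabinowitzFloer

theorem eq_fract_of_periodic {X : Type*} {f : ℝ → X} (hf : ∀ t, f (t + 1) = f t) (t : ℝ) :
    f t = f (Int.fract t) := by
  have h1 : Function.Periodic f 1 := hf
  have := h1.sub_int_mul_eq (x := t) ⌊t⌋
  rw [mul_one] at this
  rw [Int.fract, this]

section Sign

variable {S : Set ℝ} {σ : ℝ} (hS : S = Ici 0 ∧ σ = 1 ∨ S = Iic 0 ∧ σ = -1)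
include hS

theorem sign_halfLine : S = Ici 0 ∨ S = Iic 0 := by
  rcases hS with ⟨rfl, -⟩ | ⟨rfl, -⟩
  exacts [Or.inl rfl, Or.inr rfl]

theorem sign_sq : σ ^ 2 = 1 := by
  rcases hS with ⟨-, rfl⟩ | ⟨-, rfl⟩ <;> norm_num

theorem sign_abs : |σ| = 1 := by
  rcases hS with ⟨-, rfl⟩ | ⟨-, rfl⟩ <;> norm_num

theorem sign_mul_mem_interior {τ : ℝ} : σ * τ ∈ interior S ↔ 0 < τ := by
  rcases hS with ⟨rfl, rfl⟩ | ⟨rfl, rfl⟩ <;> simp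

theorem sign_mul_mem {τ : ℝ} : σ * τ ∈ S ↔ 0 ≤ τ := by
  rcases hS with ⟨rfl, rfl⟩ | ⟨rfl, rfl⟩ <;> simp

theorem sign_mul_self (s : ℝ) : σ * (σ * s) = s := by
  rcases hS with ⟨-, rfl⟩ | ⟨-, rfl⟩ <;> ring

/-- The substitution `s ↦ σ s` for integrals over compact windows, in a form common to both
half-lines. -/
theorem exists_sign_window {x y : ℝ} (hx : 0 < x) (hxy : x ≤ y) :
    ∃ c d, c ≤ d ∧ d - c = y - x ∧ Icc c d ⊆ interior S ∧
      (∀ s ∈ Icc c d, σ * s ∈ Icc x y) ∧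
      ∀ g : ℝ → ℝ, ∫ s in x..y, g (σ * s) = ∫ s in c..d, g s := by
  rcases hS with ⟨rfl, rfl⟩ | ⟨rfl, rfl⟩
  · exact ⟨x, y, hxy, rfl, by rw [interior_Ici]; exact fun s hs => hx.trans_le hs.1,
      fun s hs => by simpa using hs, fun g => by simp⟩
  · refine ⟨-y, -x, by linarith, by ring, by rw [interior_Iic]; exact fun s hs =>
      (by linarith [hs.2] : s < 0), fun s hs => ⟨by linarith [hs.2], by linarith [hs.1]⟩, fun g => ?_⟩
    simp

end Sign

namespace LiouvilleCompletion

variable {n : ℕ}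
  {M : Type*} [TopologicalSpace M] [T2Space M]
  [ChartedSpace (EuclideanSpace ℝ (Fin (2 * n))) M] [IsManifold (𝓡 (2 * n)) ∞ M]
  {N : Type*} [TopologicalSpace N] [ChartedSpace (EuclideanSpace ℝ (Fin (2 * n - 1))) N]
  [IsManifold (𝓡 (2 * n - 1)) ∞ N]
  (D : LiouvilleCompletion n M N)
  {J : ℝ → ∀ p : M, TangentSpace (𝓡 (2 * n)) p →L[ℝ] TangentSpace (𝓡 (2 * n)) p}
  {S : Set ℝ} {H : ℝ → M → ℝ} {u : ℝ → ℝ → M} {η : ℝ → ℝ} {r₀ : ℝ} {h : ℝ → ℝ → ℝ} {σ : ℝ}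

/-- The height of a solution as a function on a half-cylinder. -/
theorem IsSolution.cylJet_height (sol : D.IsSolution J S H u η) {a : ℝ} (ha : 0 ≤ a) :
    CylJet (interior S) (fun s t => D.height a u (s, t))
      (fun s t => fderiv ℝ (D.height a u) (s, t) (1, 0))
      (fun s t => fderiv ℝ (D.height a u) (s, t) (0, 1))
      (fun s t => fderiv ℝ (fun x => fderiv ℝ (D.height a u) x (1, 0)) (s, t) (1, 0))
      (fun s t => fderiv ℝ (fun x => fderiv ℝ (D.height a u) x (0, 1)) (s, t) (0, 1)) := by
  have hΩ := isOpen_interior_prod (S := S)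
  have hF := sol.contDiffOn_height_interior D ha
  have hF1 : ∀ v : ℝ × ℝ, ContDiffOn ℝ ∞ (fun x => fderiv ℝ (D.height a u) x v)
      (interior S ×ˢ univ) := fun v =>
    (hF.fderiv_of_isOpen (m := ∞) hΩ (by simp)).clm_apply contDiffOn_const
  have hd : ∀ {g : ℝ × ℝ → ℝ}, ContDiffOn ℝ ∞ g (interior S ×ˢ univ) → ∀ s ∈ interior S, ∀ t,
      DifferentiableAt ℝ g (s, t) := fun hg s hs t =>
    (hg.contDiffAt (hΩ.mem_nhds ⟨hs, mem_univ _⟩)).differentiableAt (by simp)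
  exact
  { isOpen := isOpen_interior
    fst := fun s hs t => hasDerivAt_fst_line (hd hF s hs t)
    snd := fun s hs t => hasDerivAt_snd_line (hd hF s hs t)
    fst_fst := fun s hs t => hasDerivAt_fst_line (hd (hF1 (1, 0)) s hs t)
    snd_snd := fun s hs t => hasDerivAt_snd_line (hd (hF1 (0, 1)) s hs t)
    cont := hF.continuousOn
    cont_fst := (hF1 (1, 0)).continuousOn
    cont_snd := (hF1 (0, 1)).continuousOn
    cont_fst_fst := ((hF1 (1, 0)).continuousOn_fderiv_of_isOpen hΩ (by simp)).clm_apply continuousOn_const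
    cont_snd_snd := ((hF1 (0, 1)).continuousOn_fderiv_of_isOpen hΩ (by simp)).clm_apply continuousOn_const
    periodic := fun s hs t => by
      simp only [height]
      rw [sol.u_periodic s (interior_subset hs) t] }

/-- The height in the variable `τ = |s|`. -/
theorem IsSolution.cylJet_height_sign (hS : S = Ici 0 ∧ σ = 1 ∨ S = Iic 0 ∧ σ = -1)
    (sol : D.IsSolution J S H u η) {a : ℝ} (ha : 0 ≤ a) :
    CylJet (Ioi 0) (fun s t => D.height a u (σ * s, t))
      (fun s t => σ * fderiv ℝ (D.height a u) (σ * s, t) (1, 0))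
      (fun s t => fderiv ℝ (D.height a u) (σ * s, t) (0, 1))
      (fun s t => σ ^ 2 * fderiv ℝ (fun x => fderiv ℝ (D.height a u) x (1, 0)) (σ * s, t) (1, 0))
      (fun s t => fderiv ℝ (fun x => fderiv ℝ (D.height a u) x (0, 1)) (σ * s, t) (0, 1)) := by
  have h1 := (sol.cylJet_height D ha).rescale σ
  have h2 : (σ * ·) ⁻¹' interior S = Ioi 0 := by
    ext τ
    exact sign_mul_mem_interior hS
  rwa [h2] at h1

theorem IsSolution.energy_height_le (hS : S = Ici 0 ∧ σ = 1 ∨ S = Iic 0 ∧ σ = -1) (hr₀ : 0 < r₀)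
    (hJ : D.IsCompatibleLoop J) (hJr₀ : D.IsContactType J r₀) (hH : D.IsHamiltonianFamily S H r₀ h)
    (sol : D.IsSolution J S H u η) {a : ℝ} (ha : 0 ≤ a) (hra : Real.log r₀ < a) {E : ℝ} (hE0 : 0 ≤ E)
    (hE : D.EnergyBound J S H u η E) {x y : ℝ} (hx : 0 < x) (hxy : x ≤ y) :
    ∫ s in x..y, ∫ t in (0 : ℝ)..1, Real.exp (D.height a u (σ * s, t)) *
      ((σ * fderiv ℝ (D.height a u) (σ * s, t) (1, 0)) ^ 2 +
        fderiv ℝ (D.height a u) (σ * s, t) (0, 1) ^ 2) ≤ E := by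
  obtain ⟨c, d, hcd, -, hI, -, hg⟩ := exists_sign_window hS hx hxy
  have h1 := hg fun s => ∫ t in (0 : ℝ)..1, Real.exp (D.height a u (s, t)) *
      (fderiv ℝ (D.height a u) (s, t) (1, 0) ^ 2 + fderiv ℝ (D.height a u) (s, t) (0, 1) ^ 2)
  simp only [mul_pow, sign_sq hS, one_mul]
  rw [h1]
  have jF := sol.cylJet_height D ha
  have hm : Icc c d ×ˢ (univ : Set ℝ) ⊆ interior S ×ˢ univ := prod_mono hI le_rfl
  exact (integral_integral_mono (f := fun s t => Real.exp (D.height a u (s, t)) *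
      (fderiv ℝ (D.height a u) (s, t) (1, 0) ^ 2 + fderiv ℝ (D.height a u) (s, t) (0, 1) ^ 2)) hcd
    ((jF.cont.mono hm).rexp.mul (((jF.cont_fst.mono hm).pow 2).add ((jF.cont_snd.mono hm).pow 2)))
    ((sol.continuousOn_defectSq D hJ hH).mono hm) fun s hs t =>
      sol.exp_height_mul_le D hr₀ hJ hJr₀ hH ha hra (q := (s, t)) (hI hs)).trans
    (sol.energy_le D hJ hH hcd hI hE0 hE).1

/-- The differential inequality for the height. -/
theorem IsSolution.neg_weight_le_laplacian (hr₀ : 0 < r₀)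
    (hJ : D.IsCompatibleLoop J) (hJr₀ : D.IsContactType J r₀) (hH : D.IsHamiltonianFamily S H r₀ h)
    (sol : D.IsSolution J S H u η) {a : ℝ} (ha : 0 ≤ a) (hra : Real.log r₀ < a) {m C : ℝ} (hm : 0 ≤ m)
    (hHm : ∀ s ∈ S, ∀ w, -m ≤ H s w) {s t : ℝ} (hs : s ∈ interior S) (hη : |η s| ≤ C)
    (hh : ∀ r, r₀ ≤ r → 0 ≤ dRho r₀ h s r) {P : ℝ} (hP0 : 0 ≤ P)
    (hP : u s t ∈ D.openEnd r₀ →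
      m * dRho r₀ h s (D.radius (u s t)) + C * |dSRho S r₀ h s (D.radius (u s t))| ≤ P ∧
      C * (D.radius (u s t) * |dRhoRho r₀ h s (D.radius (u s t))|) ≤ P) :
    -(P * (1 + |fderiv ℝ (D.height a u) (s, t) (1, 0)|)) ≤
      fderiv ℝ (fun x => fderiv ℝ (D.height a u) x (1, 0)) (s, t) (1, 0) +
      fderiv ℝ (fun x => fderiv ℝ (D.height a u) x (0, 1)) (s, t) (0, 1) := by
  by_cases hw : u s t ∈ D.openEnd r₀
  · obtain ⟨h1, h2⟩ := hP hw
    have h3 : -m ≤ ∫ t in (0 : ℝ)..1, H s (u s t) := by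
      have hc : Continuous fun t => H s (u s t) :=
        ((hH.contMDiff D (interior_subset hs)).continuous).comp
          (sol.contMDiff_slice D (interior_subset hs)).continuous
      have h4 := intervalIntegral.integral_mono_on (μ := volume) zero_le_one
        (intervalIntegrable_const (c := -m)) (hc.intervalIntegrable 0 1)
        fun t _ => hHm s (interior_subset hs) (u s t)
      simpa using h4
    refine le_trans ?_ (sol.laplacian_height D hr₀ hJ hJr₀ hH ha (q := (s, t)) hs hw hm h3 hη
      (hh _ hw.2.le))
    have h5 := mul_le_mul_of_nonneg_right h2 (abs_nonneg (fderiv ℝ (D.height a u) (s, t) (1, 0)))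
    simp only
    linarith
  · have h0 := sol.height_eventuallyEq_zero D ha hra (q := (s, t)) hs hw
    have h1 : ∀ v : ℝ × ℝ, (fun x => fderiv ℝ (D.height a u) x v) =ᶠ[𝓝 (s, t)] fun _ => 0 := by
      intro v
      filter_upwards [h0.fderiv (𝕜 := ℝ)] with x hx
      rw [hx]
      simp
    have h2 : fderiv ℝ (D.height a u) (s, t) (1, 0) = 0 := (h1 (1, 0)).self_of_nhds
    rw [(h1 _).fderiv_eq, (h1 _).fderiv_eq, h2]
    simpa using hP0

/-- The coefficient in the differential inequality for the height, with its integral bound. -/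
theorem exists_weight (hS : S = Ici 0 ∧ σ = 1 ∨ S = Iic 0 ∧ σ = -1) (hr₀ : 0 < r₀)
    (hJ : D.IsCompatibleLoop J) (hJr₀ : D.IsContactType J r₀) (hH : D.IsHamiltonianFamily S H r₀ h)
    (hg : PolynomialGrowth S r₀ h ∨ QuadraticGrowth S r₀ h) {a : ℝ} (ha : 0 ≤ a)
    (hra : Real.log r₀ < a) {m C E : ℝ} (hm : 0 ≤ m) (hHm : ∀ s ∈ S, ∀ w, -m ≤ H s w) (hC : 0 ≤ C)
    (hE0 : 0 ≤ E) (ℓ : ℝ) :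
    ∃ B : ℝ, ∀ (u : ℝ → ℝ → M) (η : ℝ → ℝ), D.IsSolution J S H u η → D.EnergyBound J S H u η E →
      ∃ P : ℝ → ℝ → ℝ, ContinuousOn (fun q : ℝ × ℝ => P q.1 q.2) (interior S ×ˢ univ) ∧
        (∀ s ∈ interior S, ∀ t, 0 ≤ P s t) ∧ (∀ s ∈ interior S, ∀ t, P s (t + 1) = P s t) ∧
        (∀ s ∈ interior S, ∀ t, u s t ∈ D.openEnd r₀ →
          m * dRho r₀ h s (D.radius (u s t)) + C * |dSRho S r₀ h s (D.radius (u s t))| ≤ P s t ∧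
          C * (D.radius (u s t) * |dRhoRho r₀ h s (D.radius (u s t))|) ≤ P s t) ∧
        ∀ x y, 0 < x → x ≤ y → y - x ≤ ℓ → (∀ t, D.height a u (σ * y, t) = 0) →
          ∫ s in x..y, (∫ t in (0 : ℝ)..1, P (σ * s) t ^ 2) ^ 2 ≤ B := by
  rcases hg with hg | hg
  · obtain ⟨c, k, hc, hck⟩ := hH.exists_exp_weight D (sign_halfLine hS) hr₀ hg hm hC ha
    obtain ⟨B, hB⟩ := CylJet.exists_exp_weight_bound ℓ E c k
    refine ⟨B, fun u η sol hE => ⟨fun s t => c * Real.exp (k * D.height a u (s, t)), ?_, ?_, ?_, ?_, ?_⟩⟩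
    · exact continuousOn_const.mul (continuousOn_const.mul (sol.cylJet_height D ha).cont).rexp
    · exact fun s _ t => by positivity
    · intro s hs t
      have := (sol.cylJet_height D ha).periodic s hs t
      change c * Real.exp (k * D.height a u (s, t + 1)) = c * Real.exp (k * D.height a u (s, t))
      rw [this]
    · exact fun s hs t hw => hck s (interior_subset hs) (u s t) hw
    · intro x y hx hxy hℓ hy
      exact hB (sol.cylJet_height_sign D hS ha) hxy (fun s hs => hx.trans_le hs.1) hy hℓ
        (sol.energy_height_le D hS hr₀ hJ hJr₀ hH ha hra hE0 hE hx hxy)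
  · obtain ⟨κ, hκ, hκP⟩ := hH.exists_sqrt_weight D hr₀ hg hm hC
    -- With `P = κ √(H + m + 1)` one has `∫ P² dt = κ² (η' + m + 1)`. The constant comes from `(x +
    -- y)² ≤ 2x² + 2y²` and `∫ η'² ≤ E`.
    refine ⟨κ ^ 4 * (2 * E + 2 * (m + 1) ^ 2 * ℓ), fun u η sol hE =>
      ⟨fun s t => κ * √(H s (u s t) + m + 1), ?_, ?_, ?_, ?_, ?_⟩⟩
    · exact continuousOn_const.mul ((((sol.continuousOn_hamiltonian D hH).mono
        (prod_mono interior_subset le_rfl)).add continuousOn_const).add continuousOn_const).sqrt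
    · exact fun s _ t => by positivity
    · intro s hs t
      simp only
      rw [sol.u_periodic s (interior_subset hs) t]
    · exact fun s hs t hw => hκP s (interior_subset hs) (u s t) hw
    · intro x y hx hxy hℓ _
      obtain ⟨c, d, hcd, hlen, hI, -, hg'⟩ := exists_sign_window hS hx hxy
      rw [hg' fun s => (∫ t in (0 : ℝ)..1, (κ * √(H s (u s t) + m + 1)) ^ 2) ^ 2]
      obtain ⟨-, c2⟩ := sol.continuousOn_gradNormSq D hJ hH hI
      have h1 : ∀ s ∈ Icc c d, ∫ t in (0 : ℝ)..1, (κ * √(H s (u s t) + m + 1)) ^ 2 =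
          κ ^ 2 * ((∫ t in (0 : ℝ)..1, H s (u s t)) + (m + 1)) := by
        intro s hs
        have hsS := interior_subset (hI hs)
        have hc : Continuous fun t => H s (u s t) :=
          ((hH.contMDiff D hsS).continuous).comp (sol.contMDiff_slice D hsS).continuous
        have h2 : ∀ t, (κ * √(H s (u s t) + m + 1)) ^ 2 = κ ^ 2 * (H s (u s t) + (m + 1)) := by
          intro t
          rw [mul_pow, Real.sq_sqrt (by linarith [hHm s hsS (u s t)]), add_assoc]
        simp only [h2]
        rw [intervalIntegral.integral_const_mul, intervalIntegral.integral_add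
          (hc.intervalIntegrable _ _) intervalIntegrable_const]
        simp
      have i2 : IntervalIntegrable (fun s => (∫ t in (0 : ℝ)..1, H s (u s t)) ^ 2) volume c d := by
        refine ContinuousOn.intervalIntegrable ?_
        rw [uIcc_of_le hcd]
        exact c2.pow 2
      have i3 : IntervalIntegrable (fun s => (κ ^ 2 * ((∫ t in (0 : ℝ)..1, H s (u s t)) + (m + 1))) ^ 2)
          volume c d := by
        refine ContinuousOn.intervalIntegrable ?_
        rw [uIcc_of_le hcd]
        exact (continuousOn_const.mul (c2.add continuousOn_const)).pow 2
      rw [intervalIntegral.integral_congr (g := fun s =>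
        (κ ^ 2 * ((∫ t in (0 : ℝ)..1, H s (u s t)) + (m + 1))) ^ 2) fun s hs => by
          rw [uIcc_of_le hcd] at hs
          simp only [h1 s hs]]
      have h3 := intervalIntegral.integral_mono_on hcd i3
        (((i2.const_mul 2).add (intervalIntegrable_const (c := 2 * (m + 1) ^ 2))).const_mul (κ ^ 4))
        fun s _ => by
          have : (κ ^ 2 * ((∫ t in (0 : ℝ)..1, H s (u s t)) + (m + 1))) ^ 2 =
            κ ^ 4 * ((∫ t in (0 : ℝ)..1, H s (u s t)) + (m + 1)) ^ 2 := by ring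
          rw [this]
          refine mul_le_mul_of_nonneg_left ?_ (by positivity)
          nlinarith [sq_nonneg ((∫ t in (0 : ℝ)..1, H s (u s t)) - (m + 1))]
      rw [intervalIntegral.integral_const_mul, intervalIntegral.integral_add (i2.const_mul 2)
        intervalIntegrable_const, intervalIntegral.integral_const_mul, intervalIntegral.integral_const,
        smul_eq_mul, hlen] at h3
      refine h3.trans (mul_le_mul_of_nonneg_left ?_ (by positivity))
      have h4 := (sol.energy_le D hJ hH hcd hI hE0 hE).2.1
      nlinarith [sq_nonneg (m + 1)]

end LiouvilleCompletion
end RabinowitzFloer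

/-! ### Conclusion -/

namespace RabinowitzFloer
namespace LiouvilleCompletion

variable {n : ℕ}
  {M : Type*} [TopologicalSpace M] [T2Space M]
  [ChartedSpace (EuclideanSpace ℝ (Fin (2 * n))) M] [IsManifold (𝓡 (2 * n)) ∞ M]
  {N : Type*} [TopologicalSpace N] [ChartedSpace (EuclideanSpace ℝ (Fin (2 * n - 1))) N]
  [IsManifold (𝓡 (2 * n - 1)) ∞ N]
  (D : LiouvilleCompletion n M N)
  {J : ℝ → ∀ p : M, TangentSpace (𝓡 (2 * n)) p →L[ℝ] TangentSpace (𝓡 (2 * n)) p}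
  {S : Set ℝ} {H : ℝ → M → ℝ} {u : ℝ → ℝ → M} {η : ℝ → ℝ} {r₀ : ℝ} {h : ℝ → ℝ → ℝ} {σ : ℝ}

/-- The boundary condition gives a one-sided bound on the derivative of the height near `s = 0`. -/
theorem IsSolution.exists_boundary_bound (hS : S = Ici 0 ∧ σ = 1 ∨ S = Iic 0 ∧ σ = -1) (hr₀ : 0 < r₀)
    (hJr₀ : D.IsContactType J r₀) (sol : D.IsSolution J S H u η) {a : ℝ} (ha : 0 ≤ a)
    (hra : Real.log r₀ < a) {ν : ℝ} (hν : 0 ≤ ν)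
    (hb : ∀ t, u 0 t ∈ D.cylEnd r₀ → σ * D.alphaCyl (u 0 t)
      (velocity (2 * n) (u 0) t - η 0 • D.hamVF (H 0) (u 0 t)) ≤ ν) :
    ∃ δ, 0 < δ ∧ ∀ s, 0 < s → s < δ → ∀ t,
      -(ν + 1) ≤ σ * fderiv ℝ (D.height a u) (σ * s, t) (1, 0) := by
  have h0 : (0 : ℝ) ∈ S := by simpa using (sign_mul_mem hS (τ := 0)).2 le_rfl
  choose p hp0 hp1 hpw hp using fun t => sol.hasDerivWithinAt_height D hr₀ hJr₀ ha hra h0 t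
  -- The derivative in `τ` at the boundary is `-p σ α(…)` with `0 ≤ p ≤ 1`; as `ν ≥ 0`, the factor
  -- `p` preserves the bound `-ν`.
  obtain ⟨δ, hδ, hδb⟩ := exists_fst_derivative_bound (sign_halfLine hS) (sol.contDiffOn_height D ha)
    (c := σ) (ν := ν) hp fun t => by
      by_cases hw : u 0 t ∈ D.cylEnd r₀
      · have h1 := hb t hw
        have h2 : p t * (σ * D.alphaCyl (u 0 t)
          (velocity (2 * n) (u 0) t - η 0 • D.hamVF (H 0) (u 0 t))) ≤ ν := by
          nlinarith [hp0 t, hp1 t, mul_le_mul_of_nonneg_left h1 (hp0 t)]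
        linarith
      · rw [hpw t hw]
        simpa using hν
  refine ⟨δ, hδ, fun s hs hsδ t => ?_⟩
  have hs' : σ * s ∈ interior S := (sign_mul_mem_interior hS).2 hs
  have h1 := eq_fract_of_periodic (f := fun t => fderiv ℝ (D.height a u) (σ * s, t) (1, 0))
    (fun t => (sol.cylJet_height D ha).periodic_fst hs' t) t
  rw [h1]
  refine hδb _ hs' ?_ _ ⟨Int.fract_nonneg t, (Int.fract_lt_one t).le⟩
  rwa [abs_mul, sign_abs hS, one_mul, abs_of_pos hs]

/-- The uniform bound on solutions over a half-line, in the direction of the sign `σ`. -/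
theorem exists_compact_of_sign (hS : S = Ici 0 ∧ σ = 1 ∨ S = Iic 0 ∧ σ = -1) (hr₀ : 0 < r₀)
    (hJ : D.IsCompatibleLoop J) (hJr₀ : D.IsContactType J r₀) (hH : D.IsHamiltonianFamily S H r₀ h)
    (hg : PolynomialGrowth S r₀ h ∨ QuadraticGrowth S r₀ h) {A E ν : ℝ} (hE0 : 0 ≤ E) (hν : 0 ≤ ν) :
    ∃ K : Set M, IsCompact K ∧
      ∀ (u : ℝ → ℝ → M) (η : ℝ → ℝ), D.IsSolution J S H u η → D.ActionBound S H u η A →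
        D.EnergyBound J S H u η E →
        (∀ t, u 0 t ∈ D.cylEnd r₀ → σ * D.alphaCyl (u 0 t)
          (velocity (2 * n) (u 0) t - η 0 • D.hamVF (H 0) (u 0 t)) ≤ ν) →
        ∀ s ∈ S, ∀ t, u s t ∈ K := by
  obtain ⟨μ, hμ, hhμ, hh⟩ : ∃ μ, 0 < μ ∧ (∀ s ∈ S, ∀ r, r₀ ≤ r → μ ≤ h s r) ∧
      ∀ s ∈ S, ∀ r, r₀ ≤ r → 0 ≤ dRho r₀ h s r := by
    rcases hg with ⟨κ, γ, hκ, -, hg⟩ | ⟨⟨μ, hμ, hhμ⟩, κ, -, hg⟩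
    · refine ⟨r₀ / κ, by positivity, fun s hs r hr => ?_, fun s hs r hr => (hg s hs r hr).1⟩
      exact le_trans (by gcongr) (hg s hs r hr).2.1
    · exact ⟨μ, hμ, hhμ, fun s hs r hr => (hg s hs r hr).1⟩
  obtain ⟨m, hm, hHm⟩ := hH.exists_lower_bound D (sign_halfLine hS) hr₀
    fun s hs r hr => hμ.trans_le (hhμ s hs r hr)
  obtain ⟨L, C, hL, hC, hgood⟩ := hH.exists_good D hJ hr₀ (sign_halfLine hS) hμ hhμ A E hE0
  -- Both `a ≥ 0` and `a > log r₀` are needed for the height to vanish near points outside `ρ > r₀`.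
  set a := |Real.log r₀| + 1 with ha'
  have ha : 0 ≤ a := by positivity
  have hra : Real.log r₀ < a := by linarith [le_abs_self (Real.log r₀)]
  obtain ⟨CW, hCW⟩ := D.exists_weight hS hr₀ hJ hJr₀ hH hg ha hra hm hHm hC hE0 (2 * L)
  obtain ⟨B, -, hB⟩ := CylJet.exists_halfLine_bound (L := L) (ν := ν + 1) (by linarith) E CW
  -- A height of at most `B` means `log ρ ≤ B + a + 1`.
  refine ⟨D.filled (max 1 (Real.exp (B + a + 1))), D.isCompact_filled (le_max_left _ _),
    fun u η sol hA hE hb => ?_⟩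
  obtain ⟨hzero, hη⟩ := hgood u η sol hA hE
  obtain ⟨P, hPc, hP0, hPp, hPw, hPi⟩ := hCW u η sol hE
  have hint : ∀ {s}, 0 < s → σ * s ∈ interior S := fun hs => (sign_mul_mem_interior hS).2 hs
  have hmain : ∀ s, 0 < s → ∀ t, D.height a u (σ * s, t) ≤ B := by
    refine hB (P := fun s t => P (σ * s) t) (sol.cylJet_height_sign D hS ha)
      (fun s _ t => D.exhaustion_nonneg a _)
      (fun x y hx hxy => sol.energy_height_le D hS hr₀ hJ hJr₀ hH ha hra hE0 hE hx hxy)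
      ?_ (fun s hs t => hP0 _ (hint hs) t) (fun s hs t => hPp _ (hint hs) t) (fun s hs t => ?_)
      (fun x y hx hxy hl hy => hPi x y hx hxy hl hy) (fun s hs => ?_)
      (sol.exists_boundary_bound D hS hr₀ hJr₀ ha hra hν hb)
    · exact hPc.comp (f := fun q : ℝ × ℝ => (σ * q.1, q.2)) (by fun_prop)
        fun q hq => ⟨hint hq.1, mem_univ _⟩
    · rw [abs_mul, sign_abs hS, one_mul, sign_sq hS, one_mul]
      exact sol.neg_weight_le_laplacian D hr₀ hJ hJr₀ hH ha hra hm hHm (hint hs) (hη _ (hint hs))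
        (hh _ (interior_subset (hint hs))) (hP0 _ (hint hs) t) (hPw _ (hint hs) t)
    · obtain ⟨c, d, -, hlen, hI, hwin, -⟩ := exists_sign_window hS hs (by linarith : s ≤ s + L)
      have hd : d = c + L := by linarith
      subst hd
      obtain ⟨x, hx, hxw⟩ := hzero c hI
      refine ⟨σ * x, hwin x hx, fun t => ?_⟩
      rw [sign_mul_self hS]
      exact (D.exhaustion_eq_zero ha hra
        fun hw => hxw t (D.openEnd_subset hr₀ hw)).self_of_nhds
  have hall : ∀ s ∈ S, ∀ t, D.height a u (s, t) ≤ B := by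
    intro s hs t
    have h1 : 0 ≤ σ * s := by
      rw [← sign_mul_self hS s] at hs
      exact (sign_mul_mem hS).1 hs
    rcases h1.eq_or_lt with h2 | h2
    -- The boundary slice is not covered by the estimate on the open half-line and is reached by
    -- continuity.
    · have hs0 : s = 0 := by
        have := sign_mul_self hS s
        rw [← h2, mul_zero] at this
        exact this.symm
      subst hs0
      have h3 : Tendsto (fun τ => D.height a u (σ * τ, t)) (𝓝[>] 0) (𝓝 (D.height a u (0, t))) := by
        have h4 : ContinuousOn (fun τ => D.height a u (σ * τ, t)) (Ici 0) :=
          (sol.contDiffOn_height D ha).continuousOn.comp (f := fun τ : ℝ => (σ * τ, t)) (by fun_prop)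
            fun τ hτ => ⟨(sign_mul_mem hS).2 hτ, mem_univ _⟩
        have h5 := (h4 0 self_mem_Ici).mono Ioi_subset_Ici_self
        simpa [ContinuousWithinAt] using h5
      exact le_of_tendsto h3 (by filter_upwards [self_mem_nhdsWithin] with τ hτ using hmain τ hτ t)
    · have := hmain _ h2 t
      rwa [sign_mul_self hS] at this
  intro s hs t
  by_contra hcon
  obtain ⟨h1, h2⟩ := (D.mem_filled_compl (by positivity)).1 hcon
  have h3 : Real.exp (B + a + 1) < D.radius (u s t) := (le_max_right _ _).trans_lt h2
  rw [← Real.lt_log_iff_exp_lt (D.radius_pos h1)] at h3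
  have h4 := D.log_radius_le (a := a) h1
  have h5 : D.exhaustion a (u s t) ≤ B := hall s hs t
  linarith

end LiouvilleCompletion
end RabinowitzFloer

theorem mainTheorem5 {n : ℕ}
    {M : Type*} [TopologicalSpace M] [T2Space M]
    [ChartedSpace (EuclideanSpace ℝ (Fin (2 * n))) M] [IsManifold (𝓡 (2 * n)) ∞ M]
    {N : Type*} [TopologicalSpace N] [T2Space N]
    [ChartedSpace (EuclideanSpace ℝ (Fin (2 * n - 1))) N] [IsManifold (𝓡 (2 * n - 1)) ∞ N]
    (D : RabinowitzFloer.LiouvilleCompletion n M N)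
    (J : ℝ → ∀ p : M, TangentSpace (𝓡 (2 * n)) p →L[ℝ] TangentSpace (𝓡 (2 * n)) p)
    (hJ : D.IsCompatibleLoop J)
    (r₀ : ℝ) (hr₀ : 0 < r₀) (hJr₀ : D.IsContactType J r₀) :
    -- solutions on the half-line `[0, ∞)`
    (∀ (H : ℝ → M → ℝ) (h : ℝ → ℝ → ℝ),
      D.IsHamiltonianFamily (Ici 0) H r₀ h →
      (RabinowitzFloer.PolynomialGrowth (Ici 0) r₀ h ∨
        RabinowitzFloer.QuadraticGrowth (Ici 0) r₀ h) →
      ∀ A E ν : ℝ, 0 < A → 0 < E → 0 < ν →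
        ∃ K : Set M, IsCompact K ∧
          ∀ (u : ℝ → ℝ → M) (η : ℝ → ℝ), D.IsSolution J (Ici 0) H u η →
            D.ActionBound (Ici 0) H u η A →
            D.EnergyBound J (Ici 0) H u η E →
            (∀ t, u 0 t ∈ D.cylEnd r₀ →
              D.alphaCyl (u 0 t)
                (RabinowitzFloer.velocity (2 * n) (u 0) t - η 0 • D.hamVF (H 0) (u 0 t)) ≤ ν) →
            -ν ≤ η 0 →
            ∀ s ∈ Ici (0 : ℝ), ∀ t, u s t ∈ K) ∧
    -- solutions on the half-line `(-∞, 0]`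
    (∀ (H : ℝ → M → ℝ) (h : ℝ → ℝ → ℝ),
      D.IsHamiltonianFamily (Iic 0) H r₀ h →
      (RabinowitzFloer.PolynomialGrowth (Iic 0) r₀ h ∨
        RabinowitzFloer.QuadraticGrowth (Iic 0) r₀ h) →
      ∀ A E ν : ℝ, 0 < A → 0 < E → 0 < ν →
        ∃ K : Set M, IsCompact K ∧
          ∀ (u : ℝ → ℝ → M) (η : ℝ → ℝ), D.IsSolution J (Iic 0) H u η →
            D.ActionBound (Iic 0) H u η A →
            D.EnergyBound J (Iic 0) H u η E →
            (∀ t, u 0 t ∈ D.cylEnd r₀ →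
              -ν ≤ D.alphaCyl (u 0 t)
                (RabinowitzFloer.velocity (2 * n) (u 0) t - η 0 • D.hamVF (H 0) (u 0 t))) →
            η 0 ≤ ν →
            ∀ s ∈ Iic (0 : ℝ), ∀ t, u s t ∈ K) := by
  refine ⟨fun H h hH hg A E ν _ hE hν => ?_, fun H h hH hg A E ν _ hE hν => ?_⟩
  · obtain ⟨K, hK, hKu⟩ := D.exists_compact_of_sign (σ := 1) (A := A) (Or.inl ⟨rfl, rfl⟩) hr₀ hJ hJr₀
      hH hg hE.le hν.le
    exact ⟨K, hK, fun u η sol hA hEb hb _ => hKu u η sol hA hEb fun t ht => by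
      rw [one_mul]
      exact hb t ht⟩
  -- With `σ = -1` the condition `σ α(…) ≤ ν` is the assumed lower bound `-ν`.
  · obtain ⟨K, hK, hKu⟩ := D.exists_compact_of_sign (σ := -1) (A := A) (Or.inr ⟨rfl, rfl⟩) hr₀ hJ hJr₀
      hH hg hE.le hν.le
    exact ⟨K, hK, fun u η sol hA hEb hb _ => hKu u η sol hA hEb fun t ht => by
      linarith [hb t ht]⟩
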